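/- Conventions. Let $R$ be a regular local ring with maximal ideal $\mathfrak m$, residue field $\mathbb K=R/\mathfrak m$, regular system of parameters $x_1,\dots,x_n$ and $\mathfrak m$-adic completion $\widehat R$ (which has residue field $\mathbb K$ and parameters the images of $x_1,\dots,x_n$). Every $f\in R[y]$ has a finite expansion $f=\sum_{(\alpha,j)\in\mathbb Z_{\ge 0}^{n}\times\mathbb Z_{\geq 0}} a_{\alpha,j}\,x^{\alpha}y^{j}$ with each $a_{\alpha,j}$ either $0$ or a unit of $R$. Its Newton polyhedron $\Delta(f)\subset\mathbb R_{\ge0}^{n+1}$ is the convex hull of $\{(\alpha,j): a_{\alpha,j}\ne0\}+\mathbb R_{\ge 0}^{n+1}$. A face of $\Delta(f)$ is a set $\Delta(f)^{\xi}=\{a\in\Delta(f):\langle\xi,a\rangle=\min_{b\in\Delta(f)}\langle\xi,b\rangle\}$ with $\xi\in\mathbb R_{\ge0}^{n+1}$. A loose edge is a compact face of dimension $1$ that is not contained in any compact face of dimension $\ge2$. A segment $E\subset\mathbb R^{n+1}$ is descendant if it is parallel to a vector $c$ with $c_1,\dots,c_n\ge0$ and $c_{n+1}<0$. For a compact face $A$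 put $f|_A=\sum_{(\alpha,j)\in A}\overline{a}_{\alpha,j}X^{\alpha}y^{j}\in\mathbb K[X_1,\dots,X_n][y]$, where $\overline a$ is the residue class of $a$. The same definitions apply to $\widehat R$. Theorem. Let $f\in R[y]$, let $E$ be a loose and descendant edge of $\Delta(f)$, and suppose that $f|_E=GH$ with relatively prime $G,H\in\mathbb K[X_1,\dots,X_n][y]$, $G$ monic in $y$. Then there are $g,h\in\widehat R[y]$ such that $f=gh$, $g$ is monic in $y$ of degree $\deg_y g=\deg_y G$, and $g|_{E_1}=G$, $h|_{E_2}=H$ for some compact faces $E_1$ of $\Delta(g)$ and $E_2$ of $\Delta(h)$ with $E=E_1+E_2$ (Minkowski sum). If $R=\mathbb K[\![x_1,\dots,x_n]\!]$ for a field $\mathbb K$ (so that $\widehat R=R$), then the pair $(g,h)$ with these properties exists in $R[y]$ and is unique. -/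

import Mathlib

open scoped Pointwise

namespace LooseEdge

section Expansions

variable {S : Type*} [CommRing S] {n : ℕ}

/-- A finite expansion `f = ∑ a_{α,j} x^α y^j` of a polynomial `f ∈ S[y]` in the elements
`x_1, …, x_n` of `S`, each coefficient `a_{α,j} ∈ S` being zero or a unit. The family of
coefficients is recorded as a polynomial `P ∈ S[X_1, …, X_n][y]`, so `a_{α,j}` is
`(P.coeff j).coeff α`. -/
structure IsExpansion (x : Fin n → S) (f : Polynomial S)
    (P : Polynomial (MvPolynomial (Fin n) S)) : Prop where
  zero_or_isUnit : ∀ (j : ℕ) (α : Fin n →₀ ℕ),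
    (P.coeff j).coeff α = 0 ∨ IsUnit ((P.coeff j).coeff α)
  map_eval : P.map (MvPolynomial.eval x) = f

/-- `x_1, …, x_n` is a regular system of parameters of the local ring `S`: it generates the
maximal ideal and `n = dim S`. -/
structure IsRegularSystemOfParameters [IsLocalRing S] (x : Fin n → S) : Prop where
  span_range : Ideal.span (Set.range x) = IsLocalRing.maximalIdeal S
  dim_eq : ringKrullDim S = n

/-- The exponent `(α, j)` as a point of `ℝ^{n+1} = ℝ^n × ℝ`; the last coordinate belongs to `y`. -/
def point (α : Fin n →₀ ℕ) (j : ℕ) : (Fin n → ℝ) × ℝ :=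
  (fun i => (α i : ℝ), (j : ℝ))

/-- The Newton polyhedron read off from an expansion `P = (a_{α,j})`: the convex hull of
`{(α, j) : a_{α,j} ≠ 0} + ℝ_{≥0}^{n+1}`. -/
def newtonPolyhedron (P : Polynomial (MvPolynomial (Fin n) S)) : Set ((Fin n → ℝ) × ℝ) :=
  convexHull ℝ
    ({p | ∃ (j : ℕ) (α : Fin n →₀ ℕ), (P.coeff j).coeff α ≠ 0 ∧ p = point α j} + {v | 0 ≤ v})

open Classical in
/-- The symbolic restriction `∑_{(α,j) ∈ A} π(a_{α,j}) X^α y^j` of an expansion `P = (a_{α,j})`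
to a set `A`, where `π` is the residue map of the coefficient ring. -/
noncomputable def symbolicRestriction {k : Type*} [CommRing k] (π : S →+* k)
    (P : Polynomial (MvPolynomial (Fin n) S)) (A : Set ((Fin n → ℝ) × ℝ)) :
    Polynomial (MvPolynomial (Fin n) k) :=
  ∑ j ∈ P.support, Polynomial.monomial j
    (∑ α ∈ (P.coeff j).support with point α j ∈ A,
      MvPolynomial.monomial α (π ((P.coeff j).coeff α)))

end Expansions

section Polyhedra

variable {n : ℕ}

/-- The standard scalar product of `ℝ^{n+1} = ℝ^n × ℝ`. -/
def scalar (ξ a : (Fin n → ℝ) × ℝ) : ℝ := (∑ i, ξ.1 i * a.1 i) + ξ.2 * a.2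

/-- `Δ^ξ`, the set of points of `Δ` at which `⟨ξ, ·⟩` is minimal on `Δ`. -/
def face (Δ : Set ((Fin n → ℝ) × ℝ)) (ξ : (Fin n → ℝ) × ℝ) : Set ((Fin n → ℝ) × ℝ) :=
  {a | a ∈ Δ ∧ ∀ b ∈ Δ, scalar ξ a ≤ scalar ξ b}

/-- `A` is a face of `Δ`: `A = Δ^ξ` for some `ξ ∈ ℝ_{≥0}^{n+1}`. -/
def IsFace (Δ A : Set ((Fin n → ℝ) × ℝ)) : Prop :=
  ∃ ξ : (Fin n → ℝ) × ℝ, 0 ≤ ξ ∧ A = face Δ ξ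

/-- `A` is a compact face of `Δ`. -/
def IsCompactFace (Δ A : Set ((Fin n → ℝ) × ℝ)) : Prop :=
  IsFace Δ A ∧ IsCompact A

/-- The dimension of (the affine hull of) a set. -/
noncomputable def dim (A : Set ((Fin n → ℝ) × ℝ)) : ℕ := Module.finrank ℝ (vectorSpan ℝ A)

/-- `E` is a loose edge of `Δ`: a compact one-dimensional face that is not contained in any
compact face of dimension at least two. -/
def IsLooseEdge (Δ E : Set ((Fin n → ℝ) × ℝ)) : Prop :=
  IsCompactFace Δ E ∧ dim E = 1 ∧ ∀ A, IsCompactFace Δ A → 2 ≤ dim A → ¬ E ⊆ A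

/-- The segment `E` is parallel to a vector `c` with `c_1, …, c_n ≥ 0` and `c_{n+1} < 0`. -/
def IsDescendant (E : Set ((Fin n → ℝ) × ℝ)) : Prop :=
  ∃ c : (Fin n → ℝ) × ℝ, (∀ i, 0 ≤ c.1 i) ∧ c.2 < 0 ∧ vectorSpan ℝ E = Submodule.span ℝ {c}

end Polyhedra

section Factorizations

variable {S : Type*} [CommRing S] {n : ℕ}

/-- `f = g h` in `S[y]`, where `g` is monic of degree `deg_y G`, and `g|_{E₁} = G`, `h|_{E₂} = H`
for some compact faces `E₁` of `Δ(g)` and `E₂` of `Δ(h)` with `E = E₁ + E₂`. -/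
structure IsFactorizationAlong {k : Type*} [CommRing k] (x : Fin n → S) (π : S →+* k)
    (E : Set ((Fin n → ℝ) × ℝ)) (G H : Polynomial (MvPolynomial (Fin n) k))
    (f g h : Polynomial S) : Prop where
  eq_mul : f = g * h
  monic : g.Monic
  natDegree_eq : g.natDegree = G.natDegree
  restrictions : ∃ (P Q : Polynomial (MvPolynomial (Fin n) S)) (E₁ E₂ : Set ((Fin n → ℝ) × ℝ)),
    IsExpansion x g P ∧ IsExpansion x h Q ∧
    IsCompactFace (newtonPolyhedron P) E₁ ∧ IsCompactFace (newtonPolyhedron Q) E₂ ∧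
    symbolicRestriction π P E₁ = G ∧ symbolicRestriction π Q E₂ = H ∧ E = E₁ + E₂

end Factorizations

/-- The residue map `R̂ → R̂ / m R̂ = R / m` of the `m`-adic completion of a local ring. -/
noncomputable def completionResidue (R : Type*) [CommRing R] [IsLocalRing R] :
    AdicCompletion (IsLocalRing.maximalIdeal R) R →+* IsLocalRing.ResidueField R :=
  (AdicCompletion.evalOneₐ (IsLocalRing.maximalIdeal R)).toRingHom

section ExistenceOfExpansions

open MvPolynomial IsLocalRing

lemma mem_of_forall_mem_sup_pow {R : Type*} [CommRing R] [IsLocalRing R] [IsNoetherianRing R] (J : Ideal R) (r : R)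
    (N : ℕ) (h : ∀ k, N ≤ k → r ∈ J ⊔ maximalIdeal R ^ k) : r ∈ J := by
  have hh := IsHausdorff.of_isLocalRing (I := maximalIdeal R) (M := R ⧸ J) Ideal.IsPrime.ne_top'
  rw [← Ideal.Quotient.eq_zero_iff_mem]
  refine hh.haus' _ fun k => ?_
  rw [SModEq.zero]
  obtain ⟨a, ha, b, hb, rfl⟩ := Submodule.mem_sup.1 (h (max N k) (le_max_left _ _))
  rw [map_add, Ideal.Quotient.eq_zero_iff_mem.2 ha, zero_add]
  have hb' := Ideal.pow_le_pow_right (le_max_right N k) hb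
  have : (Ideal.Quotient.mk J) b = b • (1 : R ⧸ J) := by
    rw [Algebra.smul_def, mul_one]; rfl
  rw [this]
  exact Submodule.smul_mem_smul hb' trivial

lemma eval_monomial_mem_pow {R : Type*} [CommRing R] [IsLocalRing R] {n : ℕ} (x : Fin n → R)
    (hx : Ideal.span (Set.range x) = maximalIdeal R) (α : Fin n →₀ ℕ) :
    eval x (monomial α (1 : R)) ∈ maximalIdeal R ^ α.degree := by
  rw [← hx, Ideal.mem_span_pow_iff_exists_isHomogeneous]
  exact ⟨monomial α 1, isHomogeneous_monomial _ rfl, rfl⟩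

lemma eval_monomial_mem_mul {R : Type*} [CommRing R] [IsLocalRing R] {n : ℕ} (x : Fin n → R)
    (hx : Ideal.span (Set.range x) = maximalIdeal R) (α β : Fin n →₀ ℕ) (h : β ≤ α)
    (h' : β.degree < α.degree) (I : Ideal R) (hI : eval x (monomial β (1 : R)) ∈ I) :
    eval x (monomial α (1 : R)) ∈ maximalIdeal R * I := by
  obtain ⟨γ, rfl⟩ := exists_add_of_le h
  have : eval x (monomial (β + γ) (1 : R))
      = eval x (monomial γ (1 : R)) * eval x (monomial β (1 : R)) := by
    rw [← map_mul, monomial_mul, add_comm, one_mul]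
  rw [this]
  refine Ideal.mul_mem_mul ?_ hI
  have h2 := eval_monomial_mem_pow x hx γ
  refine Ideal.pow_le_self ?_ h2
  simp at h'
  exact h'.ne'

theorem exists_unit_expansion {R : Type*} [CommRing R] [IsLocalRing R] [IsNoetherianRing R] {n : ℕ}
    (x : Fin n → R) (hx : Ideal.span (Set.range x) = maximalIdeal R) (f : R) :
    ∃ p : MvPolynomial (Fin n) R, (∀ α, p.coeff α = 0 ∨ IsUnit (p.coeff α)) ∧ eval x p = f := by
  classical
  let m := maximalIdeal R
  let I : MvPolynomial (Fin n) R → Ideal R := fun p =>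
    Ideal.span ((fun α => eval x (monomial α (1 : R))) '' (p.support : Set (Fin n →₀ ℕ)))
  let J : MvPolynomial (Fin n) R → Ideal (MvPolynomial (Fin n) ℚ) := fun p =>
    Ideal.span ((fun α => monomial α (1 : ℚ)) '' (p.support : Set (Fin n →₀ ℕ)))
  let Good : MvPolynomial (Fin n) R → ℕ → Prop := fun p N =>
    (∀ α ∈ p.support, IsUnit (p.coeff α) ∧ α.degree < N) ∧ f - eval x p ∈ m * I p ⊔ m ^ N
  have h0 : Good 0 0 := by simp [Good]
  obtain ⟨_, ⟨⟨p, N⟩, hg, rfl⟩, hmax⟩ := set_has_maximal_iff_noetherian.2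
    (inferInstance : IsNoetherian (MvPolynomial (Fin n) ℚ) (MvPolynomial (Fin n) ℚ))
    ((fun q : MvPolynomial (Fin n) R × ℕ => J q.1) '' {q | Good q.1 q.2}) ⟨_, (0, 0), h0, rfl⟩
  simp only [Set.mem_ofPred_eq] at hg hmax
  have key : ∀ k, N ≤ k → f - eval x p ∈ m * I p ⊔ m ^ k := by
    intro k hk
    induction k, hk using Nat.le_induction with
    | base => exact hg.2
    | succ k hk ih =>
      obtain ⟨s, hs, r, hr, hsr⟩ := Submodule.mem_sup.1 ih
      have hr' : r ∈ Ideal.span (Set.range x) ^ k := by rw [hx]; exact hr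
      rw [Ideal.mem_span_pow_iff_exists_isHomogeneous] at hr'
      obtain ⟨q, hq, rfl⟩ := hr'
      have hcase : ∀ α ∈ q.support, (∀ β ∈ p.support, ¬ β ≤ α) → ¬ IsUnit (q.coeff α) := by
        by_contra! hc
        obtain ⟨α₀, hα₀, hα₁, hα₂⟩ := hc
        let T := q.support.filter (fun α => (∀ β ∈ p.support, ¬ β ≤ α) ∧ IsUnit (q.coeff α))
        let t : MvPolynomial (Fin n) R := ∑ α ∈ T, monomial α (q.coeff α)
        have htc : ∀ α, t.coeff α = if α ∈ T then q.coeff α else 0 := by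
          intro α; simp [t, coeff_sum, coeff_monomial]
        have hpT : ∀ α ∈ T, p.coeff α = 0 := by
          intro α hα
          by_contra hne
          exact (Finset.mem_filter.1 hα).2.1 α (mem_support_iff.2 hne) le_rfl
        have hdeg : ∀ α ∈ q.support, α.degree = k := fun α hα => by
          have := hq (mem_support_iff.1 hα)
          rwa [Finsupp.degree_eq_weight_one]
        have hsupp : p.support ⊆ (p + t).support := by
          intro α hα
          rw [mem_support_iff, coeff_add, htc, if_neg, add_zero]
          · exact mem_support_iff.1 hα
          · exact fun h => mem_support_iff.1 hα (hpT α h)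
        have hIle : I p ≤ I (p + t) := Ideal.span_mono (Set.image_mono (by exact_mod_cast hsupp))
        have hgood : Good (p + t) (k + 1) := by
          refine ⟨fun α hα => ?_, ?_⟩
          · rw [mem_support_iff, coeff_add, htc] at hα
            rw [coeff_add, htc]
            by_cases hT : α ∈ T
            · rw [if_pos hT, hpT α hT, zero_add]
              exact ⟨(Finset.mem_filter.1 hT).2.2, by
                rw [hdeg α (Finset.mem_filter.1 hT).1]; omega⟩
            · rw [if_neg hT, add_zero] at hα ⊢
              have := hg.1 α (mem_support_iff.2 hα)
              exact ⟨this.1, by omega⟩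
          · have e : f - eval x (p + t) = s + ∑ α ∈ q.support \ T, eval x (monomial α (q.coeff α)) := by
              have h1 : eval x q = ∑ α ∈ q.support, eval x (monomial α (q.coeff α)) := by
                conv_lhs => rw [q.as_sum, map_sum]
              have h2 : eval x t = ∑ α ∈ T, eval x (monomial α (q.coeff α)) := by
                simp only [t, map_sum]
              rw [map_add, ← sub_sub, ← hsr, h1, h2,
                ← Finset.sum_sdiff (Finset.filter_subset _ _ : T ⊆ q.support)]
              ring
            rw [e]
            refine Ideal.add_mem _ (Ideal.mem_sup_left (Ideal.mul_mono_right hIle hs))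
              (Ideal.sum_mem _ fun α hα => ?_)
            obtain ⟨hα1, hα2⟩ := Finset.mem_sdiff.1 hα
            have e2 : eval x (monomial α (q.coeff α))
              = q.coeff α * eval x (monomial α (1 : R)) := by simp [eval_monomial]
            rw [e2]
            by_cases hβ : ∀ β ∈ p.support, ¬ β ≤ α
            · have hnu : ¬ IsUnit (q.coeff α) := fun hu =>
                hα2 (Finset.mem_filter.2 ⟨hα1, hβ, hu⟩)
              refine Ideal.mem_sup_right ?_
              rw [pow_succ']
              refine Ideal.mul_mem_mul ((mem_maximalIdeal _).2 hnu) ?_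
              have := eval_monomial_mem_pow x hx α
              rwa [hdeg α hα1] at this
            · push Not at hβ
              obtain ⟨β, hβ, hle⟩ := hβ
              refine Ideal.mem_sup_left (Ideal.mul_mono_right hIle (Ideal.mul_mem_left _ _ ?_))
              refine eval_monomial_mem_mul x hx α β hle ?_ _ (Ideal.subset_span ⟨β, hβ, rfl⟩)
              rw [hdeg α hα1]
              exact (hg.1 β hβ).2.trans_le hk
        refine hmax _ ⟨(p + t, k + 1), hgood, rfl⟩ (lt_of_le_not_ge
          (Ideal.span_mono (Set.image_mono (by exact_mod_cast hsupp))) fun hle => ?_)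
        have hmem : monomial α₀ (1 : ℚ) ∈ J (p + t) := by
          refine Ideal.subset_span ⟨α₀, ?_, rfl⟩
          have hT : α₀ ∈ T := Finset.mem_filter.2 ⟨hα₀, hα₁, hα₂⟩
          rw [Finset.mem_coe, mem_support_iff, coeff_add, htc, if_pos hT, hpT _ hT, zero_add]
          exact hα₂.ne_zero
        obtain ⟨β, hβ, hβα⟩ := mem_ideal_span_monomial_image.1 (hle hmem) α₀ (by
          simp [support_monomial])
        exact hα₁ β hβ hβα
      have hdeg : ∀ α ∈ q.support, α.degree = k := fun α hα => by
        have := hq (mem_support_iff.1 hα)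
        rwa [Finsupp.degree_eq_weight_one]
      rw [← hsr]
      refine Ideal.add_mem _ (Ideal.mem_sup_left hs) ?_
      rw [q.as_sum, map_sum]
      refine Ideal.sum_mem _ fun α hα => ?_
      have e2 : eval x (monomial α (q.coeff α))
              = q.coeff α * eval x (monomial α (1 : R)) := by simp [eval_monomial]
      rw [e2]
      by_cases hβ : ∀ β ∈ p.support, ¬ β ≤ α
      · refine Ideal.mem_sup_right ?_
        rw [pow_succ']
        refine Ideal.mul_mem_mul ((mem_maximalIdeal _).2 (hcase α hα hβ)) ?_
        have := eval_monomial_mem_pow x hx α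
        rwa [hdeg α hα] at this
      · push Not at hβ
        obtain ⟨β, hβ, hle⟩ := hβ
        refine Ideal.mem_sup_left (Ideal.mul_mem_left _ _ ?_)
        refine eval_monomial_mem_mul x hx α β hle ?_ _ (Ideal.subset_span ⟨β, hβ, rfl⟩)
        rw [hdeg α hα]
        exact (hg.1 β hβ).2.trans_le hk
  have hr := mem_of_forall_mem_sup_pow _ _ N key
  rw [← smul_eq_mul] at hr
  obtain ⟨c, hc, hcs⟩ := (Submodule.mem_ideal_smul_span_iff_exists_sum' _ _ _ _).1 hr
  refine ⟨∑ α : p.support, monomial α.1 (p.coeff α.1 + c α), fun α => ?_, ?_⟩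
  · rw [coeff_sum]
    by_cases hα : α ∈ p.support
    · right
      rw [Finset.sum_eq_single ⟨α, hα⟩]
      · rw [coeff_monomial, if_pos rfl]
        by_contra hnu
        have h1 := (mem_maximalIdeal _).2 hnu
        have h2 := (Ideal.add_mem_iff_left _ (hc ⟨α, hα⟩)).1 h1
        exact (mem_maximalIdeal _).1 h2 (hg.1 α hα).1
      · intro β _ hβ
        rw [coeff_monomial, if_neg fun h => hβ (Subtype.ext h)]
      · simp
    · left
      refine Finset.sum_eq_zero fun β _ => ?_
      rw [coeff_monomial, if_neg]
      rintro rfl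
      exact hα β.2
  · have h1 : eval x p = ∑ α : p.support, eval x (monomial α.1 (p.coeff α.1)) := by
      conv_lhs => rw [p.as_sum, map_sum]
      exact (Finset.sum_coe_sort p.support fun α => eval x (monomial α (p.coeff α))).symm
    have h2 : f - eval x p = ∑ α : p.support, eval x (monomial α.1 (c α)) := by
      rw [← hcs, Finsupp.sum_fintype]
      · refine Finset.sum_congr rfl fun α _ => ?_
        simp [eval_monomial]
      · simp
    rw [map_sum]
    simp only [map_add, Finset.sum_add_distrib]
    rw [← h1, ← h2]
    ring

/-- Over a Noetherian local ring whose maximal ideal is generated by `x_1, …, x_n`, every polynomial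
has a finite expansion. -/
theorem exists_isExpansion {R : Type*} [CommRing R] [IsLocalRing R] [IsNoetherianRing R] {n : ℕ}
    (x : Fin n → R) (hx : Ideal.span (Set.range x) = maximalIdeal R) (f : Polynomial R) :
    ∃ P : Polynomial (MvPolynomial (Fin n) R), IsExpansion x f P := by
  choose p hp hpe using exists_unit_expansion x hx
  refine ⟨∑ j ∈ f.support, Polynomial.monomial j (p (f.coeff j)), fun j α => ?_, ?_⟩
  · rw [Polynomial.finsetSum_coeff]
    simp only [Polynomial.coeff_monomial, Finset.sum_ite_eq']
    split_ifs
    · exact hp _ _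
    · simp
  · conv_rhs => rw [f.as_sum_support]
    simp [Polynomial.map_sum, hpe]

end ExistenceOfExpansions

end LooseEdge

/-! The theorem is a Hensel lemma for a filtration adapted to `E`. Normalize the direction of `E` to
`(c, -1)` with `c ≥ 0`, `c ≠ 0`, and give `x^α y^j` the vector weight `α + j c ∈ ℝ^n`, which has a
constant value `e` along `E`. Looseness forces every exponent of `f` to have weight `≥ e` in each
coordinate, with equality in all coordinates only on `E` (`IsLooseEdge.exists_slope`): otherwise the
supporting functional could be tilted about `E` until it met an exponent off the line of `E`, and it
would then cut out a compact face of dimension at least two containing `E`.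

Consequently `f` is a lift of `GH` plus terms of strictly larger total weight. As factors of a
homogeneous polynomial, `G` and `H` are homogeneous, and setting `X = 1` makes them coprime in
`K[y]` (`isCoprime_dehomogenize`). Thus `y^k = φ H + ψ G` with `deg φ < deg G`. Only the powers of
`y` whose companion exponents of `x` are integral need to be kept, and the coordinatewise bound on
weights makes these exponents nonnegative (`exists_lattice_bezout`). So every monomial of weight `≥
e` is a combination of the lifts of `G` and `H` modulo larger total weight (`exists_correction`),
and the successive corrections converge by completeness (`exists_factorization`). The corrections
have larger total weight than the lifts, and elements of `m^k` have finite unit expansions in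
degrees `≥ k` (`exists_unit_expansion_of_mem_pow`); hence the required faces and restrictions can be
read off (`exists_expansion_of_lift`).

For uniqueness over `K[[x]]`, the part of least total weight is multiplicative and is visible in any
expansion; for admissible factors it is `G`, respectively `H`
(`IsFactorizationAlong.hasInitialForm`). Two factorizations give `(g - g') h = g' (h' - h)`, whose
initial forms satisfy `φ H = G ψ` with `deg φ < deg G`. Since `G` and `H` are coprime over the
fraction field of `K[X]`, `G` divides `r φ` for some `r ≠ 0`, which forces `φ = 0`
(`eq_of_hasInitialForm`). -/

namespace LooseEdge

/-! ### Faces of Newton polyhedra and the slope of a loose edge. -/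

section Geometry

variable {n : ℕ}

lemma scalar_add_right (ξ a b : (Fin n → ℝ) × ℝ) : scalar ξ (a + b) = scalar ξ a + scalar ξ b := by
  simp only [scalar, Prod.fst_add, Prod.snd_add, Pi.add_apply, mul_add, Finset.sum_add_distrib]
  ring

lemma scalar_smul_right (ξ a : (Fin n → ℝ) × ℝ) (t : ℝ) : scalar ξ (t • a) = t * scalar ξ a := by
  simp only [scalar, Prod.smul_fst, Prod.smul_snd, Pi.smul_apply, smul_eq_mul, mul_add,
    Finset.mul_sum]
  congr 1
  · exact Finset.sum_congr rfl fun i _ => by ring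
  · ring

lemma isLinearMap_scalar (ξ : (Fin n → ℝ) × ℝ) : IsLinearMap ℝ (scalar ξ) :=
  ⟨scalar_add_right ξ, fun t a => scalar_smul_right ξ a t⟩

lemma scalar_sub_right (ξ a b : (Fin n → ℝ) × ℝ) : scalar ξ (a - b) = scalar ξ a - scalar ξ b :=
  (isLinearMap_scalar ξ).map_sub a b

lemma scalar_combination_left (s t : ℝ) (ξ η a : (Fin n → ℝ) × ℝ) :
    scalar (s • ξ + t • η) a = s * scalar ξ a + t * scalar η a := by
  simp only [scalar, Prod.fst_add, Prod.snd_add, Prod.smul_fst, Prod.smul_snd, Pi.add_apply,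
    Pi.smul_apply, smul_eq_mul, add_mul, Finset.sum_add_distrib, mul_add, Finset.mul_sum]
  simp only [mul_assoc]
  ring

lemma scalar_pos {ξ w : (Fin n → ℝ) × ℝ} (h1 : ∀ i, 0 < ξ.1 i) (h2 : 0 < ξ.2) (hw : 0 ≤ w)
    (hw0 : w ≠ 0) : 0 < scalar ξ w := by
  have hw1 : ∀ i, 0 ≤ w.1 i := fun i => hw.1 i
  have hw2 : 0 ≤ w.2 := hw.2
  by_contra hle
  have hs : 0 ≤ ∑ i, ξ.1 i * w.1 i :=
    Finset.sum_nonneg fun i _ => mul_nonneg (h1 i).le (hw1 i)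
  have hm := mul_nonneg h2.le hw2
  rw [scalar] at hle
  have hs0 : ∑ i, ξ.1 i * w.1 i = 0 := by linarith
  have hm0 : ξ.2 * w.2 = 0 := by linarith
  rw [Finset.sum_eq_zero_iff_of_nonneg fun i _ => mul_nonneg (h1 i).le (hw1 i)] at hs0
  refine hw0 (Prod.ext (funext fun i => ?_) ?_)
  · exact (mul_eq_zero.1 (hs0 i (Finset.mem_univ i))).resolve_left (h1 i).ne'
  · exact (mul_eq_zero.1 hm0).resolve_left h2.ne'

/-- The face of `conv(F + ℝ_{≥0}^{n+1})` cut out by a positive functional is spanned by the points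
of `F` at which the functional is minimal. -/
lemma face_convexHull_add (F : Set ((Fin n → ℝ) × ℝ)) {ξ : (Fin n → ℝ) × ℝ}
    (h1 : ∀ i, 0 < ξ.1 i) (h2 : 0 < ξ.2) {v : ℝ} (hv : ∀ p ∈ F, v ≤ scalar ξ p)
    (hne : ∃ p ∈ F, scalar ξ p = v) :
    face (convexHull ℝ (F + {v | 0 ≤ v})) ξ = convexHull ℝ {p | p ∈ F ∧ scalar ξ p = v} := by
  have hnn : ∀ w : (Fin n → ℝ) × ℝ, 0 ≤ w → 0 ≤ scalar ξ w := fun w hw => by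
    by_cases h0 : w = 0
    · simp [h0, scalar]
    · exact (scalar_pos h1 h2 hw h0).le
  have hΔ : ∀ b ∈ convexHull ℝ (F + {v | 0 ≤ v}), v ≤ scalar ξ b := by
    refine convexHull_min ?_ (convex_halfSpace_ge (isLinearMap_scalar ξ) v)
    rintro _ ⟨p, hp, w, hw, rfl⟩
    have := hv p hp
    have := hnn w hw
    change v ≤ scalar ξ (p + w)
    rw [scalar_add_right]
    linarith
  have hF : ∀ p ∈ F, p ∈ convexHull ℝ (F + {v : (Fin n → ℝ) × ℝ | 0 ≤ v}) := fun p hp =>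
    subset_convexHull ℝ _ ⟨p, hp, 0, le_refl (0 : (Fin n → ℝ) × ℝ), add_zero p⟩
  apply Set.Subset.antisymm
  · rintro a ⟨ha, hmin⟩
    obtain ⟨p₀, hp₀, hp₀v⟩ := hne
    have hav : scalar ξ a ≤ v := hp₀v ▸ hmin p₀ (hF p₀ hp₀)
    rw [convexHull_add] at ha
    obtain ⟨b, hb, w, hw, rfl⟩ := Set.mem_add.1 ha
    have hw' : 0 ≤ w := by
      have hc : Convex ℝ {v : (Fin n → ℝ) × ℝ | 0 ≤ v} := convex_Ici 0
      rw [hc.convexHull_eq] at hw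
      exact hw
    have hb' : v ≤ scalar ξ b :=
      convexHull_min (fun p hp => hv p hp) (convex_halfSpace_ge (isLinearMap_scalar ξ) v) hb
    simp only [scalar_add_right] at hav
    -- The functional is strictly positive on nonzero vectors of the orthant, so a minimal point has
    -- no orthant part.
    have hw0 : w = 0 := by
      by_contra h0
      have := scalar_pos h1 h2 hw' h0
      linarith
    subst hw0
    simp only [add_zero]
    have hbv : scalar ξ b = v := le_antisymm (by have := hnn 0 le_rfl; linarith) hb'
    -- Write the minimal point as a convex combination of a point over the minimal exponents and one
    -- over the others; the second must have coefficient zero.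
    have hunion : F = {p | p ∈ F ∧ scalar ξ p = v} ∪ {p | p ∈ F ∧ v < scalar ξ p} := by
      ext p
      constructor
      · intro hp
        rcases (hv p hp).eq_or_lt with h | h
        · exact Or.inl ⟨hp, h.symm⟩
        · exact Or.inr ⟨hp, h⟩
      · rintro (h | h) <;> exact h.1
    rcases Set.eq_empty_or_nonempty {p | p ∈ F ∧ v < scalar ξ p} with hem | hnem
    · rw [hem, Set.union_empty] at hunion
      rw [← hunion]
      exact hb
    · have hne₁ : {p | p ∈ F ∧ scalar ξ p = v}.Nonempty := ⟨p₀, hp₀, hp₀v⟩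
      rw [hunion, convexHull_union hne₁ hnem, mem_convexJoin] at hb
      obtain ⟨y, hy, z, hz, hbyz⟩ := hb
      have hyv : scalar ξ y = v := by
        have : y ∈ {w | scalar ξ w = v} :=
          convexHull_min (fun p hp => hp.2) (convex_hyperplane (isLinearMap_scalar ξ) v) hy
        exact this
      have hzv : v < scalar ξ z := by
        have : z ∈ {w | v < scalar ξ w} :=
          convexHull_min (fun p hp => hp.2) (convex_halfSpace_gt (isLinearMap_scalar ξ) v) hz
        exact this
      obtain ⟨s, t, hs, ht, hst, rfl⟩ := hbyz
      rw [scalar_add_right, scalar_smul_right, scalar_smul_right, hyv] at hbv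
      have ht0 : t = 0 := by
        by_contra hne
        have hpos := mul_pos (lt_of_le_of_ne ht (Ne.symm hne)) (sub_pos.2 hzv)
        obtain rfl : s = 1 - t := by linarith
        linarith
      subst ht0
      have : s = 1 := by linarith
      subst this
      simpa using hy
  · intro a ha
    have hav : scalar ξ a = v := by
      have : a ∈ {w | scalar ξ w = v} :=
        convexHull_min (fun p hp => hp.2) (convex_hyperplane (isLinearMap_scalar ξ) v) ha
      exact this
    refine ⟨?_, fun b hb => hav.le.trans (hΔ b hb)⟩
    exact convexHull_min (fun p hp => hF p hp.1) (convex_convexHull ℝ _) ha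

lemma add_mem_convexHull_add (F : Set ((Fin n → ℝ) × ℝ)) {a w : (Fin n → ℝ) × ℝ}
    (ha : a ∈ convexHull ℝ (F + {v | 0 ≤ v})) (hw : 0 ≤ w) :
    a + w ∈ convexHull ℝ (F + {v | 0 ≤ v}) := by
  have hc : Convex ℝ {v : (Fin n → ℝ) × ℝ | 0 ≤ v} := convex_Ici 0
  rw [convexHull_add, hc.convexHull_eq] at ha ⊢
  obtain ⟨b, hb, u, hu, rfl⟩ := ha
  exact ⟨b, hb, u + w, add_nonneg hu hw, (add_assoc b u w).symm⟩

lemma convex_face {Δ : Set ((Fin n → ℝ) × ℝ)} (hΔ : Convex ℝ Δ) (ξ : (Fin n → ℝ) × ℝ) :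
    Convex ℝ (face Δ ξ) := by
  intro a ha b hb s t hs ht hst
  refine ⟨hΔ ha.1 hb.1 hs ht hst, fun z hz => ?_⟩
  rw [scalar_add_right, scalar_smul_right, scalar_smul_right]
  have h1 := mul_le_mul_of_nonneg_left (ha.2 z hz) hs
  have h2 := mul_le_mul_of_nonneg_left (hb.2 z hz) ht
  calc _ ≤ s * scalar ξ z + t * scalar ξ z := add_le_add h1 h2
    _ = scalar ξ z := by rw [← add_mul, hst, one_mul]

/-- A nonempty compact face of an upward closed set is defined by a positive functional. -/
lemma not_isCompact_face (F : Set ((Fin n → ℝ) × ℝ)) {ξ d : (Fin n → ℝ) × ℝ}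
    (hd : 0 ≤ d) (hd0 : d ≠ 0) (hξd : scalar ξ d = 0)
    (hne : (face (convexHull ℝ (F + {v | 0 ≤ v})) ξ).Nonempty) :
    ¬ IsCompact (face (convexHull ℝ (F + {v | 0 ≤ v})) ξ) := by
  intro hcomp
  obtain ⟨a, ha⟩ := hne
  obtain ⟨C, hC⟩ := hcomp.isBounded.exists_norm_le
  -- The face contains the whole ray in the direction `d`, so it is unbounded.
  have hmem : ∀ t : ℕ, a + (t : ℝ) • d ∈ face (convexHull ℝ (F + {v | 0 ≤ v})) ξ := fun t => by
    refine ⟨add_mem_convexHull_add F ha.1 (smul_nonneg (Nat.cast_nonneg t) hd), fun b hb => ?_⟩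
    rw [scalar_add_right, scalar_smul_right, hξd, mul_zero, add_zero]
    exact ha.2 b hb
  have hdn : 0 < ‖d‖ := norm_pos_iff.2 hd0
  obtain ⟨t, ht⟩ := exists_nat_gt ((C + C) / ‖d‖)
  rw [div_lt_iff₀ hdn] at ht
  have h1 := hC _ (hmem t)
  have h2 := hC _ ha
  have h3 : ‖(t : ℝ) • d‖ = t * ‖d‖ := by rw [norm_smul, Real.norm_natCast]
  have h4 : ‖(t : ℝ) • d‖ ≤ ‖a + (t : ℝ) • d‖ + ‖a‖ := by
    have := norm_sub_le (a + (t : ℝ) • d) a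
    rwa [add_sub_cancel_left] at this
  linarith

lemma pos_of_isCompact_face (F : Set ((Fin n → ℝ) × ℝ)) {ξ : (Fin n → ℝ) × ℝ} (hξ : 0 ≤ ξ)
    (hne : (face (convexHull ℝ (F + {v | 0 ≤ v})) ξ).Nonempty)
    (hcomp : IsCompact (face (convexHull ℝ (F + {v | 0 ≤ v})) ξ)) :
    (∀ i, 0 < ξ.1 i) ∧ 0 < ξ.2 := by
  classical
  refine ⟨fun i => lt_of_le_of_ne (hξ.1 i) fun h0 => ?_, lt_of_le_of_ne hξ.2 fun h0 => ?_⟩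
  · refine not_isCompact_face F (d := (Pi.single i 1, 0)) ⟨?_, le_rfl⟩ ?_ ?_ hne hcomp
    · exact Pi.single_nonneg.2 zero_le_one
    · intro h
      have := congrFun (congrArg Prod.fst h) i
      simp at this
    · replace h0 : 0 = ξ.1 i := h0
      simp [scalar, Pi.single_apply, ← h0]
  · refine not_isCompact_face F (d := (0, 1)) ⟨le_rfl, zero_le_one⟩ ?_ ?_ hne hcomp
    · intro h
      have := congrArg Prod.snd h
      simp at this
    · replace h0 : 0 = ξ.2 := h0
      simp [scalar, ← h0]

/-- The slope of a loose descendant edge `E` of a polyhedron `conv(F + ℝ_{≥0}^{n+1})`: in the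
direction of `E` the whole polyhedron lies in the orthant over the line spanned by `E`. -/
lemma IsLooseEdge.exists_slope {F : Set ((Fin n → ℝ) × ℝ)} (hF : F.Finite)
    {E : Set ((Fin n → ℝ) × ℝ)} (hE : IsLooseEdge (convexHull ℝ (F + {v | 0 ≤ v})) E)
    (hd : IsDescendant E) :
    ∃ c e : Fin n → ℝ, (∀ i, 0 ≤ c i) ∧ 0 < ∑ i, c i ∧
      (∀ p ∈ F, ∀ i, e i ≤ p.1 i + p.2 * c i) ∧
      (∀ p ∈ F, p ∈ E ↔ ∀ i, p.1 i + p.2 * c i = e i) ∧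
      E = convexHull ℝ {p | p ∈ F ∧ p ∈ E} := by
  classical
  obtain ⟨⟨⟨ξ, hξ, rfl⟩, hcomp⟩, hdim, hloose⟩ := hE
  obtain ⟨c, hc1, hc2, hspan⟩ := hd
  have hne : (face (convexHull ℝ (F + {v | 0 ≤ v})) ξ).Nonempty := by
    by_contra hem
    rw [Set.not_nonempty_iff_eq_empty] at hem
    rw [dim, hem, vectorSpan_empty] at hdim
    simp at hdim
  obtain ⟨hp1, hp2⟩ := pos_of_isCompact_face F hξ hne hcomp
  have hFne : F.Nonempty := by
    by_contra hem
    rw [Set.not_nonempty_iff_eq_empty] at hem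
    obtain ⟨a, ha⟩ := hne
    have := ha.1
    rw [hem, Set.empty_add, convexHull_empty] at this
    exact this
  obtain ⟨p₀, hp₀, hmin⟩ := Set.exists_min_image F (scalar ξ) hF hFne
  have hface := face_convexHull_add F hp1 hp2 hmin ⟨p₀, hp₀, rfl⟩
  set E := face (convexHull ℝ (F + {v | 0 ≤ v})) ξ with hEdef
  have hsub : ∀ p ∈ F, scalar ξ p = scalar ξ p₀ → p ∈ E := fun p hp h => by
    rw [hface]
    exact subset_convexHull ℝ _ ⟨hp, h⟩
  have hEv : ∀ p ∈ E, scalar ξ p = scalar ξ p₀ := fun p hp => by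
    rw [hface] at hp
    have : p ∈ {w | scalar ξ w = scalar ξ p₀} :=
      convexHull_min (fun p hp => hp.2) (convex_hyperplane (isLinearMap_scalar ξ) _) hp
    exact this
  have hp₀E : p₀ ∈ E := hsub p₀ hp₀ rfl
  have hcE : c ∈ vectorSpan ℝ E := by
    rw [hspan]
    exact Submodule.mem_span_singleton_self c
  have hξc : scalar ξ c = 0 := by
    have hle : vectorSpan ℝ E ≤ LinearMap.ker (isLinearMap_scalar ξ).mk' := by
      rw [vectorSpan_def, Submodule.span_le]
      rintro _ ⟨a, ha, b, hb, rfl⟩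
      simp [vsub_eq_sub, scalar_sub_right, hEv a ha, hEv b hb]
    exact hle hcE
  have hcsum : 0 < ∑ i, c.1 i := by
    refine lt_of_le_of_ne (Finset.sum_nonneg fun i _ => hc1 i) fun h0 => ?_
    have h0' := (Finset.sum_eq_zero_iff_of_nonneg fun i _ => hc1 i).1 h0.symm
    have : ∑ i, ξ.1 i * c.1 i = 0 := Finset.sum_eq_zero fun i hi => by rw [h0' i hi, mul_zero]
    rw [scalar, this, zero_add] at hξc
    exact (mul_neg_of_pos_of_neg hp2 hc2).ne hξc
  -- Dividing by `-c.2 > 0` rescales the direction of `E` to last coordinate `-1`; the resulting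
  -- coordinate weights are constant on `E`.
  have hline : ∀ p ∈ E, ∀ i, p.1 i + p.2 * (c.1 i / -c.2) = p₀.1 i + p₀.2 * (c.1 i / -c.2) := by
    intro p hp i
    have hmem : p - p₀ ∈ vectorSpan ℝ E := vsub_mem_vectorSpan ℝ hp hp₀E
    rw [hspan, Submodule.mem_span_singleton] at hmem
    obtain ⟨t, ht⟩ := hmem
    have e1 : t * c.1 i = p.1 i - p₀.1 i := congrFun (congrArg Prod.fst ht) i
    have e2 : t * c.2 = p.2 - p₀.2 := congrArg Prod.snd ht
    have : c.2 ≠ 0 := hc2.ne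
    field_simp
    linear_combination (-c.2) * e1 + c.1 i * e2
  refine ⟨fun i => c.1 i / -c.2, fun i => p₀.1 i + p₀.2 * (c.1 i / -c.2),
    fun i => div_nonneg (hc1 i) (by linarith), ?_, ?_, fun p hp => ⟨hline p, fun h => ?_⟩, ?_⟩
  · rw [← Finset.sum_div]
    exact div_pos hcsum (by linarith)
  · by_contra! hcon
    obtain ⟨p, hp, i, hpi⟩ := hcon
    -- The `i`-th coordinate weight as a functional: it is constant on `E` but drops below that
    -- value at `p`. Rotate `ξ` towards it.
    let η : (Fin n → ℝ) × ℝ := (Pi.single i 1, c.1 i / -c.2)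
    have hη : ∀ q, scalar η q = q.1 i + q.2 * (c.1 i / -c.2) := fun q => by
      simp [scalar, η, Pi.single_apply, mul_comm]
    let A : (Fin n → ℝ) × ℝ → ℝ := fun q => scalar ξ q - scalar ξ p₀
    let B : (Fin n → ℝ) × ℝ → ℝ := fun q => scalar η q - scalar η p₀
    have hA : ∀ q ∈ F, 0 ≤ A q := fun q hq => sub_nonneg.2 (hmin q hq)
    have hAB : ∀ q ∈ F, B q < 0 → 0 < A q := fun q hq hB => by
      refine lt_of_le_of_ne (hA q hq) fun h0 => hB.ne ?_
      have := hline q (hsub q hq (sub_eq_zero.1 h0.symm)) i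
      simp only [B, hη, this, sub_self]
    -- `A q / (A q - B q)` is the parameter `s` at which `(1 - s) A q + s B q` vanishes. The
    -- smallest such `s` is the first moment at which a new exponent reaches the supporting
    -- hyperplane; as `s < 1`, the functional is still positive.
    obtain ⟨q, ⟨hq, hBq⟩, hqmin⟩ := Set.exists_min_image {q | q ∈ F ∧ B q < 0}
      (fun q => A q / (A q - B q)) (hF.subset fun q hq => hq.1)
      ⟨p, hp, by simp only [B, hη]; linarith⟩
    have hAq := hAB q hq hBq
    set s := A q / (A q - B q) with hs
    have hden : 0 < A q - B q := by linarith
    have hs0 : 0 < s := div_pos hAq hden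
    have hs1 : s < 1 := (div_lt_one hden).2 (by linarith)
    have hsq : s * (A q - B q) = A q := div_mul_cancel₀ _ hden.ne'
    let ζ := (1 - s) • ξ + s • η
    have hζ : ∀ r, scalar ζ r - scalar ζ p₀ = (1 - s) * A r + s * B r := fun r => by
      simp only [ζ, scalar_combination_left, A, B]
      ring
    have hζF : ∀ r ∈ F, scalar ζ p₀ ≤ scalar ζ r := by
      intro r hr
      rw [← sub_nonneg, hζ]
      by_cases hB : B r < 0
      · have h1 := hqmin r ⟨hr, hB⟩
        have h2 : 0 < A r - B r := by have := hA r hr; linarith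
        rw [le_div_iff₀ h2] at h1
        linarith
      · exact add_nonneg (mul_nonneg (by linarith) (hA r hr)) (mul_nonneg hs0.le (not_lt.1 hB))
    have hζq : scalar ζ q = scalar ζ p₀ := by
      rw [← sub_eq_zero, hζ]
      linarith
    have hζ1 : ∀ j, 0 < ζ.1 j := fun j => by
      change 0 < (1 - s) * ξ.1 j + s * (Pi.single i 1 : Fin n → ℝ) j
      have h1 : (0 : ℝ) ≤ (Pi.single i 1 : Fin n → ℝ) j := by
        rw [Pi.single_apply]; split_ifs <;> norm_num
      have := mul_pos (sub_pos.2 hs1) (hp1 j)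
      have := mul_nonneg hs0.le h1
      linarith
    have hζ2 : 0 < ζ.2 := by
      change 0 < (1 - s) * ξ.2 + s * (c.1 i / -c.2)
      have h1 : 0 ≤ c.1 i / -c.2 := div_nonneg (hc1 i) (by linarith)
      have := mul_pos (sub_pos.2 hs1) hp2
      have := mul_nonneg hs0.le h1
      linarith
    have hfaceζ := face_convexHull_add F hζ1 hζ2 hζF ⟨p₀, hp₀, rfl⟩
    set A' := face (convexHull ℝ (F + {v | 0 ≤ v})) ζ with hA'
    have hA'c : IsCompact A' := by
      rw [hfaceζ]
      exact (hF.subset fun p hp => hp.1).isCompact_convexHull ℝ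
    have hEA' : E ⊆ A' := by
      rw [hface, hfaceζ]
      refine convexHull_mono fun r hr => ⟨hr.1, ?_⟩
      have h1 : A r = 0 := sub_eq_zero.2 hr.2
      have h2 : B r = 0 := by
        have := hline r (hsub r hr.1 hr.2) i
        simp only [B, hη, this, sub_self]
      rw [← sub_eq_zero, hζ, h1, h2]
      ring
    have hqA' : q ∈ A' := by
      rw [hfaceζ]
      exact subset_convexHull ℝ _ ⟨hq, hζq⟩
    refine hloose A' ⟨⟨ζ, ⟨fun j => (hζ1 j).le, hζ2.le⟩, rfl⟩, hA'c⟩ ?_ hEA'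
    -- If the new face had dimension one, `q - p₀` would be a multiple of `c`, on which `ξ`
    -- vanishes; but `A q > 0`.
    by_contra hlt
    have hle : vectorSpan ℝ E ≤ vectorSpan ℝ A' := vectorSpan_mono ℝ hEA'
    have heq := Submodule.eq_of_le_of_finrank_le hle (by
      change dim A' ≤ dim E
      omega)
    have hmem : q - p₀ ∈ vectorSpan ℝ A' := vsub_mem_vectorSpan ℝ hqA' (hEA' hp₀E)
    rw [← heq, hspan, Submodule.mem_span_singleton] at hmem
    obtain ⟨t, ht⟩ := hmem
    have : A q = 0 := by
      simp only [A]
      rw [← scalar_sub_right, ← ht, scalar_smul_right, hξc, mul_zero]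
    exact hAq.ne' this
  · refine hsub p hp ?_
    have : p - p₀ = ((p.2 - p₀.2) / c.2) • c := by
      have hc : c.2 ≠ 0 := hc2.ne
      refine Prod.ext (funext fun i => ?_) ?_
      · have := h i
        change p.1 i - p₀.1 i = (p.2 - p₀.2) / c.2 * c.1 i
        field_simp at this ⊢
        linear_combination this
      · change p.2 - p₀.2 = (p.2 - p₀.2) / c.2 * c.2
        rw [div_mul_cancel₀ _ hc]
    rw [← sub_eq_zero, ← scalar_sub_right, this, scalar_smul_right, hξc, mul_zero]
  · have : {p | p ∈ F ∧ p ∈ E} = {p | p ∈ F ∧ scalar ξ p = scalar ξ p₀} := by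
      ext p
      exact ⟨fun h => ⟨h.1, hEv p h.2⟩, fun h => ⟨h.1, hsub p h.1 h.2⟩⟩
    rw [this]
    exact hface

/-- The line `{(α, s) : α + s c = e}`, parametrized by its last coordinate. -/
def line (e c : Fin n → ℝ) (s : ℝ) : (Fin n → ℝ) × ℝ := (fun i => e i - s * c i, s)

lemma line_combination (e c : Fin n → ℝ) {p q : ℝ} (h : p + q = 1) (s t : ℝ) :
    p • line e c s + q • line e c t = line e c (p * s + q * t) := by
  refine Prod.ext (funext fun i => ?_) rfl
  change p * (e i - s * c i) + q * (e i - t * c i) = e i - (p * s + q * t) * c i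
  linear_combination e i * h

lemma line_mem_of_mem {A : Set ((Fin n → ℝ) × ℝ)} (hA : Convex ℝ A) {e c : Fin n → ℝ} {a b t : ℝ}
    (ha : line e c a ∈ A) (hb : line e c b ∈ A) (h1 : a ≤ t) (h2 : t ≤ b) : line e c t ∈ A := by
  have : t ∈ segment ℝ a b := by
    rw [segment_eq_Icc (h1.trans h2)]
    exact ⟨h1, h2⟩
  obtain ⟨p, q, hp, hq, hpq, rfl⟩ := this
  have := hA ha hb hp hq hpq
  rwa [line_combination e c hpq] at this

lemma convexHull_line_image (e c : Fin n → ℝ) {T : Set ℕ} {a b : ℕ} (ha : a ∈ T) (hb : b ∈ T)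
    (h : ∀ t ∈ T, a ≤ t ∧ t ≤ b) :
    convexHull ℝ ((fun t : ℕ => line e c t) '' T) = line e c '' Set.Icc (a : ℝ) b := by
  apply Set.Subset.antisymm
  · refine convexHull_min ?_ ?_
    · rintro _ ⟨t, ht, rfl⟩
      exact ⟨t, ⟨by exact_mod_cast (h t ht).1, by exact_mod_cast (h t ht).2⟩, rfl⟩
    · rintro _ ⟨s, hs, rfl⟩ _ ⟨t, ht, rfl⟩ p q hp hq hpq
      rw [line_combination e c hpq]
      exact ⟨_, convex_Icc _ _ hs ht hp hq hpq, rfl⟩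
  · rintro _ ⟨s, hs, rfl⟩
    exact line_mem_of_mem (convex_convexHull ℝ _) (subset_convexHull ℝ _ ⟨a, ha, rfl⟩)
      (subset_convexHull ℝ _ ⟨b, hb, rfl⟩) hs.1 hs.2

/-- Segments of the same direction add by adding their parameter intervals. This later gives `E = E₁
+ E₂`. -/
lemma line_image_Icc_add (e e' c : Fin n → ℝ) {a b a' b' : ℝ} (h : a ≤ b) (h' : a' ≤ b') :
    line e c '' Set.Icc a b + line e' c '' Set.Icc a' b'
      = line (e + e') c '' Set.Icc (a + a') (b + b') := by
  have hadd : ∀ s t, line e c s + line e' c t = line (e + e') c (s + t) := fun s t => by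
    refine Prod.ext (funext fun i => ?_) rfl
    change e i - s * c i + (e' i - t * c i) = e i + e' i - (s + t) * c i
    ring
  apply Set.Subset.antisymm
  · rintro _ ⟨_, ⟨s, hs, rfl⟩, _, ⟨t, ht, rfl⟩, rfl⟩
    exact ⟨s + t, ⟨add_le_add hs.1 ht.1, add_le_add hs.2 ht.2⟩, (hadd s t).symm⟩
  · rintro _ ⟨s, hs, rfl⟩
    obtain ⟨h1, h2⟩ := hs
    -- The least first summand that leaves a remainder not exceeding `b'`.
    refine ⟨_, ⟨max a (s - b'), ⟨le_max_left _ _, max_le h (by linarith)⟩, rfl⟩, _,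
      ⟨s - max a (s - b'), ⟨?_, ?_⟩, rfl⟩, ?_⟩
    · rw [le_sub_comm]
      exact max_le (by linarith) (by linarith)
    · rw [sub_le_comm]
      exact le_max_right _ _
    · change line e c _ + line e' c _ = _
      rw [hadd]
      congr 1
      ring

lemma point_eq_line_iff {e c : Fin n → ℝ} {α : Fin n →₀ ℕ} {j : ℕ} :
    point α j = line e c j ↔ ∀ i, (α i : ℝ) + j * c i = e i := by
  constructor
  · intro h i
    have : (α i : ℝ) = e i - j * c i := congrFun (congrArg Prod.fst h) i
    linarith
  · intro h
    refine Prod.ext (funext fun i => ?_) rfl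
    change (α i : ℝ) = e i - j * c i
    linarith [h i]

end Geometry

/-! ### Symbolic restrictions, weights and homogeneity. -/

section Restriction

variable {S k : Type*} [CommRing S] [CommRing k] {n : ℕ}

lemma coeff_symbolicRestriction (π : S →+* k) (P : Polynomial (MvPolynomial (Fin n) S))
    (A : Set ((Fin n → ℝ) × ℝ)) (j : ℕ) (α : Fin n →₀ ℕ) [Decidable (point α j ∈ A)] :
    ((symbolicRestriction π P A).coeff j).coeff α
      = if point α j ∈ A then π ((P.coeff j).coeff α) else 0 := by
  classical
  rw [symbolicRestriction, Polynomial.finsetSum_coeff]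
  simp only [Polynomial.coeff_monomial, Finset.sum_ite_eq']
  by_cases hj : j ∈ P.support
  · rw [if_pos hj, MvPolynomial.coeff_sum]
    simp only [MvPolynomial.coeff_monomial, Finset.sum_ite_eq', Finset.mem_filter,
      MvPolynomial.mem_support_iff]
    by_cases h0 : (P.coeff j).coeff α = 0
    · simp [h0]
    · simp [h0]
  · rw [if_neg hj]
    simp [Polynomial.notMem_support_iff.1 hj]

lemma finite_support (F : Polynomial (MvPolynomial (Fin n) S)) :
    {p : (Fin n →₀ ℕ) × ℕ | (F.coeff p.2).coeff p.1 ≠ 0}.Finite := by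
  classical
  refine (F.support.biUnion fun j => (F.coeff j).support.image fun α => (α, j)).finite_toSet.subset
    ?_
  rintro ⟨α, j⟩ h
  simp only [Finset.coe_biUnion, Set.mem_iUnion, Finset.mem_coe, Finset.mem_image,
    MvPolynomial.mem_support_iff, Polynomial.mem_support_iff]
  exact ⟨j, fun h0 => h (by simp [h0]), α, h, rfl⟩

/-- The weight `α + j c` of the exponent `(α, j)`, constant along lines of direction `(c, -1)`. -/
def weight (c : Fin n → ℝ) (α : Fin n →₀ ℕ) (j : ℕ) : Fin n → ℝ := fun i => α i + j * c i

lemma weight_add (c : Fin n → ℝ) (α β : Fin n →₀ ℕ) (i j : ℕ) :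
    weight c (α + β) (i + j) = weight c α i + weight c β j := by
  funext l
  simp only [weight, Finsupp.add_apply, Pi.add_apply]
  push_cast
  ring

/-- For a fixed power of `y` there is at most one exponent of a given weight. Hence a homogeneous
polynomial has at most one term in each degree in `y`, and setting `X = 1` loses nothing. -/
lemma weight_left_injective {c : Fin n → ℝ} {α β : Fin n →₀ ℕ} {j : ℕ}
    (h : weight c α j = weight c β j) : α = β := by
  ext i
  have := congrFun h i
  simp only [weight] at this
  exact_mod_cast add_right_cancel this

/-- `F` is homogeneous of weight `e`. -/
def IsHomogeneousAlong (c e : Fin n → ℝ) (F : Polynomial (MvPolynomial (Fin n) k)) : Prop :=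
  ∀ (j : ℕ) (α : Fin n →₀ ℕ), (F.coeff j).coeff α ≠ 0 → weight c α j = e

end Restriction

/-! ### Weight components and initial forms. -/

section Components

open MvPowerSeries (coeff)

variable {K : Type*} [Field K] {n : ℕ} {Γ : Type*}

open Classical in
/-- The part of a power series consisting of the monomials with a given property. -/
noncomputable def filterSeries (p : (Fin n →₀ ℕ) → Prop) (φ : MvPowerSeries (Fin n) K) :
    MvPowerSeries (Fin n) K := fun α => if p α then coeff α φ else 0

lemma coeff_filterSeries (p : (Fin n →₀ ℕ) → Prop) (φ : MvPowerSeries (Fin n) K)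
    (α : Fin n →₀ ℕ) [Decidable (p α)] :
    coeff α (filterSeries p φ) = if p α then coeff α φ else 0 := by
  rw [MvPowerSeries.coeff_apply, filterSeries]
  congr

/-- The part of `g` of weight `t`. -/
noncomputable def component (w : (Fin n →₀ ℕ) → ℕ → Γ) (t : Γ)
    (g : Polynomial (MvPowerSeries (Fin n) K)) : Polynomial (MvPowerSeries (Fin n) K) :=
  ∑ j ∈ g.support, Polynomial.monomial j
    (filterSeries (fun α => w α j = t) (g.coeff j))

lemma coeff_component (w : (Fin n →₀ ℕ) → ℕ → Γ) (t : Γ)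
    (g : Polynomial (MvPowerSeries (Fin n) K)) (j : ℕ) (α : Fin n →₀ ℕ) [Decidable (w α j = t)] :
    coeff α ((component w t g).coeff j) = if w α j = t then coeff α (g.coeff j) else 0 := by
  classical
  rw [component, Polynomial.finsetSum_coeff]
  simp only [Polynomial.coeff_monomial, Finset.sum_ite_eq']
  by_cases hj : j ∈ g.support
  · rw [if_pos hj, coeff_filterSeries]
  · rw [if_neg hj]
    simp [Polynomial.notMem_support_iff.1 hj]

lemma coeff_coeff_mul (g h : Polynomial (MvPowerSeries (Fin n) K)) (l : ℕ) (γ : Fin n →₀ ℕ) :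
    coeff γ ((g * h).coeff l) = ∑ p ∈ Finset.HasAntidiagonal.antidiagonal l, ∑ q ∈ Finset.HasAntidiagonal.antidiagonal γ,
      coeff q.1 (g.coeff p.1) * coeff q.2 (h.coeff p.2) := by
  classical
  rw [Polynomial.coeff_mul, map_sum]
  exact Finset.sum_congr rfl fun p _ => MvPowerSeries.coeff_mul _ _ _

/-- The hypothesis `H` excludes mixed contributions to weight `s + t`. It holds when both weights
are minimal, and also when one factor is homogeneous; both cases are used. -/
lemma component_mul [Add Γ] {w : (Fin n →₀ ℕ) → ℕ → Γ}
    (hw : ∀ α β i j, w (α + β) (i + j) = w α i + w β j) {s t : Γ}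
    {g h : Polynomial (MvPowerSeries (Fin n) K)}
    (H : ∀ α i β j, coeff α (g.coeff i) ≠ 0 → coeff β (h.coeff j) ≠ 0 →
      w α i + w β j = s + t → w α i = s ∧ w β j = t) :
    component w (s + t) (g * h) = component w s g * component w t h := by
  classical
  ext l γ
  rw [coeff_component, coeff_coeff_mul, coeff_coeff_mul]
  simp only [coeff_component]
  split_ifs with hγ
  · refine Finset.sum_congr rfl fun p hp => Finset.sum_congr rfl fun q hq => ?_
    rw [Finset.HasAntidiagonal.mem_antidiagonal] at hp hq
    rw [← hp, ← hq, hw] at hγ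
    by_cases h1 : coeff q.1 (g.coeff p.1) = 0
    · simp [h1]
    by_cases h2 : coeff q.2 (h.coeff p.2) = 0
    · simp [h2]
    obtain ⟨h3, h4⟩ := H _ _ _ _ h1 h2 hγ
    rw [if_pos h3, if_pos h4]
  · symm
    refine Finset.sum_eq_zero fun p hp => Finset.sum_eq_zero fun q hq => ?_
    rw [Finset.HasAntidiagonal.mem_antidiagonal] at hp hq
    rw [← hp, ← hq, hw] at hγ
    by_cases h3 : w q.1 p.1 = s
    · rw [if_neg fun h4 : w q.2 p.2 = t => hγ (by rw [h3, h4]), mul_zero]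
    · rw [if_neg h3, zero_mul]

/-- `G` is the nonzero part of `g` of minimal weight `s`. -/
structure HasInitialForm (w : (Fin n →₀ ℕ) → ℕ → ℝ) (g : Polynomial (MvPowerSeries (Fin n) K))
    (s : ℝ) (G : Polynomial (MvPowerSeries (Fin n) K)) : Prop where
  le : ∀ j α, coeff α (g.coeff j) ≠ 0 → s ≤ w α j
  component_eq : component w s g = G
  ne_zero : G ≠ 0

variable {w : (Fin n →₀ ℕ) → ℕ → ℝ}

lemma HasInitialForm.mul (hw : ∀ α β i j, w (α + β) (i + j) = w α i + w β j)
    {g h G H : Polynomial (MvPowerSeries (Fin n) K)} {s t : ℝ}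
    (hg : HasInitialForm w g s G) (hh : HasInitialForm w h t H) :
    HasInitialForm w (g * h) (s + t) (G * H) where
  le l γ hne := by
    classical
    rw [coeff_coeff_mul] at hne
    obtain ⟨p, hp, hne⟩ := Finset.exists_ne_zero_of_sum_ne_zero hne
    obtain ⟨q, hq, hne⟩ := Finset.exists_ne_zero_of_sum_ne_zero hne
    rw [Finset.HasAntidiagonal.mem_antidiagonal] at hp hq
    rw [← hp, ← hq, hw]
    exact add_le_add (hg.le _ _ (left_ne_zero_of_mul hne)) (hh.le _ _ (right_ne_zero_of_mul hne))
  component_eq := by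
    rw [component_mul hw, hg.component_eq, hh.component_eq]
    intro α i β j h1 h2 h3
    have := hg.le _ _ h1
    have := hh.le _ _ h2
    constructor <;> linarith
  ne_zero := mul_ne_zero hg.ne_zero hh.ne_zero

lemma HasInitialForm.exists_coeff {g G : Polynomial (MvPowerSeries (Fin n) K)} {s : ℝ}
    (hg : HasInitialForm w g s G) : ∃ j α, coeff α (g.coeff j) ≠ 0 ∧ w α j = s := by
  classical
  by_contra! hcon
  refine hg.ne_zero ?_
  rw [← hg.component_eq]
  ext j α
  rw [coeff_component]
  split_ifs with h
  · by_contra hne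
    exact hcon j α hne h
  · simp

lemma HasInitialForm.unique {g G G' : Polynomial (MvPowerSeries (Fin n) K)} {s s' : ℝ}
    (h : HasInitialForm w g s G) (h' : HasInitialForm w g s' G') : s = s' ∧ G = G' := by
  obtain ⟨j, α, hne, rfl⟩ := h.exists_coeff
  obtain ⟨j', α', hne', hs⟩ := h'.exists_coeff
  have : w α j = s' := le_antisymm (hs ▸ h.le _ _ hne') (h'.le _ _ hne)
  refine ⟨this, ?_⟩
  rw [← h.component_eq, ← h'.component_eq, this]

/-- Coefficients are power series, so the support may be infinite; finiteness below every bound is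
what makes the minimum exist. -/
lemma exists_hasInitialForm {g : Polynomial (MvPowerSeries (Fin n) K)} (hg : g ≠ 0)
    (hfin : ∀ v, {p : (Fin n →₀ ℕ) × ℕ | coeff p.1 (g.coeff p.2) ≠ 0 ∧ w p.1 p.2 ≤ v}.Finite) :
    ∃ s G, HasInitialForm w g s G := by
  classical
  have : ∃ j α, coeff α (g.coeff j) ≠ 0 := by
    by_contra! h
    exact hg (by ext j α; simpa using h j α)
  obtain ⟨j, α, hne⟩ := this
  obtain ⟨⟨α₀, j₀⟩, ⟨hne₀, hle₀⟩, hmin⟩ := Set.exists_min_image _ (fun p => w p.1 p.2)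
    (hfin (w α j)) ⟨(α, j), hne, le_rfl⟩
  refine ⟨w α₀ j₀, _, fun j' α' hne' => ?_, rfl, fun h0 => hne₀ ?_⟩
  · rcases le_total (w α' j') (w α j) with h | h
    · exact hmin (α', j') ⟨hne', h⟩
    · exact hle₀.trans h
  · have h1 := coeff_component w (w α₀ j₀) g j₀ α₀
    rw [if_pos rfl, h0] at h1
    simpa using h1.symm

/-- The inclusion of `K[X][y]` into `K[[X]][y]`. -/
noncomputable def toSeries :
    Polynomial (MvPolynomial (Fin n) K) →+* Polynomial (MvPowerSeries (Fin n) K) :=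
  Polynomial.mapRingHom MvPolynomial.coeToMvPowerSeries.ringHom

@[simp] lemma coeff_toSeries (F : Polynomial (MvPolynomial (Fin n) K)) (j : ℕ) (α : Fin n →₀ ℕ) :
    coeff α ((toSeries F).coeff j) = (F.coeff j).coeff α := by
  simp [toSeries]

lemma toSeries_injective : Function.Injective (toSeries (K := K) (n := n)) := by
  intro F F' h
  ext j α
  rw [← coeff_toSeries, h, coeff_toSeries]

lemma toSeries_symbolicRestriction (c t : Fin n → ℝ) (F : Polynomial (MvPolynomial (Fin n) K)) :
    toSeries (symbolicRestriction (RingHom.id K) F {p | (fun i => p.1 i + p.2 * c i) = t})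
      = component (weight c) t (toSeries F) := by
  classical
  ext j α
  rw [coeff_toSeries, coeff_symbolicRestriction, coeff_component, coeff_toSeries]
  rfl

/-- The factors of a homogeneous polynomial are homogeneous. -/
lemma IsHomogeneousAlong.of_mul {c e : Fin n → ℝ} {G H : Polynomial (MvPolynomial (Fin n) K)}
    (h : IsHomogeneousAlong c e (G * H)) (hG : G.Monic) (hH : H ≠ 0) :
    IsHomogeneousAlong c (weight c 0 G.natDegree) G ∧
      IsHomogeneousAlong c (e - weight c 0 G.natDegree) H := by
  have key : ∀ i, (∀ j α, (G.coeff j).coeff α ≠ 0 → weight c α j i = weight c 0 G.natDegree i) ∧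
      (∀ j α, (H.coeff j).coeff α ≠ 0 → weight c α j i = e i - weight c 0 G.natDegree i) := by
    intro i
    have hex : ∀ (w : (Fin n →₀ ℕ) → ℕ → ℝ) (F : Polynomial (MvPolynomial (Fin n) K)), F ≠ 0 →
        ∃ s F', HasInitialForm w (toSeries F) s F' := fun w F hF => by
      refine exists_hasInitialForm (fun h0 => hF (toSeries_injective (by rw [h0, map_zero])))
        fun v => (finite_support F).subset fun p hp => ?_
      simpa using hp.1
    have hw : ∀ α β j l, weight c (α + β) (j + l) i = weight c α j i + weight c β l i :=
      fun α β j l => by rw [weight_add]; rfl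
    have hw' : ∀ α β j l, -weight c (α + β) (j + l) i = -weight c α j i + -weight c β l i :=
      fun α β j l => by rw [hw]; ring
    -- The initial forms for `w` and `-w` record the least and the greatest value of the `i`-th
    -- weight. Both are additive on products and they agree on `G * H`, so they agree on each
    -- factor; monicity of `G` identifies the value.
    obtain ⟨s₁, G₁, hG₁⟩ := hex (fun α j => weight c α j i) G hG.ne_zero
    obtain ⟨s₂, G₂, hG₂⟩ := hex (fun α j => -weight c α j i) G hG.ne_zero
    obtain ⟨t₁, H₁, hH₁⟩ := hex (fun α j => weight c α j i) H hH
    obtain ⟨t₂, H₂, hH₂⟩ := hex (fun α j => -weight c α j i) H hH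
    have h₁ := hG₁.mul hw hH₁
    have h₂ := hG₂.mul hw' hH₂
    rw [← map_mul] at h₁ h₂
    obtain ⟨j, α, hne, h1⟩ := h₁.exists_coeff
    obtain ⟨j', α', hne', h2⟩ := h₂.exists_coeff
    rw [coeff_toSeries] at hne hne'
    rw [h j α hne] at h1
    rw [h j' α' hne'] at h2
    have hGb : ∀ j α, (G.coeff j).coeff α ≠ 0 → s₁ ≤ weight c α j i ∧ weight c α j i ≤ -s₂ :=
      fun j α hne => by
        have h1 := hG₁.le j α (by rwa [coeff_toSeries])
        have h2 := hG₂.le j α (by rwa [coeff_toSeries])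
        exact ⟨h1, by linarith⟩
    have hHb : ∀ j α, (H.coeff j).coeff α ≠ 0 → t₁ ≤ weight c α j i ∧ weight c α j i ≤ -t₂ :=
      fun j α hne => by
        have h1 := hH₁.le j α (by rwa [coeff_toSeries])
        have h2 := hH₂.le j α (by rwa [coeff_toSeries])
        exact ⟨h1, by linarith⟩
    obtain ⟨jH, αH, hneH, -⟩ := hH₁.exists_coeff
    rw [coeff_toSeries] at hneH
    have hbH := hHb jH αH hneH
    have hbG := hGb G.natDegree 0 (by rw [hG.coeff_natDegree]; simp)
    refine ⟨fun j α hne => ?_, fun j α hne => ?_⟩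
    · have := hGb j α hne
      linarith
    · have := hHb j α hne
      linarith
  exact ⟨fun j α hne => funext fun i => (key i).1 j α hne,
    fun j α hne => funext fun i => (key i).2 j α hne⟩

end Components

/-! ### Coprimality over the fraction field. -/

section Bezout

open Polynomial

/-- Relatively prime polynomials over a factorial domain, one of them monic, are coprime over the
fraction field. -/
lemma exists_mul_add_mul_eq_C {R : Type*} [CommRing R] [IsDomain R] [UniqueFactorizationMonoid R]
    {G H : R[X]} (hG : G.Monic) (h : IsRelPrime G H) :
    ∃ (A B : R[X]) (r : R), r ≠ 0 ∧ A * G + B * H = C r := by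
  let L := FractionRing R
  have hinj : Function.Injective (Polynomial.map (algebraMap R L)) :=
    map_injective _ (IsFractionRing.injective R L)
  have hrel : IsRelPrime (G.map (algebraMap R L)) (H.map (algebraMap R L)) := by
    intro p hpG hpH
    -- Gauss's lemma: up to a scalar, a common divisor over `L` comes from a monic `q` over `R`,
    -- which then divides `G` and `H` already over `R`.
    obtain ⟨q, hq⟩ := IsIntegrallyClosed.eq_map_mul_C_of_dvd L hG hpG
    have hp0 : p ≠ 0 := fun h0 => (hG.map (algebraMap R L)).ne_zero (by
      rw [h0] at hpG
      exact zero_dvd_iff.1 hpG)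
    have hlu : IsUnit (C p.leadingCoeff) := isUnit_C.2 (leadingCoeff_ne_zero.2 hp0).isUnit
    have hqm : q.Monic := by
      refine monic_of_injective (IsFractionRing.injective R L) ?_
      have : (map (algebraMap R L) q * C p.leadingCoeff).leadingCoeff = p.leadingCoeff := by
        rw [hq]
      rw [leadingCoeff_mul, leadingCoeff_C] at this
      exact mul_right_cancel₀ (leadingCoeff_ne_zero.2 hp0) (by rw [this, one_mul])
    have hqp : map (algebraMap R L) q ∣ p := ⟨_, hq.symm⟩
    have hq1 : IsUnit q := h (hqm.isPrimitive.dvd_of_fraction_map_dvd_fraction_map (hqp.trans hpG))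
      (hqm.isPrimitive.dvd_of_fraction_map_dvd_fraction_map (hqp.trans hpH))
    rw [← hq]
    exact (hq1.map (mapRingHom (algebraMap R L))).mul hlu
  obtain ⟨a, b, hab⟩ := hrel.isCoprime
  obtain ⟨s, hs, hsa⟩ := IsLocalization.integerNormalization_spec (nonZeroDivisors R) a
  obtain ⟨t, ht, htb⟩ := IsLocalization.integerNormalization_spec (nonZeroDivisors R) b
  refine ⟨C t * IsLocalization.integerNormalization (nonZeroDivisors R) a,
    C s * IsLocalization.integerNormalization (nonZeroDivisors R) b, s * t,
    mul_ne_zero (nonZeroDivisors.ne_zero hs) (nonZeroDivisors.ne_zero ht), hinj ?_⟩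
  rw [Algebra.smul_def, Polynomial.algebraMap_apply] at hsa htb
  simp only [Polynomial.map_add, Polynomial.map_mul, map_C, map_mul]
  rw [hsa, htb]
  linear_combination (C ((algebraMap R L) s) * C ((algebraMap R L) t)) * hab

end Bezout

/-! ### Setting `X = 1`, and a Bézout identity that respects the lattice. -/

section Dehomogenization

open Polynomial

variable {K : Type*} [Field K] {n : ℕ}

/-- Setting `X_1 = … = X_n = 1`. -/
noncomputable def dehomogenize : (MvPolynomial (Fin n) K)[X] →+* K[X] :=
  mapRingHom (MvPolynomial.eval 1)

lemma coeff_dehomogenize (F : (MvPolynomial (Fin n) K)[X]) (j : ℕ) :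
    (dehomogenize F).coeff j = MvPolynomial.eval 1 (F.coeff j) := by
  simp [dehomogenize]

lemma IsHomogeneousAlong.coeff_dehomogenize {c e : Fin n → ℝ} {F : (MvPolynomial (Fin n) K)[X]}
    (hF : IsHomogeneousAlong c e F) {j : ℕ} {α : Fin n →₀ ℕ} (h : weight c α j = e) :
    (dehomogenize F).coeff j = (F.coeff j).coeff α := by
  rw [LooseEdge.coeff_dehomogenize, MvPolynomial.eval_eq]
  simp only [Pi.one_apply, one_pow, Finset.prod_const_one, mul_one]
  rw [Finset.sum_eq_single α]
  · intro β hβ hne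
    exact absurd (weight_left_injective ((hF j β (MvPolynomial.mem_support_iff.1 hβ)).trans h.symm))
      hne
  · exact MvPolynomial.notMem_support_iff.1

/-- The exponents of `y` in `q ∈ K[y]` are those of points of `ℕ^{n+1}` of weight `e`. -/
def IsLatticeAlong (c e : Fin n → ℝ) (q : K[X]) : Prop :=
  ∀ j, q.coeff j ≠ 0 → ∃ α : Fin n →₀ ℕ, weight c α j = e

lemma IsHomogeneousAlong.isLatticeAlong {c e : Fin n → ℝ} {F : (MvPolynomial (Fin n) K)[X]}
    (hF : IsHomogeneousAlong c e F) : IsLatticeAlong c e (dehomogenize F) := by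
  intro j hj
  rw [LooseEdge.coeff_dehomogenize] at hj
  have h0 : F.coeff j ≠ 0 := fun h0 => hj (by rw [h0, map_zero])
  obtain ⟨α, hα⟩ := MvPolynomial.ne_zero_iff.1 h0
  exact ⟨α, hF j α hα⟩

lemma IsHomogeneousAlong.coeff_dehomogenize_ne_zero {c e : Fin n → ℝ}
    {F : (MvPolynomial (Fin n) K)[X]} (hF : IsHomogeneousAlong c e F) {j : ℕ} :
    (dehomogenize F).coeff j ≠ 0 ↔ F.coeff j ≠ 0 := by
  constructor
  · intro h h0
    rw [LooseEdge.coeff_dehomogenize, h0, map_zero] at h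
    exact h rfl
  · intro h
    obtain ⟨α, hα⟩ := MvPolynomial.ne_zero_iff.1 h
    rwa [hF.coeff_dehomogenize (hF j α hα)]

lemma IsHomogeneousAlong.natDegree_dehomogenize {c e : Fin n → ℝ}
    {F : (MvPolynomial (Fin n) K)[X]} (hF : IsHomogeneousAlong c e F) :
    (dehomogenize F).natDegree = F.natDegree := by
  refine le_antisymm (natDegree_map_le) ?_
  by_cases h0 : F = 0
  · simp [h0]
  · refine le_natDegree_of_ne_zero (hF.coeff_dehomogenize_ne_zero.2 ?_)
    rw [coeff_natDegree]
    exact leadingCoeff_ne_zero.2 h0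

/-- A homogeneous relation between homogeneous polynomials. -/
lemma exists_homogeneous_relation {c eG eH : Fin n → ℝ} {G H : (MvPolynomial (Fin n) K)[X]}
    (hG : IsHomogeneousAlong c eG G) (hH : IsHomogeneousAlong c eH H)
    (h : ∃ (A B : (MvPolynomial (Fin n) K)[X]) (r : MvPolynomial (Fin n) K),
      r ≠ 0 ∧ A * G + B * H = C r) :
    ∃ (A B : (MvPolynomial (Fin n) K)[X]) (γ : Fin n →₀ ℕ) (a : K), a ≠ 0 ∧
      A * G + B * H = C (MvPolynomial.monomial γ a) := by
  classical
  obtain ⟨A, B, r, hr, hAB⟩ := h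
  obtain ⟨γ, hγ⟩ := MvPolynomial.ne_zero_iff.1 hr
  set t := weight c γ 0 with ht
  -- Take the component of weight `t` in `A * G + B * H = C r`. Since `r` does not involve `y`, its
  -- component is the single monomial with exponent `γ`.
  refine ⟨symbolicRestriction (RingHom.id K) A {p | (fun i => p.1 i + p.2 * c i) = t - eG},
    symbolicRestriction (RingHom.id K) B {p | (fun i => p.1 i + p.2 * c i) = t - eH},
    γ, r.coeff γ, hγ, toSeries_injective ?_⟩
  have key : ∀ (e : Fin n → ℝ) (F F' : (MvPolynomial (Fin n) K)[X]), IsHomogeneousAlong c e F →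
      component (weight c) (t - e) (toSeries F') * toSeries F
        = component (weight c) t (toSeries F' * toSeries F) := by
    intro e F F' hF
    have h1 : component (weight c) e (toSeries F) = toSeries F := by
      ext j α
      rw [coeff_component, coeff_toSeries]
      split_ifs with h
      · rfl
      · by_contra hne
        exact h (hF j α (Ne.symm hne))
    have h2 := component_mul (weight_add c) (s := t - e) (t := e) (g := toSeries F')
      (h := toSeries F) fun α i β j _ hβ h => by
        have := hF j β (by rwa [coeff_toSeries] at hβ)
        rw [this] at h
        exact ⟨add_right_cancel h, this⟩
    rw [sub_add_cancel, h1] at h2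
    exact h2.symm
  rw [map_add, map_mul, map_mul, toSeries_symbolicRestriction, toSeries_symbolicRestriction,
    key eG G A hG, key eH H B hH, ← map_mul, ← map_mul]
  ext j α
  have hc := congrArg (fun F => (F.coeff j).coeff α) hAB
  simp only [coeff_add, MvPolynomial.coeff_add, coeff_C] at hc
  rw [coeff_add, map_add, coeff_component, coeff_component, coeff_toSeries, coeff_toSeries,
    coeff_toSeries, coeff_C]
  have hjα : weight c α j = t → j = 0 → α = γ := fun h h0 => by
    subst h0
    exact weight_left_injective h
  split_ifs at hc ⊢ with h1 h2 h2
  · rw [hc, MvPolynomial.coeff_monomial, if_pos (hjα h1 h2).symm, hjα h1 h2]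
  · rw [hc]
  · rw [add_zero, MvPolynomial.coeff_monomial, if_neg]
    rintro rfl
    exact h1 (by rw [h2, ht])
  · simp

lemma isCoprime_dehomogenize {c eG eH : Fin n → ℝ} {G H : (MvPolynomial (Fin n) K)[X]}
    (hG : IsHomogeneousAlong c eG G) (hH : IsHomogeneousAlong c eH H) (hGm : G.Monic)
    (h : IsRelPrime G H) : IsCoprime (dehomogenize G) (dehomogenize H) := by
  obtain ⟨A, B, γ, a, ha, hAB⟩ :=
    exists_homogeneous_relation hG hH (exists_mul_add_mul_eq_C hGm h)
  have h1 := congrArg dehomogenize hAB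
  have h2 : dehomogenize (C (MvPolynomial.monomial γ a)) = C a := by
    simp [dehomogenize, MvPolynomial.eval_monomial]
  rw [h2, map_add, map_mul, map_mul] at h1
  refine ⟨C a⁻¹ * dehomogenize A, C a⁻¹ * dehomogenize B, ?_⟩
  have h3 : C a⁻¹ * C a = 1 := by rw [← C_mul, inv_mul_cancel₀ ha, C_1]
  linear_combination C a⁻¹ * h1 + h3

open Classical in
/-- The part of `q` consisting of the monomials `y^j` for which `v - j c` is integral. -/
noncomputable def integralPart (c v : Fin n → ℝ) (q : K[X]) : K[X] :=
  ∑ j ∈ q.support with ∃ β : Fin n → ℤ, ∀ i, (β i : ℝ) = v i - (j : ℕ) * c i, monomial j (q.coeff j)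

lemma coeff_integralPart (c v : Fin n → ℝ) (q : K[X]) (j : ℕ)
    [Decidable (∃ β : Fin n → ℤ, ∀ i, (β i : ℝ) = v i - j * c i)] :
    (integralPart c v q).coeff j
      = if ∃ β : Fin n → ℤ, ∀ i, (β i : ℝ) = v i - j * c i then q.coeff j else 0 := by
  classical
  rw [integralPart, finsetSum_coeff]
  simp only [coeff_monomial, Finset.sum_ite_eq', Finset.mem_filter, mem_support_iff]
  by_cases h0 : q.coeff j = 0
  · simp [h0]
  · simp [h0]

/-- Multiplying by a monomial of `p` shifts the exponent of `x` by a lattice vector, so integrality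
is preserved in both directions. Thus `integralPart` is linear over such `p` and can be applied to a
Bézout identity. -/
lemma integralPart_mul {c v e : Fin n → ℝ} {q p : K[X]} (hp : IsLatticeAlong c e p) :
    integralPart c (v + e) (q * p) = integralPart c v q * p := by
  classical
  ext l
  have key : ∀ i j, i + j = l → p.coeff j ≠ 0 →
      ((∃ β : Fin n → ℤ, ∀ a, (β a : ℝ) = v a - i * c a) ↔
        ∃ β : Fin n → ℤ, ∀ a, (β a : ℝ) = (v + e) a - l * c a) := by
    rintro i j rfl hj
    obtain ⟨α, hα⟩ := hp j hj
    have hα' : ∀ a, (α a : ℝ) + j * c a = e a := fun a => congrFun hα a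
    constructor
    · rintro ⟨β, hβ⟩
      refine ⟨fun a => β a + α a, fun a => ?_⟩
      push_cast
      rw [hβ, Pi.add_apply, ← hα' a]
      ring
    · rintro ⟨β, hβ⟩
      refine ⟨fun a => β a - α a, fun a => ?_⟩
      push_cast
      rw [hβ, Pi.add_apply, ← hα' a]
      push_cast
      ring
  rw [coeff_integralPart, coeff_mul, coeff_mul]
  simp only [coeff_integralPart]
  by_cases hl : ∃ β : Fin n → ℤ, ∀ a, (β a : ℝ) = (v + e) a - l * c a
  · rw [if_pos hl]
    refine Finset.sum_congr rfl fun x hx => ?_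
    rw [Finset.HasAntidiagonal.mem_antidiagonal] at hx
    by_cases h0 : p.coeff x.2 = 0
    · simp [h0]
    · rw [if_pos ((key _ _ hx h0).2 hl)]
  · rw [if_neg hl]
    symm
    refine Finset.sum_eq_zero fun x hx => ?_
    rw [Finset.HasAntidiagonal.mem_antidiagonal] at hx
    by_cases h0 : p.coeff x.2 = 0
    · simp [h0]
    · rw [if_neg fun h => hl ((key _ _ hx h0).1 h), zero_mul]

lemma integralPart_add (c v : Fin n → ℝ) (q p : K[X]) :
    integralPart c v (q + p) = integralPart c v q + integralPart c v p := by
  classical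
  ext j
  simp only [coeff_integralPart, coeff_add]
  split_ifs <;> simp

lemma exists_finsupp_of_integral {v : Fin n → ℝ} (h0 : ∀ i, 0 ≤ v i)
    (h : ∃ β : Fin n → ℤ, ∀ i, (β i : ℝ) = v i) : ∃ α : Fin n →₀ ℕ, ∀ i, (α i : ℝ) = v i := by
  obtain ⟨β, hβ⟩ := h
  refine ⟨Finsupp.equivFunOnFinite.symm fun i => (β i).toNat, fun i => ?_⟩
  have h1 : 0 ≤ β i := by
    have := h0 i
    rw [← hβ] at this
    exact_mod_cast this
  rw [← hβ]
  change (((β i).toNat : ℕ) : ℝ) = _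
  exact_mod_cast Int.toNat_of_nonneg h1

/-- The monomials of weight at least that of `GH` are homogeneous combinations of `G` and `H`. -/
lemma exists_lattice_bezout {c eH : Fin n → ℝ} (hc : ∀ i, 0 ≤ c i) {G H : K[X]} (hGm : G.Monic)
    (hcop : IsCoprime G H) (hG : IsLatticeAlong c (weight c 0 G.natDegree) G)
    (hH : IsLatticeAlong c eH H) (hH0 : H ≠ 0) (α : Fin n →₀ ℕ) (k : ℕ)
    (hge : ∀ i, weight c 0 G.natDegree i + eH i ≤ weight c α k i) :
    ∃ φ ψ : K[X], (∀ j, G.natDegree ≤ j → φ.coeff j = 0) ∧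
      (∀ j, ψ.coeff j ≠ 0 → j + G.natDegree ≤ max k (G.natDegree + H.natDegree)) ∧
      IsLatticeAlong c (weight c α k - eH) φ ∧
      IsLatticeAlong c (weight c α k - weight c 0 G.natDegree) ψ ∧
      φ * H + ψ * G = X ^ k := by
  classical
  obtain ⟨A, B, hAB⟩ := hcop
  set d := G.natDegree with hd
  have hw0 : ∀ i, weight c 0 d i = d * c i := fun i => by simp [weight]
  -- Bézout times `y^k`, with the multiplier of `H` reduced modulo `G`. The bound on `deg φ₀` then
  -- bounds `deg ψ₀`.
  set φ₀ := (X ^ k * B) %ₘ G with hφ₀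
  set ψ₀ := X ^ k * A + ((X ^ k * B) /ₘ G) * H with hψ₀
  have hrel : φ₀ * H + ψ₀ * G = X ^ k := by
    have := modByMonic_add_div (X ^ k * B) G
    rw [hφ₀, hψ₀]
    linear_combination H * this + X ^ k * hAB
  have hφdeg : ∀ j, d ≤ j → φ₀.coeff j = 0 := fun j hj => by
    refine coeff_eq_zero_of_degree_lt ((degree_modByMonic_lt _ hGm).trans_le ?_)
    rw [degree_eq_natDegree hGm.ne_zero]
    exact_mod_cast hj
  have hψdeg : ∀ j, ψ₀.coeff j ≠ 0 → j + d ≤ max k (d + H.natDegree) := by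
    intro j hj
    have h1 : ψ₀ * G = X ^ k - φ₀ * H := by linear_combination hrel
    have h0 : ψ₀ ≠ 0 := fun h0 => hj (by rw [h0, coeff_zero])
    have h2 : (ψ₀ * G).natDegree = ψ₀.natDegree + d := natDegree_mul h0 hGm.ne_zero
    have h3 : (X ^ k - φ₀ * H).natDegree ≤ max k (d + H.natDegree) := by
      refine (natDegree_sub_le _ _).trans (max_le_max (natDegree_X_pow_le k) ?_)
      refine natDegree_mul_le.trans (Nat.add_le_add_right ?_ _)
      rw [natDegree_le_iff_coeff_eq_zero]
      exact fun j hj => hφdeg j hj.le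
    have h4 := le_natDegree_of_ne_zero hj
    rw [h1] at h2
    omega
  refine ⟨integralPart c (weight c α k - eH) φ₀, integralPart c (weight c α k - weight c 0 d) ψ₀,
    fun j hj => ?_, fun j hj => hψdeg j ?_, fun j hj => ?_, fun j hj => ?_, ?_⟩
  · rw [coeff_integralPart, hφdeg j hj, ite_self]
  · rw [coeff_integralPart] at hj
    exact (ite_ne_right_iff.1 hj).2
  · rw [coeff_integralPart, ite_ne_right_iff] at hj
    obtain ⟨hβ, hj⟩ := hj
    have hjd : j < d := by
      by_contra h
      exact hj (hφdeg j (not_lt.1 h))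
    -- By `hge` this is at least `(d - j) c i`, and `j < d`.
    have hnn : ∀ i, 0 ≤ (weight c α k - eH) i - j * c i := fun i => by
      have h1 := hge i
      rw [hw0] at h1
      have h2 : (j : ℝ) * c i ≤ d * c i :=
        mul_le_mul_of_nonneg_right (by exact_mod_cast hjd.le) (hc i)
      rw [Pi.sub_apply]
      linarith
    obtain ⟨β, hβ⟩ := exists_finsupp_of_integral hnn hβ
    refine ⟨β, funext fun i => ?_⟩
    simp only [weight] at hβ ⊢
    rw [hβ]
    ring
  · rw [coeff_integralPart, ite_ne_right_iff] at hj
    obtain ⟨hβ, hj⟩ := hj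
    have hjd := hψdeg j hj
    have hnn : ∀ i, 0 ≤ (weight c α k - weight c 0 d) i - j * c i := fun i => by
      rw [Pi.sub_apply, hw0]
      -- If `j + d ≤ k`, the quantity is at least `α i`. Otherwise `j ≤ deg H`, and by `hge` it is
      -- at least the exponent of `x` in the leading term of `H`.
      rcases le_max_iff.1 hjd with h | h
      · have h2 : ((j + d : ℕ) : ℝ) * c i ≤ k * c i :=
          mul_le_mul_of_nonneg_right (by exact_mod_cast h) (hc i)
        push_cast at h2
        have h3 : (0 : ℝ) ≤ α i := Nat.cast_nonneg _
        simp only [weight]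
        linarith
      · obtain ⟨β, hβ⟩ := hH H.natDegree (by
          rw [coeff_natDegree]
          exact leadingCoeff_ne_zero.2 hH0)
        have h1 := hge i
        rw [hw0, ← hβ] at h1
        have h2 : (j : ℝ) * c i ≤ H.natDegree * c i :=
          mul_le_mul_of_nonneg_right (by exact_mod_cast (by omega : j ≤ H.natDegree)) (hc i)
        have h3 : (0 : ℝ) ≤ β i := Nat.cast_nonneg _
        have h4 : weight c β H.natDegree i = β i + H.natDegree * c i := rfl
        linarith
    obtain ⟨β, hβ⟩ := exists_finsupp_of_integral hnn hβ
    refine ⟨β, funext fun i => ?_⟩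
    simp only [weight] at hβ ⊢
    rw [hβ]
    ring
  · have h1 := integralPart_mul (v := weight c α k - eH) (q := φ₀) hH
    have h2 := integralPart_mul (v := weight c α k - weight c 0 d) (q := ψ₀) hG
    rw [sub_add_cancel] at h1 h2
    rw [← h1, ← h2, ← integralPart_add, hrel]
    -- The monomial `y^k` survives `integralPart`, because at `j = k` the required vector is `α`
    -- itself.
    ext j
    rw [coeff_integralPart, coeff_X_pow]
    split_ifs with h3 h4 h4 <;> try rfl
    subst h4
    exact absurd ⟨fun i => α i, fun i => by simp [weight]⟩ h3

end Dehomogenization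

/-! ### Monomial ideals defined by a corner and a total degree. -/

section MonomialIdeals

variable {S : Type*} [CommRing S] {n : ℕ} (x : Fin n → S)

/-- The monomial `x^α`. -/
def xpow (α : Fin n →₀ ℕ) : S := ∏ i, x i ^ α i

@[simp] lemma xpow_zero : xpow x 0 = 1 := by simp [xpow]

lemma xpow_add (α β : Fin n →₀ ℕ) : xpow x (α + β) = xpow x α * xpow x β := by
  simp [xpow, pow_add, Finset.prod_mul_distrib]

lemma xpow_single (i : Fin n) : xpow x (Finsupp.single i 1) = x i := by
  classical
  rw [xpow, Finset.prod_eq_single i]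
  · simp
  · intro j _ hj
    simp [hj.symm]
  · simp

lemma eval_monomial_eq (α : Fin n →₀ ℕ) (a : S) :
    MvPolynomial.eval x (MvPolynomial.monomial α a) = a * xpow x α := by
  rw [MvPolynomial.eval_monomial, xpow, Finsupp.prod_fintype _ _ fun i => pow_zero _]

lemma xpow_mem_pow (α : Fin n →₀ ℕ) : xpow x α ∈ Ideal.span (Set.range x) ^ ∑ i, α i := by
  rw [xpow, ← Finset.prod_pow_eq_pow_sum]
  exact Ideal.prod_mem_prod fun i _ =>
    Ideal.pow_mem_pow (Ideal.subset_span (Set.mem_range_self i)) _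

lemma span_pow_eq (k : ℕ) : Ideal.span (Set.range x) ^ k
    = Ideal.span (xpow x '' {α : Fin n →₀ ℕ | ∑ i, α i = k}) := by
  refine le_antisymm ?_ ?_
  · induction k with
    | zero =>
      refine fun s _ => ?_
      rw [← mul_one s, ← xpow_zero x]
      exact Ideal.mul_mem_left _ _ (Ideal.subset_span ⟨0, by simp, rfl⟩)
    | succ k ih =>
      rw [pow_succ]
      refine (Ideal.mul_mono_left ih).trans ?_
      rw [Ideal.span_mul_span', Ideal.span_le]
      rintro _ ⟨_, ⟨α, hα, rfl⟩, _, ⟨i, rfl⟩, rfl⟩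
      refine Ideal.subset_span ⟨α + Finsupp.single i 1, ?_, ?_⟩
      · change ∑ j, (α j + Finsupp.single i 1 j) = k + 1
        rw [Finset.sum_add_distrib, show ∑ j, α j = k from hα]
        simp [Finsupp.single_apply]
      · simp only [xpow_add, xpow_single]
  · rw [Ideal.span_le]
    rintro _ ⟨α, rfl, rfl⟩
    exact xpow_mem_pow x α

/-- The ideal generated by the `x^α` with `α ≥ a` and `|α| ≥ |a| + t`. -/
def monomialIdeal (a : Fin n → ℝ) (t : ℝ) : Ideal S :=
  Ideal.span (xpow x '' {α : Fin n →₀ ℕ | (∀ i, a i ≤ α i) ∧ ∑ i, a i + t ≤ ∑ i, (α i : ℝ)})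

variable {x}

lemma xpow_mem_monomialIdeal {a : Fin n → ℝ} {t : ℝ} {α : Fin n →₀ ℕ} (h1 : ∀ i, a i ≤ α i)
    (h2 : ∑ i, a i + t ≤ ∑ i, (α i : ℝ)) : xpow x α ∈ monomialIdeal x a t :=
  Ideal.subset_span ⟨α, ⟨h1, h2⟩, rfl⟩

lemma monomialIdeal_mono {a b : Fin n → ℝ} {t u : ℝ} (h1 : ∀ i, a i ≤ b i)
    (h2 : ∑ i, a i + t ≤ ∑ i, b i + u) : monomialIdeal x b u ≤ monomialIdeal x a t :=
  Ideal.span_mono (Set.image_mono fun _ hα =>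
    ⟨fun i => (h1 i).trans (hα.1 i), h2.trans hα.2⟩)

lemma mul_mem_monomialIdeal {a b : Fin n → ℝ} {t u : ℝ} {r s : S} (hr : r ∈ monomialIdeal x a t)
    (hs : s ∈ monomialIdeal x b u) : r * s ∈ monomialIdeal x (a + b) (t + u) := by
  have h := Ideal.mul_mem_mul hr hs
  rw [monomialIdeal, monomialIdeal, Ideal.span_mul_span'] at h
  refine (Ideal.span_le.2 ?_) h
  rintro _ ⟨_, ⟨α, hα, rfl⟩, _, ⟨β, hβ, rfl⟩, rfl⟩
  refine Ideal.subset_span ⟨α + β, ⟨fun i => ?_, ?_⟩, xpow_add x α β⟩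
  · rw [Pi.add_apply, Finsupp.add_apply]
    push_cast
    exact add_le_add (hα.1 i) (hβ.1 i)
  · simp only [Pi.add_apply, Finsupp.add_apply]
    push_cast
    rw [Finset.sum_add_distrib, Finset.sum_add_distrib]
    have := hα.2
    have := hβ.2
    linarith

lemma span_range_le_monomialIdeal : Ideal.span (Set.range x) ≤ monomialIdeal x 0 1 := by
  rw [Ideal.span_le]
  rintro _ ⟨i, rfl⟩
  rw [← xpow_single x i]
  refine xpow_mem_monomialIdeal (fun j => ?_) ?_
  · simp
  · simp [Finsupp.single_apply]

lemma mul_mem_monomialIdeal_add_one {a : Fin n → ℝ} {t : ℝ} {r s : S}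
    (hr : r ∈ Ideal.span (Set.range x)) (hs : s ∈ monomialIdeal x a t) :
    r * s ∈ monomialIdeal x a (t + 1) := by
  have := mul_mem_monomialIdeal (span_range_le_monomialIdeal hr) hs
  rwa [zero_add, add_comm] at this

lemma monomialIdeal_le_pow_ceil {a : Fin n → ℝ} {t : ℝ} :
    monomialIdeal x a t ≤ Ideal.span (Set.range x) ^ ⌈∑ i, a i + t⌉₊ := by
  rw [monomialIdeal, Ideal.span_le]
  rintro _ ⟨α, hα, rfl⟩
  refine Ideal.pow_le_pow_right (Nat.ceil_le.2 ?_) (xpow_mem_pow x α)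
  have := hα.2
  exact_mod_cast this

lemma monomialIdeal_le_pow {a : Fin n → ℝ} {t : ℝ} {k : ℕ} (h : (k : ℝ) ≤ ∑ i, a i + t) :
    monomialIdeal x a t ≤ Ideal.span (Set.range x) ^ k :=
  monomialIdeal_le_pow_ceil.trans (Ideal.pow_le_pow_right (by
    exact_mod_cast h.trans (Nat.le_ceil _)))

/-- The least lattice point of the nonnegative orthant above `a`. -/
noncomputable def ceil (a : Fin n → ℝ) : Fin n →₀ ℕ := Finsupp.equivFunOnFinite.symm fun i => ⌈a i⌉₊

@[simp] lemma ceil_apply (a : Fin n → ℝ) (i : Fin n) : ceil a i = ⌈a i⌉₊ := rfl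

/-- Every generator is divisible by `x^(ceil a)`, and the cofactor is subject only to a bound on its
degree. So the ideal is one monomial times a power of `m`, which reduces convergence inside it to
convergence in the `m`-adic topology. -/
lemma mem_monomialIdeal_iff {a : Fin n → ℝ} {t : ℝ} {s : S} : s ∈ monomialIdeal x a t ↔
    ∃ u ∈ Ideal.span (Set.range x) ^ ⌈∑ i, a i + t - ∑ i, (ceil a i : ℝ)⌉₊,
      s = xpow x (ceil a) * u := by
  constructor
  · intro hs
    have hle : monomialIdeal x a t ≤ Ideal.span {xpow x (ceil a)} *
        Ideal.span (Set.range x) ^ ⌈∑ i, a i + t - ∑ i, (ceil a i : ℝ)⌉₊ := by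
      rw [monomialIdeal, Ideal.span_le]
      rintro _ ⟨α, hα, rfl⟩
      have hle : ceil a ≤ α := fun i => Nat.ceil_le.2 (hα.1 i)
      obtain ⟨β, rfl⟩ := exists_add_of_le hle
      rw [xpow_add]
      refine Ideal.mul_mem_mul (Ideal.mem_span_singleton_self _)
        (Ideal.pow_le_pow_right ?_ (xpow_mem_pow x β))
      rw [Nat.ceil_le]
      have := hα.2
      simp only [Finsupp.add_apply] at this
      push_cast at this ⊢
      rw [Finset.sum_add_distrib] at this
      linarith
    obtain ⟨u, hu, hus⟩ := Ideal.mem_span_singleton_mul.1 (hle hs)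
    exact ⟨u, hu, hus.symm⟩
  · rintro ⟨u, hu, rfl⟩
    rw [span_pow_eq] at hu
    induction hu using Submodule.span_induction with
    | mem u hu =>
      obtain ⟨β, hβ, rfl⟩ := hu
      rw [← xpow_add]
      refine xpow_mem_monomialIdeal (fun i => ?_) ?_
      · rw [Finsupp.add_apply, ceil_apply]
        push_cast
        exact (Nat.le_ceil _).trans (le_add_of_nonneg_right (Nat.cast_nonneg _))
      · have h1 : ∑ i, a i + t - ∑ i, (ceil a i : ℝ) ≤ ((∑ i, β i : ℕ) : ℝ) := by
          rw [show ∑ i, β i = _ from hβ]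
          exact Nat.le_ceil _
        push_cast at h1
        simp only [Finsupp.add_apply]
        push_cast
        rw [Finset.sum_add_distrib]
        linarith
    | zero => rw [mul_zero]; exact zero_mem _
    | add u v _ _ hu hv => rw [mul_add]; exact add_mem hu hv
    | smul c u _ hu =>
      rw [smul_eq_mul, mul_left_comm]
      exact Ideal.mul_mem_left _ _ hu

end MonomialIdeals

/-! ### Convergence of series in adically complete rings. -/

section Complete

variable {S : Type*} [CommRing S]

lemma sum_range_sub_sum_range_mem {I : Ideal S} {s : ℕ → S} {κ : ℕ → ℕ} (hκ : Monotone κ)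
    (hs : ∀ k, s k ∈ I ^ κ k) {a b : ℕ} (hab : a ≤ b) :
    ∑ k ∈ Finset.range b, s k - ∑ k ∈ Finset.range a, s k ∈ I ^ κ a := by
  rw [← Finset.sum_Ico_eq_sub _ hab]
  exact Ideal.sum_mem _ fun k hk =>
    Ideal.pow_le_pow_right (hκ (Finset.mem_Ico.1 hk).1) (hs k)

/-- Convergence of series in complete rings. -/
lemma exists_sum_of_isAdicComplete (I : Ideal S) [IsAdicComplete I S] {s : ℕ → S} {κ : ℕ → ℕ}
    (hκ : Monotone κ) (hub : ∀ N, ∃ k, N ≤ κ k) (hs : ∀ k, s k ∈ I ^ κ k) :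
    ∃ L, ∀ N, L - ∑ k ∈ Finset.range N, s k ∈ I ^ κ N := by
  choose M hM using hub
  -- A subsequence of partial sums that is monotone, satisfies `κ (M' N) ≥ N` as precompleteness
  -- requires, and has `M' N ≥ N` so that it eventually passes any given index.
  let M' : ℕ → ℕ := fun N => ∑ i ∈ Finset.range (N + 1), M i + N
  have hM'mono : Monotone M' := fun a b hab => by
    simp only [M']
    exact add_le_add (Finset.sum_le_sum_of_subset (Finset.range_subset_range.2 (by omega))) hab
  have hM' : ∀ N, N ≤ κ (M' N) := fun N => (hM N).trans (hκ ((Finset.single_le_sum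
    (f := M) (fun _ _ => Nat.zero_le _) (Finset.self_mem_range_succ N)).trans
      (Nat.le_add_right _ _)))
  have hpre : IsPrecomplete I S := inferInstance
  obtain ⟨L, hL⟩ := hpre.prec' (fun N => ∑ k ∈ Finset.range (M' N), s k) fun {a b} hab => by
    rw [SModEq.comm, SModEq.sub_mem, smul_eq_mul, Ideal.mul_top]
    exact Ideal.pow_le_pow_right (hM' a) (sum_range_sub_sum_range_mem hκ hs (hM'mono hab))
  refine ⟨L, fun N => ?_⟩
  have h1 := hL (max N (κ N))
  rw [SModEq.comm, SModEq.sub_mem, smul_eq_mul, Ideal.mul_top] at h1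
  have h2 := Ideal.pow_le_pow_right (le_max_right N (κ N)) h1
  have h3 := sum_range_sub_sum_range_mem hκ hs
    (show N ≤ M' (max N (κ N)) from (le_max_left _ _).trans (Nat.le_add_left _ _))
  have := add_mem h2 h3
  rwa [sub_add_sub_cancel] at this

lemma eq_zero_of_forall_mem_pow (I : Ideal S) [IsAdicComplete I S] {s : S}
    (h : ∀ k, s ∈ I ^ k) : s = 0 := by
  have hh : IsHausdorff I S := inferInstance
  refine hh.haus' s fun k => ?_
  rw [SModEq.zero, smul_eq_mul, Ideal.mul_top]
  exact h k

variable {n : ℕ} {x : Fin n → S}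

lemma exists_sum_mem_monomialIdeal [IsAdicComplete (Ideal.span (Set.range x)) S]
    {a : Fin n → ℝ} {τ : ℕ → ℝ} (hτ : Monotone τ) (hub : ∀ C, ∃ k, C ≤ τ k) {r : ℕ → S}
    (hr : ∀ k, r k ∈ monomialIdeal x a (τ k)) :
    ∃ L, ∀ N, L - ∑ k ∈ Finset.range N, r k ∈ monomialIdeal x a (τ N) := by
  choose u hu hru using fun k => mem_monomialIdeal_iff.1 (hr k)
  obtain ⟨L, hL⟩ := exists_sum_of_isAdicComplete (Ideal.span (Set.range x))
    (κ := fun k => ⌈∑ i, a i + τ k - ∑ i, (ceil a i : ℝ)⌉₊)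
    (fun k l hkl => Nat.ceil_mono (by have := hτ hkl; linarith))
    (fun N => by
      obtain ⟨k, hk⟩ := hub (N - ∑ i, a i + ∑ i, (ceil a i : ℝ))
      refine ⟨k, ?_⟩
      have : (N : ℝ) ≤ ⌈∑ i, a i + τ k - ∑ i, (ceil a i : ℝ)⌉₊ :=
        le_trans (by linarith) (Nat.le_ceil _)
      exact_mod_cast this) hu
  -- The limit is taken on the cofactors, so it stays in the monomial ideal without any closedness
  -- argument.
  refine ⟨xpow x (ceil a) * L, fun N => mem_monomialIdeal_iff.2 ⟨_, hL N, ?_⟩⟩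
  rw [mul_sub, Finset.mul_sum]
  congr 1
  exact Finset.sum_congr rfl fun k _ => hru k

end Complete

/-! ### Finite unit expansions in a complete ring. -/

section UnitExpansions

variable {S K : Type*} [CommRing S] [Field K] {n : ℕ} {x : Fin n → S} {π : S →+* K}

/-- The ideal lies in the Jacobson radical, so an inverse modulo the ideal makes the element a unit.
-/
lemma isUnit_of_map_ne_zero (hπ : Function.Surjective π)
    (hker : RingHom.ker π = Ideal.span (Set.range x)) [IsAdicComplete (Ideal.span (Set.range x)) S]
    {s : S} (hs : π s ≠ 0) : IsUnit s := by
  obtain ⟨b, hb⟩ := hπ (π s)⁻¹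
  have h1 : s * b - 1 ∈ Ideal.span (Set.range x) := by
    rw [← hker, RingHom.mem_ker, map_sub, map_mul, hb, mul_inv_cancel₀ hs, map_one, sub_self]
  have h2 := Ideal.mem_jacobson_bot.1 (IsAdicComplete.le_jacobson_bot _ h1) 1
  rw [mul_one, sub_add_cancel] at h2
  exact isUnit_of_mul_isUnit_left h2

lemma sub_section_mem (hker : RingHom.ker π = Ideal.span (Set.range x)) {σ : K → S}
    (hσ : ∀ a, π (σ a) = a) (s : S) : s - σ (π s) ∈ Ideal.span (Set.range x) := by
  rw [← hker, RingHom.mem_ker, map_sub, hσ, sub_self]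

lemma map_xpow (hker : RingHom.ker π = Ideal.span (Set.range x)) {α : Fin n →₀ ℕ} (hα : α ≠ 0) :
    π (xpow x α) = 0 := by
  rw [← RingHom.mem_ker, hker]
  refine Ideal.pow_le_self (fun h0 => hα ?_) (xpow_mem_pow x α)
  ext i
  exact (Finset.sum_eq_zero_iff.1 h0) i (Finset.mem_univ i)

/-- The exponents of total degree `N`. -/
noncomputable def exponents (n N : ℕ) : Finset (Fin n →₀ ℕ) := Finset.univ.finsuppAntidiag N

lemma mem_exponents {N : ℕ} {α : Fin n →₀ ℕ} : α ∈ exponents n N ↔ ∑ i, α i = N := by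
  simp [exponents, Finset.mem_finsuppAntidiag]

/-- The leading digits of an element of `m^N`. -/
lemma exists_digits (hker : RingHom.ker π = Ideal.span (Set.range x)) {σ : K → S}
    (hσ : ∀ a, π (σ a) = a) {N : ℕ} {r : S} (hr : r ∈ Ideal.span (Set.range x) ^ N) :
    ∃ a : (Fin n →₀ ℕ) → K, r - ∑ α ∈ exponents n N, σ (a α) * xpow x α
      ∈ Ideal.span (Set.range x) ^ (N + 1) := by
  have hset : {α : Fin n →₀ ℕ | ∑ i, α i = N} = exponents n N := by
    ext α
    rw [Finset.mem_coe, mem_exponents]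
    rfl
  rw [span_pow_eq, hset, Ideal.span, Submodule.mem_span_image_finset_iff_exists_fun'] at hr
  obtain ⟨b, rfl⟩ := hr
  refine ⟨fun α => π (b α), ?_⟩
  rw [← Finset.sum_sub_distrib]
  refine Ideal.sum_mem _ fun α hα => ?_
  rw [smul_eq_mul, ← sub_mul, pow_succ']
  refine Ideal.mul_mem_mul (sub_section_mem hker hσ _) ?_
  rw [← mem_exponents.1 hα]
  exact xpow_mem_pow x α

/-- Expansion of an element of `m^k` into an infinite series. -/
lemma exists_series (hker : RingHom.ker π = Ideal.span (Set.range x)) {σ : K → S}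
    (hσ : ∀ a, π (σ a) = a) {k : ℕ} {s : S} (hs : s ∈ Ideal.span (Set.range x) ^ k) :
    ∃ a : (Fin n →₀ ℕ) → K, ∀ N,
      s - ∑ j ∈ Finset.range N, ∑ α ∈ exponents n (k + j), σ (a α) * xpow x α
        ∈ Ideal.span (Set.range x) ^ (k + N) := by
  have hD : ∀ (N : ℕ) (r : S), ∃ a : (Fin n →₀ ℕ) → K, r ∈ Ideal.span (Set.range x) ^ N →
      r - ∑ α ∈ exponents n N, σ (a α) * xpow x α ∈ Ideal.span (Set.range x) ^ (N + 1) := by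
    intro N r
    by_cases hr : r ∈ Ideal.span (Set.range x) ^ N
    · obtain ⟨a, ha⟩ := exists_digits hker hσ hr
      exact ⟨a, fun _ => ha⟩
    · exact ⟨0, fun h => absurd h hr⟩
  choose D hD using hD
  let r : ℕ → S := fun N => Nat.rec s
    (fun j rj => rj - ∑ α ∈ exponents n (k + j), σ (D (k + j) rj α) * xpow x α) N
  have hr0 : r 0 = s := rfl
  have hrs : ∀ j, r (j + 1)
      = r j - ∑ α ∈ exponents n (k + j), σ (D (k + j) (r j) α) * xpow x α := fun _ => rfl
  have hr : ∀ j, r j ∈ Ideal.span (Set.range x) ^ (k + j) := fun j => by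
    induction j with
    | zero => exact hs
    | succ j ih =>
      rw [hrs]
      exact hD _ _ ih
  -- An exponent occurs only at the stage given by its degree, so the digits of all stages combine
  -- into one function.
  refine ⟨fun α => D (∑ i, α i) (r (∑ i, α i - k)) α, fun N => ?_⟩
  have : s - ∑ j ∈ Finset.range N, ∑ α ∈ exponents n (k + j),
      σ (D (∑ i, α i) (r (∑ i, α i - k)) α) * xpow x α = r N := by
    induction N with
    | zero => simp [hr0]
    | succ N ih =>
      rw [Finset.sum_range_succ, ← sub_sub, ih, hrs]
      congr 1
      refine Finset.sum_congr rfl fun α hα => ?_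
      rw [mem_exponents.1 hα, Nat.add_sub_cancel_left]
  rw [this]
  exact hr N

/-- In a complete ring the elements of `m^k` have finite expansions with unit coefficients and
exponents of degree at least `k`. -/
theorem exists_unit_expansion_of_mem_pow (hπ : Function.Surjective π)
    (hker : RingHom.ker π = Ideal.span (Set.range x)) [IsAdicComplete (Ideal.span (Set.range x)) S]
    {k : ℕ} {s : S} (hs : s ∈ Ideal.span (Set.range x) ^ k) :
    ∃ p : MvPolynomial (Fin n) S, (∀ α, p.coeff α = 0 ∨ IsUnit (p.coeff α)) ∧
      (∀ α, p.coeff α ≠ 0 → k ≤ ∑ i, α i) ∧ MvPolynomial.eval x p = s := by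
  classical
  obtain ⟨σ', hσ'⟩ := hπ.hasRightInverse
  -- Zero digits must contribute nothing, so that only exponents in `T` occur in the series.
  let σ : K → S := fun a => if a = 0 then 0 else σ' a
  have hσ0 : σ 0 = 0 := if_pos rfl
  have hσ : ∀ a, π (σ a) = a := fun a => by
    by_cases h : a = 0
    · rw [h, hσ0, map_zero]
    · simp only [σ, if_neg h, hσ' a]
  obtain ⟨a, ha⟩ := exists_series hker hσ hs
  let T : Set (Fin n →₀ ℕ) := {α | k ≤ ∑ i, α i ∧ a α ≠ 0}
  -- Dickson's lemma. Each exponent `α` of the series is then assigned to one minimal exponent `b α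
  -- ≤ α`, and the series is regrouped as a finite sum of `x^β u_β`.
  have hBfin : {β | Minimal (· ∈ T) β}.Finite :=
    (setOfPred_minimal_antichain _).finite_of_partiallyWellOrderedOn (Set.isPWO_of_wellQuasiOrderedLE _)
  have hb : ∀ α, ∃ β, α ∈ T → β ≤ α ∧ Minimal (· ∈ T) β := fun α => by
    by_cases hα : α ∈ T
    · obtain ⟨β, hβ⟩ := exists_minimal_le_of_wellFoundedLT (· ∈ T) α hα
      exact ⟨β, fun _ => hβ⟩
    · exact ⟨0, fun h => absurd h hα⟩
  choose b hb using hb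
  have hdeg : ∀ {α β : Fin n →₀ ℕ}, β ≤ α → ∑ i, α i = ∑ i, β i + ∑ i, (α - β) i := by
    intro α β h
    rw [← Finset.sum_add_distrib]
    refine Finset.sum_congr rfl fun i _ => ?_
    have := h i
    simp only [Finsupp.tsub_apply]
    omega
  let term : (Fin n →₀ ℕ) → ℕ → S := fun β j =>
    ∑ α ∈ exponents n (k + j) with α ∈ T ∧ b α = β, σ (a α) * xpow x (α - β)
  have hterm : ∀ β j, term β j ∈ Ideal.span (Set.range x) ^ (k + j - ∑ i, β i) := by
    intro β j
    refine Ideal.sum_mem _ fun α hα => Ideal.mul_mem_left _ _ ?_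
    obtain ⟨h1, h2, rfl⟩ := Finset.mem_filter.1 hα
    have h3 := hdeg (hb α h2).1
    rw [mem_exponents.1 h1] at h3
    rw [h3, Nat.add_sub_cancel_left]
    exact xpow_mem_pow x _
  choose u hu using fun β => exists_sum_of_isAdicComplete (Ideal.span (Set.range x))
    (κ := fun j => k + j - ∑ i, β i) (fun j l hjl => Nat.sub_le_sub_right (by omega) _)
    (fun N => ⟨N + ∑ i, β i, by omega⟩) (hterm β)
  have hB : ∀ β, β ∈ hBfin.toFinset ↔ Minimal (· ∈ T) β := fun β => hBfin.mem_toFinset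
  have hunit : ∀ β ∈ hBfin.toFinset, π (u β) ≠ 0 := by
    intro β hβ
    rw [hB] at hβ
    have hβT : β ∈ T := hβ.1
    have hbβ : b β = β := (hb β hβT).1.antisymm (hβ.2 (hb β hβT).2.1 (hb β hβT).1)
    -- `β` has degree `k + m`, so it enters at stage `m`. After `m + 1` stages the remainder of `u
    -- β` lies in the ideal, and modulo the ideal only the digit `a β ≠ 0` is left.
    obtain ⟨m, hm⟩ := exists_add_of_le hβT.1
    have h1 := hu β (m + 1)
    have h2 : u β - ∑ j ∈ Finset.range (m + 1), term β j ∈ RingHom.ker π := by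
      rw [hker]
      exact Ideal.pow_le_self (by omega) h1
    rw [RingHom.mem_ker, map_sub, sub_eq_zero] at h2
    have hzero : ∀ α, α ∈ T → b α = β → α ≠ β → π (σ (a α) * xpow x (α - β)) = 0 := by
      rintro α hα rfl hne
      rw [map_mul, map_xpow hker, mul_zero]
      intro h0
      exact hne ((tsub_eq_zero_iff_le.1 h0).antisymm (hb α hα).1)
    have h3 : π (∑ j ∈ Finset.range (m + 1), term β j) = a β := by
      rw [map_sum, Finset.sum_eq_single m]
      · rw [map_sum, Finset.sum_eq_single β]
        · rw [map_mul, hσ, tsub_self, xpow_zero, map_one, mul_one]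
        · intro α hα hne
          obtain ⟨-, h4, h5⟩ := Finset.mem_filter.1 hα
          exact hzero α h4 h5 hne
        · intro hn
          exact absurd (Finset.mem_filter.2 ⟨mem_exponents.2 hm, hβT, hbβ⟩) hn
      · intro j _ hj
        rw [map_sum]
        refine Finset.sum_eq_zero fun α hα => ?_
        obtain ⟨h6, h4, h5⟩ := Finset.mem_filter.1 hα
        refine hzero α h4 h5 ?_
        rintro rfl
        rw [mem_exponents] at h6
        omega
      · intro hn
        exact absurd (Finset.mem_range.2 (Nat.lt_succ_self m)) hn
    rw [h2, h3]
    exact hβT.2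
  have hsum : s = ∑ β ∈ hBfin.toFinset, xpow x β * u β := by
    rw [← sub_eq_zero]
    refine eq_zero_of_forall_mem_pow (Ideal.span (Set.range x)) fun N => ?_
    refine Ideal.pow_le_pow_right (Nat.le_add_left N k) ?_
    have h1 : ∑ β ∈ hBfin.toFinset, xpow x β * ∑ j ∈ Finset.range N, term β j
        = ∑ j ∈ Finset.range N, ∑ α ∈ exponents n (k + j), σ (a α) * xpow x α := by
      simp only [Finset.mul_sum]
      rw [Finset.sum_comm]
      refine Finset.sum_congr rfl fun j _ => ?_
      simp only [term, Finset.mul_sum, Finset.sum_filter]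
      rw [Finset.sum_comm]
      refine Finset.sum_congr rfl fun α hα => ?_
      by_cases hαT : α ∈ T
      · rw [Finset.sum_eq_single (b α)]
        · rw [if_pos ⟨hαT, rfl⟩, mul_left_comm, ← xpow_add, add_tsub_cancel_of_le (hb α hαT).1]
        · intro β _ hne
          rw [if_neg fun h => hne h.2.symm, mul_zero]
        · intro hn
          exact absurd ((hB _).2 (hb α hαT).2) hn
      · have h0 : a α = 0 := by
          by_contra hne
          refine hαT ⟨?_, hne⟩
          rw [mem_exponents.1 hα]
          omega
        have h2 : σ (a α) * xpow x α = 0 := by rw [h0, hσ0, zero_mul]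
        rw [h2]
        exact Finset.sum_eq_zero fun β _ => by rw [if_neg fun h => hαT h.1, mul_zero]
    have h2 : s - ∑ β ∈ hBfin.toFinset, xpow x β * u β
        = (s - ∑ j ∈ Finset.range N, ∑ α ∈ exponents n (k + j), σ (a α) * xpow x α)
          - ∑ β ∈ hBfin.toFinset, xpow x β * (u β - ∑ j ∈ Finset.range N, term β j) := by
      simp only [mul_sub, Finset.sum_sub_distrib, h1]
      ring
    rw [h2]
    refine sub_mem (ha N) (Ideal.sum_mem _ fun β _ => ?_)
    have h3 := Ideal.mul_mem_mul (xpow_mem_pow x β) (hu β N)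
    rw [← pow_add] at h3
    exact Ideal.pow_le_pow_right (by omega) h3
  have hcoeff : ∀ α, MvPolynomial.coeff α
      (∑ β ∈ hBfin.toFinset, MvPolynomial.monomial β (u β))
        = if α ∈ hBfin.toFinset then u α else 0 := fun α => by
    rw [MvPolynomial.coeff_sum]
    simp only [MvPolynomial.coeff_monomial, Finset.sum_ite_eq']
  refine ⟨∑ β ∈ hBfin.toFinset, MvPolynomial.monomial β (u β), fun α => ?_, fun α hα => ?_, ?_⟩
  · rw [hcoeff]
    split_ifs with h
    · exact Or.inr (isUnit_of_map_ne_zero hπ hker (hunit α h))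
    · exact Or.inl rfl
  · rw [hcoeff, ite_ne_right_iff, hB] at hα
    exact hα.1.1.1
  · rw [map_sum, hsum]
    exact Finset.sum_congr rfl fun β _ => by rw [eval_monomial_eq, mul_comm]

end UnitExpansions

/-! ### The filtration of polynomials by weight. -/

section Filtration

open Polynomial

variable {S : Type*} [CommRing S] {n : ℕ} (x : Fin n → S)

/-- The polynomials of degree less than `N` in `y`, all of whose monomials `x^α y^j` satisfy
`α + j c ≥ e` and `|α + j c| ≥ |e| + t`. -/
def weightModule (c e : Fin n → ℝ) (N : ℕ) (t : ℝ) : Submodule S S[X] where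
  carrier := {w | (∀ j : ℕ, w.coeff j ∈ monomialIdeal x (fun i => e i - j * c i) t) ∧
    ∀ j, N ≤ j → w.coeff j = 0}
  add_mem' := fun {v w} hv hw => ⟨fun j => by rw [coeff_add]; exact add_mem (hv.1 j) (hw.1 j),
    fun j hj => by rw [coeff_add, hv.2 j hj, hw.2 j hj, add_zero]⟩
  zero_mem' := ⟨fun j => by rw [coeff_zero]; exact zero_mem _, fun j _ => coeff_zero j⟩
  smul_mem' := fun r w hw => ⟨fun j => by
    rw [coeff_smul, smul_eq_mul]; exact Ideal.mul_mem_left _ _ (hw.1 j),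
    fun j hj => by rw [coeff_smul, hw.2 j hj, smul_zero]⟩

variable {x}

lemma weightModule_mono {c e e' : Fin n → ℝ} {N N' : ℕ} {t t' : ℝ} (h1 : ∀ i, e' i ≤ e i)
    (h2 : ∑ i, e' i + t' ≤ ∑ i, e i + t) (h3 : N ≤ N') :
    weightModule x c e N t ≤ weightModule x c e' N' t' := by
  intro w hw
  refine ⟨fun j => monomialIdeal_mono (fun i => ?_) ?_ (hw.1 j), fun j hj => hw.2 j (h3.trans hj)⟩
  · linarith [h1 i]
  · rw [Finset.sum_sub_distrib, Finset.sum_sub_distrib]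
    linarith

/-- Corners and excesses add. Degrees are below `N` and `N'`, so the product has degree at most `N +
N' - 2`, which explains the `M + 1` in the degree hypothesis. -/
lemma mul_mem_weightModule {c e e' : Fin n → ℝ} {N N' M : ℕ} {t t' : ℝ} {v w : S[X]}
    (hv : v ∈ weightModule x c e N t) (hw : w ∈ weightModule x c e' N' t') (hM : N + N' ≤ M + 1) :
    v * w ∈ weightModule x c (e + e') M (t + t') := by
  constructor
  · intro l
    rw [coeff_mul]
    refine Ideal.sum_mem _ fun p hp => ?_
    rw [Finset.HasAntidiagonal.mem_antidiagonal] at hp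
    have := mul_mem_monomialIdeal (hv.1 p.1) (hw.1 p.2)
    convert this using 2
    funext i
    rw [← hp, Pi.add_apply, Pi.add_apply]
    push_cast
    ring
  · intro l hl
    rw [coeff_mul]
    refine Finset.sum_eq_zero fun p hp => ?_
    rw [Finset.HasAntidiagonal.mem_antidiagonal] at hp
    rcases Nat.lt_or_ge p.1 N with h | h
    · rw [hw.2 p.2 (by omega), mul_zero]
    · rw [hv.2 p.1 h, zero_mul]

lemma xpow_mem_of_weight_eq {c e : Fin n → ℝ} {α : Fin n →₀ ℕ} {j : ℕ} (h : weight c α j = e) :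
    xpow x α ∈ monomialIdeal x (fun i => e i - j * c i) 0 := by
  have h' : ∀ i, e i - j * c i = α i := fun i => by
    rw [← h, weight]
    ring
  refine xpow_mem_monomialIdeal (fun i => (h' i).le) ?_
  rw [add_zero]
  exact (Finset.sum_congr rfl fun i _ => h' i).le

lemma exists_sum_mem_weightModule [IsAdicComplete (Ideal.span (Set.range x)) S]
    {c e : Fin n → ℝ} {N : ℕ} {τ : ℕ → ℝ} (hτ : Monotone τ) (hub : ∀ C, ∃ k, C ≤ τ k)
    {r : ℕ → S[X]} (hr : ∀ k, r k ∈ weightModule x c e N (τ k)) :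
    ∃ L, ∀ k, L - ∑ l ∈ Finset.range k, r l ∈ weightModule x c e N (τ k) := by
  choose L hL using fun j => exists_sum_mem_monomialIdeal hτ hub (fun k => (hr k).1 j)
  refine ⟨∑ j ∈ Finset.range N, monomial j (L j), fun k => ?_⟩
  have hcoeff : ∀ j, (∑ j ∈ Finset.range N, monomial j (L j) - ∑ l ∈ Finset.range k, r l).coeff j
      = if j < N then L j - ∑ l ∈ Finset.range k, (r l).coeff j else 0 := fun j => by
    rw [coeff_sub, finsetSum_coeff, finsetSum_coeff]
    simp only [coeff_monomial, Finset.sum_ite_eq', Finset.mem_range]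
    split_ifs with h
    · rfl
    · rw [Finset.sum_eq_zero fun l _ => (hr l).2 j (not_lt.1 h), sub_zero]
  refine ⟨fun j => ?_, fun j hj => ?_⟩
  · rw [hcoeff]
    split_ifs
    · exact hL j k
    · exact zero_mem _
  · rw [hcoeff, if_neg (not_lt.2 hj)]

lemma eq_zero_of_forall_mem_weightModule [IsAdicComplete (Ideal.span (Set.range x)) S]
    {c e : Fin n → ℝ} {N : ℕ} {τ : ℕ → ℝ} (hub : ∀ C, ∃ k, C ≤ τ k) {w : S[X]}
    (hw : ∀ k, w ∈ weightModule x c e N (τ k)) : w = 0 := by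
  ext j
  rw [coeff_zero]
  refine eq_zero_of_forall_mem_pow (Ideal.span (Set.range x)) fun k => ?_
  obtain ⟨l, hl⟩ := hub (k - ∑ i, (e i - j * c i))
  exact monomialIdeal_le_pow (by linarith) ((hw l).1 j)

end Filtration

/-! ### Lifting homogeneous polynomials from `K[y]` to `S[y]`. -/

section Lifting

open Polynomial

variable {S K : Type*} [CommRing S] [Field K] {n : ℕ} (x : Fin n → S) (σ : K → S)

/-- The lift `∑ σ(q_j) x^{e - j c} y^j` of `q ∈ K[y]`. -/
noncomputable def lift (c e : Fin n → ℝ) (q : K[X]) : S[X] :=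
  ∑ j ∈ q.support, monomial j (σ (q.coeff j) * xpow x (ceil fun i => e i - j * c i))

variable {x σ} {c e e' : Fin n → ℝ}

lemma coeff_lift (hσ0 : σ 0 = 0) (q : K[X]) (j : ℕ) :
    (lift x σ c e q).coeff j = σ (q.coeff j) * xpow x (ceil fun i => e i - j * c i) := by
  rw [lift, finsetSum_coeff]
  simp only [coeff_monomial, Finset.sum_ite_eq']
  split_ifs with h
  · rfl
  · rw [notMem_support_iff.1 h, hσ0, zero_mul]

/-- On lattice points of weight `e` the rounding in `lift` is exact; elsewhere a lattice polynomial
has coefficient zero. -/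
lemma ceil_eq_of_weight_eq {α : Fin n →₀ ℕ} {j : ℕ} (h : weight c α j = e) :
    (ceil fun i => e i - j * c i) = α := by
  ext i
  rw [ceil_apply, ← h]
  have : weight c α j i - j * c i = α i := by
    rw [weight]
    ring
  rw [this, Nat.ceil_natCast]

lemma coeff_lift_of_weight_eq (hσ0 : σ 0 = 0) (q : K[X]) {α : Fin n →₀ ℕ} {j : ℕ}
    (h : weight c α j = e) : (lift x σ c e q).coeff j = σ (q.coeff j) * xpow x α := by
  rw [coeff_lift hσ0, ceil_eq_of_weight_eq h]

lemma lift_mem_weightModule (hσ0 : σ 0 = 0) {q : K[X]} (hq : IsLatticeAlong c e q) {N : ℕ}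
    (hN : ∀ j, N ≤ j → q.coeff j = 0) : lift x σ c e q ∈ weightModule x c e N 0 := by
  refine ⟨fun j => ?_, fun j hj => by rw [coeff_lift hσ0, hN j hj, hσ0, zero_mul]⟩
  by_cases h0 : q.coeff j = 0
  · rw [coeff_lift hσ0, h0, hσ0, zero_mul]
    exact zero_mem _
  · obtain ⟨α, hα⟩ := hq j h0
    rw [coeff_lift_of_weight_eq hσ0 q hα]
    exact Ideal.mul_mem_left _ _ (xpow_mem_of_weight_eq hα)

variable {π : S →+* K}

/-- A polynomial supported on the line of weight `e` with coefficients in `m` lies in the next step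
of the filtration. -/
lemma mem_weightModule_one (hker : RingHom.ker π = Ideal.span (Set.range x)) {w : S[X]} {N : ℕ} (hN : ∀ j, N ≤ j → w.coeff j = 0)
    (hw : ∀ j, w.coeff j ≠ 0 → ∃ (α : Fin n →₀ ℕ) (r : S), weight c α j = e ∧ π r = 0 ∧
      w.coeff j = r * xpow x α) : w ∈ weightModule x c e N 1 := by
  refine ⟨fun j => ?_, hN⟩
  by_cases h0 : w.coeff j = 0
  · rw [h0]
    exact zero_mem _
  · obtain ⟨α, r, hα, hr, hw⟩ := hw j h0
    rw [← RingHom.mem_ker, hker] at hr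
    rw [hw, ← zero_add (1 : ℝ)]
    exact mul_mem_monomialIdeal_add_one hr (xpow_mem_of_weight_eq hα)

/-- `σ` is only a set-theoretic section. In each degree both sides are multiples of the same
monomial of weight `e + e'`, and their coefficients agree after `π`, so the defect gains one power
of `m`. -/
lemma lift_mul_sub_mem (hker : RingHom.ker π = Ideal.span (Set.range x))
    (hσ : ∀ a, π (σ a) = a) (hσ0 : σ 0 = 0) {q q' : K[X]} (hq : IsLatticeAlong c e q) (hq' : IsLatticeAlong c e' q')
    {a b N : ℕ} (ha : ∀ j, a ≤ j → q.coeff j = 0) (hb : ∀ j, b ≤ j → q'.coeff j = 0)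
    (hN : a + b ≤ N + 1) :
    lift x σ c e q * lift x σ c e' q' - lift x σ c (e + e') (q * q')
      ∈ weightModule x c (e + e') N 1 := by
  have hterm : ∀ i j, q.coeff i ≠ 0 → q'.coeff j ≠ 0 → ∃ α : Fin n →₀ ℕ,
      weight c α (i + j) = e + e' ∧ (lift x σ c e q).coeff i * (lift x σ c e' q').coeff j
        = σ (q.coeff i) * σ (q'.coeff j) * xpow x α := by
    intro i j hi hj
    obtain ⟨α, hα⟩ := hq i hi
    obtain ⟨β, hβ⟩ := hq' j hj
    refine ⟨α + β, by rw [weight_add, hα, hβ], ?_⟩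
    rw [coeff_lift_of_weight_eq hσ0 q hα, coeff_lift_of_weight_eq hσ0 q' hβ, xpow_add]
    ring
  have hzero : ∀ i j, (q.coeff i = 0 ∨ q'.coeff j = 0) →
      (lift x σ c e q).coeff i * (lift x σ c e' q').coeff j = 0 := by
    rintro i j (h | h)
    · rw [coeff_lift hσ0, h, hσ0, zero_mul, zero_mul]
    · rw [coeff_lift hσ0 q', h, hσ0, zero_mul, mul_zero]
  refine mem_weightModule_one hker (fun l hl => ?_) fun l hl => ?_
  · have hor : ∀ p ∈ Finset.HasAntidiagonal.antidiagonal l,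
        q.coeff p.1 = 0 ∨ q'.coeff p.2 = 0 := fun p hp => by
      rw [Finset.HasAntidiagonal.mem_antidiagonal] at hp
      rcases Nat.lt_or_ge p.1 a with h | h
      · exact Or.inr (hb _ (by omega))
      · exact Or.inl (ha _ h)
    rw [coeff_sub, coeff_mul, Finset.sum_eq_zero fun p hp => hzero _ _ (hor p hp),
      coeff_lift hσ0, coeff_mul, Finset.sum_eq_zero fun p hp => mul_eq_zero.2 (hor p hp), hσ0,
      zero_mul, sub_zero]
  · by_cases hex : ∃ α : Fin n →₀ ℕ, weight c α l = e + e'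
    · obtain ⟨α, hα⟩ := hex
      refine ⟨α, ∑ p ∈ Finset.HasAntidiagonal.antidiagonal l, σ (q.coeff p.1) * σ (q'.coeff p.2)
        - σ ((q * q').coeff l), hα, ?_, ?_⟩
      · simp only [map_sub, map_sum, map_mul, hσ, coeff_mul, sub_self]
      · rw [coeff_sub, coeff_lift_of_weight_eq hσ0 _ hα, coeff_mul, sub_mul, Finset.sum_mul]
        congr 1
        refine Finset.sum_congr rfl fun p hp => ?_
        rw [Finset.HasAntidiagonal.mem_antidiagonal] at hp
        by_cases h1 : q.coeff p.1 = 0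
        · rw [hzero _ _ (Or.inl h1), h1, hσ0, zero_mul, zero_mul]
        by_cases h2 : q'.coeff p.2 = 0
        · rw [hzero _ _ (Or.inr h2), h2, hσ0, mul_zero, zero_mul]
        obtain ⟨β, hβ, h3⟩ := hterm _ _ h1 h2
        rw [hp] at hβ
        rw [h3, weight_left_injective (hβ.trans hα.symm)]
    · exfalso
      refine hl ?_
      have hor : ∀ p ∈ Finset.HasAntidiagonal.antidiagonal l,
          q.coeff p.1 = 0 ∨ q'.coeff p.2 = 0 := fun p hp => by
        rw [Finset.HasAntidiagonal.mem_antidiagonal] at hp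
        by_contra! h
        obtain ⟨β, hβ, -⟩ := hterm _ _ h.1 h.2
        rw [hp] at hβ
        exact hex ⟨β, hβ⟩
      rw [coeff_sub, coeff_mul, Finset.sum_eq_zero fun p hp => hzero _ _ (hor p hp),
        coeff_lift hσ0, coeff_mul, Finset.sum_eq_zero fun p hp => mul_eq_zero.2 (hor p hp), hσ0,
        zero_mul, sub_zero]

lemma lift_add_sub_mem (hker : RingHom.ker π = Ideal.span (Set.range x))
    (hσ : ∀ a, π (σ a) = a) (hσ0 : σ 0 = 0) {q q' : K[X]} (hq : IsLatticeAlong c e q) (hq' : IsLatticeAlong c e q')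
    {N : ℕ} (ha : ∀ j, N ≤ j → q.coeff j = 0) (hb : ∀ j, N ≤ j → q'.coeff j = 0) :
    lift x σ c e q + lift x σ c e q' - lift x σ c e (q + q') ∈ weightModule x c e N 1 := by
  refine mem_weightModule_one hker (fun l hl => ?_) fun l hl => ?_
  · rw [coeff_sub, coeff_add, coeff_lift hσ0, coeff_lift hσ0, coeff_lift hσ0, coeff_add, ha l hl,
      hb l hl, add_zero, hσ0]
    simp
  · have hex : ∃ α : Fin n →₀ ℕ, weight c α l = e := by
      by_cases h1 : q.coeff l = 0
      · by_cases h2 : q'.coeff l = 0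
        · refine absurd ?_ hl
          rw [coeff_sub, coeff_add, coeff_lift hσ0, coeff_lift hσ0, coeff_lift hσ0, coeff_add, h1,
            h2, add_zero, hσ0]
          simp
        · exact hq' l h2
      · exact hq l h1
    obtain ⟨α, hα⟩ := hex
    refine ⟨α, σ (q.coeff l) + σ (q'.coeff l) - σ ((q + q').coeff l), hα, ?_, ?_⟩
    · simp only [map_sub, map_add, hσ, coeff_add, sub_self]
    · rw [coeff_sub, coeff_add, coeff_lift_of_weight_eq hσ0 _ hα,
        coeff_lift_of_weight_eq hσ0 _ hα, coeff_lift_of_weight_eq hσ0 _ hα]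
      ring

lemma IsLatticeAlong.mul {q q' : K[X]} (hq : IsLatticeAlong c e q) (hq' : IsLatticeAlong c e' q') :
    IsLatticeAlong c (e + e') (q * q') := by
  intro l hl
  rw [coeff_mul] at hl
  obtain ⟨p, hp, hne⟩ := Finset.exists_ne_zero_of_sum_ne_zero hl
  rw [Finset.HasAntidiagonal.mem_antidiagonal] at hp
  obtain ⟨α, hα⟩ := hq _ (left_ne_zero_of_mul hne)
  obtain ⟨β, hβ⟩ := hq' _ (right_ne_zero_of_mul hne)
  exact ⟨α + β, by rw [← hp, weight_add, hα, hβ]⟩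

end Lifting

/-! ### The correction step and its iteration. -/

section Hensel

open Polynomial

variable {S K : Type*} [CommRing S] [Field K] {n : ℕ} {x : Fin n → S} {π : S →+* K} {σ : K → S}
  {c eH : Fin n → ℝ} {G H : K[X]} {M : ℕ}

lemma coeff_eq_zero_of_natDegree_add_one_le (q : K[X]) (j : ℕ) (h : q.natDegree + 1 ≤ j) :
    q.coeff j = 0 := coeff_eq_zero_of_natDegree_lt h

/-- The linearized equation of the factorization is solvable modulo the next step of the
filtration. -/
lemma exists_correction (hker : RingHom.ker π = Ideal.span (Set.range x))
    (hσ : ∀ a, π (σ a) = a) (hσ0 : σ 0 = 0) (hσ1 : σ 1 = 1) (hc : ∀ i, 0 ≤ c i) (hGm : G.Monic)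
    (hcop : IsCoprime G H) (hG : IsLatticeAlong c (weight c 0 G.natDegree) G)
    (hH : IsLatticeAlong c eH H) (hH0 : H ≠ 0) (hM : G.natDegree + H.natDegree ≤ M) {t : ℝ}
    {w : S[X]} (hw : w ∈ weightModule x c (weight c 0 G.natDegree + eH) (M + 1) t) :
    ∃ φ ∈ weightModule x c (weight c 0 G.natDegree) G.natDegree t,
      ∃ ψ ∈ weightModule x c eH (M + 1 - G.natDegree) t,
        w - φ * lift x σ c eH H - ψ * lift x σ c (weight c 0 G.natDegree) G
          ∈ weightModule x c (weight c 0 G.natDegree + eH) (M + 1) (t + 1) := by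
  set d := G.natDegree with hd
  set eG := weight c 0 d with heG
  set g := lift x σ c eG G with hg
  set h := lift x σ c eH H with hh
  -- The solvable right-hand sides form an `S`-submodule, so it suffices to treat monomials.
  let W := ((weightModule x c eG d t).map (LinearMap.mulRight S h) ⊔
    (weightModule x c eH (M + 1 - d) t).map (LinearMap.mulRight S g)) ⊔
      weightModule x c (eG + eH) (M + 1) (t + 1)
  have hgen : ∀ (k : ℕ) (α : Fin n →₀ ℕ), k ≤ M → (∀ i, (eG + eH) i - k * c i ≤ α i) →
      ∑ i, ((eG + eH) i - k * c i) + t ≤ ∑ i, (α i : ℝ) → monomial k (xpow x α) ∈ W := by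
    intro k α hk h1 h2
    obtain ⟨φ, ψ, hφd, hψd, hφl, hψl, hrel⟩ := exists_lattice_bezout hc hGm hcop hG hH hH0 α k
      (fun i => by
        have := h1 i
        rw [Pi.add_apply] at this
        change eG i + eH i ≤ α i + k * c i
        linarith)
    rw [← hd] at hφd hψd hψl
    rw [← heG] at hψl
    set e' := weight c α k with he'
    have he'i : ∀ i, e' i = α i + k * c i := fun i => rfl
    have hle : ∀ i, (eG + eH) i ≤ e' i := fun i => by
      have := h1 i
      rw [he'i]
      linarith
    have hsum : ∑ i, eG i + ∑ i, eH i + t ≤ ∑ i, e' i := by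
      rw [Finset.sum_sub_distrib] at h2
      simp only [Pi.add_apply, Finset.sum_add_distrib] at h2
      simp only [he'i, Finset.sum_add_distrib]
      linarith
    have hψd' : ∀ j, M + 1 - d ≤ j → ψ.coeff j = 0 := fun j hj => by
      by_contra hne
      have := hψd j hne
      omega
    have hφW : lift x σ c (e' - eH) φ ∈ weightModule x c eG d t := by
      refine weightModule_mono (fun i => ?_) ?_ le_rfl (lift_mem_weightModule hσ0 hφl hφd)
      · have := hle i
        rw [Pi.add_apply] at this
        rw [Pi.sub_apply]
        linarith
      · simp only [Pi.sub_apply, Finset.sum_sub_distrib]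
        linarith
    have hψW : lift x σ c (e' - eG) ψ ∈ weightModule x c eH (M + 1 - d) t := by
      refine weightModule_mono (fun i => ?_) ?_ le_rfl (lift_mem_weightModule hσ0 hψl hψd')
      · have := hle i
        rw [Pi.add_apply] at this
        rw [Pi.sub_apply]
        linarith
      · simp only [Pi.sub_apply, Finset.sum_sub_distrib]
        linarith
    have hφH := hφl.mul hH
    have hψG := hψl.mul hG
    have hdeg : ∀ {a b : ℕ} {q q' : K[X]}, (∀ j, a ≤ j → q.coeff j = 0) →
        (∀ j, b ≤ j → q'.coeff j = 0) → a + b ≤ M + 1 + 1 →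
        ∀ j, M + 1 ≤ j → (q * q').coeff j = 0 := by
      intro a b q q' ha hb hab j hj
      rw [coeff_mul]
      refine Finset.sum_eq_zero fun p hp => ?_
      rw [Finset.HasAntidiagonal.mem_antidiagonal] at hp
      rcases Nat.lt_or_ge p.1 a with h | h
      · rw [hb _ (by omega), mul_zero]
      · rw [ha _ h, zero_mul]
    have m1 := lift_mul_sub_mem hker hσ hσ0 hφl hH hφd
      (coeff_eq_zero_of_natDegree_add_one_le H) (N := M + 1) (by omega)
    have m2 := lift_mul_sub_mem hker hσ hσ0 hψl hG hψd'
      (coeff_eq_zero_of_natDegree_add_one_le G) (N := M + 1) (by omega)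
    rw [sub_add_cancel] at m1 m2 hφH hψG
    have m3 := lift_add_sub_mem hker hσ hσ0 hφH hψG
      (hdeg hφd (coeff_eq_zero_of_natDegree_add_one_le H) (by omega))
      (hdeg hψd' (coeff_eq_zero_of_natDegree_add_one_le G) (by omega))
    have hX : lift x σ c e' (X ^ k) = monomial k (xpow x α) := by
      ext j
      rw [coeff_lift hσ0, coeff_X_pow, coeff_monomial]
      by_cases hj : j = k
      · subst hj
        rw [if_pos rfl, if_pos rfl, hσ1, one_mul, ceil_eq_of_weight_eq he'.symm]
      · rw [if_neg hj, if_neg (Ne.symm hj), hσ0, zero_mul]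
    rw [hrel, hX] at m3
    -- Lifting the identity `φ H + ψ G = y^k` costs two product defects and one sum defect, each of
    -- excess one over `e'`; since `|e'| ≥ |e| + t`, they have excess `t + 1` over `e`.
    have hres := weightModule_mono (t' := t + 1) hle (by
      simp only [Pi.add_apply, Finset.sum_add_distrib]
      linarith) le_rfl (add_mem (add_mem m1 m2) m3)
    refine Submodule.mem_sup.2 ⟨lift x σ c (e' - eH) φ * h + lift x σ c (e' - eG) ψ * g,
      Submodule.add_mem_sup ⟨_, hφW, rfl⟩ ⟨_, hψW, rfl⟩, _, neg_mem hres, ?_⟩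
    rw [hg, hh]
    ring
  have hwW : w ∈ W := by
    rw [w.as_sum_range' (M + 1) (by
      rw [Nat.lt_succ_iff, natDegree_le_iff_coeff_eq_zero]
      exact fun j hj => hw.2 j hj)]
    refine sum_mem fun k hk => ?_
    have hk' : k ≤ M := Nat.lt_succ_iff.1 (Finset.mem_range.1 hk)
    have hwk := hw.1 k
    generalize w.coeff k = s at hwk ⊢
    rw [monomialIdeal] at hwk
    induction hwk using Submodule.span_induction with
    | mem u hu =>
      obtain ⟨α, hα, rfl⟩ := hu
      exact hgen k α hk' hα.1 hα.2
    | zero => rw [monomial_zero_right]; exact zero_mem _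
    | add u v _ _ hu hv => rw [map_add]; exact add_mem hu hv
    | smul r u _ hu => rw [← smul_monomial]; exact W.smul_mem r hu
  obtain ⟨u, hu, v, hv, rfl⟩ := Submodule.mem_sup.1 hwW
  obtain ⟨_, ⟨φ, hφ, rfl⟩, _, ⟨ψ, hψ, rfl⟩, rfl⟩ := Submodule.mem_sup.1 hu
  refine ⟨φ, hφ, ψ, hψ, ?_⟩
  simp only [LinearMap.mulRight_apply]
  convert hv using 1
  ring

/-- Hensel's lemma for the filtration by weights. -/
theorem exists_factorization [IsAdicComplete (Ideal.span (Set.range x)) S]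
    (hker : RingHom.ker π = Ideal.span (Set.range x))
    (hσ : ∀ a, π (σ a) = a) (hσ0 : σ 0 = 0) (hσ1 : σ 1 = 1) (hc : ∀ i, 0 ≤ c i) (hGm : G.Monic)
    (hcop : IsCoprime G H) (hG : IsLatticeAlong c (weight c 0 G.natDegree) G)
    (hH : IsLatticeAlong c eH H) (hH0 : H ≠ 0) (hM : G.natDegree + H.natDegree ≤ M) {ε : ℝ}
    (hε0 : 0 < ε) (hε1 : ε ≤ 1) {f : S[X]}
    (hf : f - lift x σ c (weight c 0 G.natDegree) G * lift x σ c eH H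
      ∈ weightModule x c (weight c 0 G.natDegree + eH) (M + 1) ε) :
    ∃ φ ∈ weightModule x c (weight c 0 G.natDegree) G.natDegree ε,
      ∃ ψ ∈ weightModule x c eH (M + 1 - G.natDegree) ε,
        f = (lift x σ c (weight c 0 G.natDegree) G + φ) * (lift x σ c eH H + ψ) := by
  set d := G.natDegree with hd
  set eG := weight c 0 d with heG
  set g := lift x σ c eG G with hg
  set h := lift x σ c eH H with hh
  have hgW : g ∈ weightModule x c eG (d + 1) 0 :=
    lift_mem_weightModule hσ0 hG (coeff_eq_zero_of_natDegree_add_one_le G)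
  have hhW : h ∈ weightModule x c eH (H.natDegree + 1) 0 :=
    lift_mem_weightModule hσ0 hH (coeff_eq_zero_of_natDegree_add_one_le H)
  have hstep : ∀ (t : ℝ) (w : S[X]), ∃ p : S[X] × S[X],
      w ∈ weightModule x c (eG + eH) (M + 1) t →
        p.1 ∈ weightModule x c eG d t ∧ p.2 ∈ weightModule x c eH (M + 1 - d) t ∧
          w - p.1 * h - p.2 * g ∈ weightModule x c (eG + eH) (M + 1) (t + 1) := by
    intro t w
    by_cases hw : w ∈ weightModule x c (eG + eH) (M + 1) t
    · obtain ⟨φ, hφ, ψ, hψ, hres⟩ :=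
        exists_correction hker hσ hσ0 hσ1 hc hGm hcop hG hH hH0 hM hw
      exact ⟨(φ, ψ), fun _ => ⟨hφ, hψ, hres⟩⟩
    · exact ⟨0, fun h => absurd h hw⟩
  choose D hD using hstep
  -- The linear error improves by one at each step, but the quadratic terms improve only by `ε`,
  -- since the accumulated corrections have excess `ε`.
  let τ : ℕ → ℝ := fun k => ε * (k + 1)
  have hτ : Monotone τ := fun k l hkl => by
    have : (k : ℝ) ≤ l := by exact_mod_cast hkl
    exact mul_le_mul_of_nonneg_left (by linarith) hε0.le
  have hτε : ∀ k, ε ≤ τ k := fun k => by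
    have : (0 : ℝ) ≤ k := Nat.cast_nonneg k
    have := mul_nonneg hε0.le this
    simp only [τ]
    linarith
  have hτ0 : τ 0 = ε := by simp [τ]
  have hτs : ∀ k, τ (k + 1) = τ k + ε := fun k => by
    simp only [τ]
    push_cast
    ring
  have hub : ∀ C, ∃ k, C ≤ τ k := fun C => by
    obtain ⟨k, hk⟩ := exists_nat_ge (C / ε)
    refine ⟨k, ?_⟩
    rw [div_le_iff₀ hε0] at hk
    simp only [τ]
    linarith
  let z : ℕ → S[X] × S[X] := fun N => Nat.rec (0, 0)
    (fun k zk => zk + D (τ k) (f - (g + zk.1) * (h + zk.2))) N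
  let w : ℕ → S[X] := fun k => f - (g + (z k).1) * (h + (z k).2)
  have hz0 : z 0 = (0, 0) := rfl
  have hzs : ∀ k, z (k + 1) = z k + D (τ k) (w k) := fun _ => rfl
  have hanti : ∀ {e : Fin n → ℝ} {N : ℕ} {t u : ℝ}, t ≤ u →
      weightModule x c e N u ≤ weightModule x c e N t := fun htu =>
    weightModule_mono (fun _ => le_rfl) (by linarith) le_rfl
  have hinv : ∀ k, (z k).1 ∈ weightModule x c eG d ε ∧
      (z k).2 ∈ weightModule x c eH (M + 1 - d) ε ∧
        w k ∈ weightModule x c (eG + eH) (M + 1) (τ k) := by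
    intro k
    induction k with
    | zero =>
      refine ⟨zero_mem _, zero_mem _, ?_⟩
      simp only [w, hz0, add_zero, hτ0]
      exact hf
    | succ k ih =>
      obtain ⟨h1, h2, h3⟩ := ih
      obtain ⟨m1, m2, m3⟩ := hD (τ k) (w k) h3
      set φ := (D (τ k) (w k)).1 with hφ
      set ψ := (D (τ k) (w k)).2 with hψ
      have hz1 : (z (k + 1)).1 = (z k).1 + φ := by rw [hzs]; rfl
      have hz2 : (z (k + 1)).2 = (z k).2 + ψ := by rw [hzs]; rfl
      refine ⟨?_, ?_, ?_⟩
      · rw [hz1]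
        exact add_mem h1 (hanti (hτε k) m1)
      · rw [hz2]
        exact add_mem h2 (hanti (hτε k) m2)
      -- The linearized error, then the products with earlier corrections and the new quadratic
      -- term.
      · have e1 : w (k + 1) = (w k - φ * h - ψ * g) - φ * (z k).2 - (z k).1 * ψ - φ * ψ := by
          simp only [w, hz1, hz2]
          ring
        rw [e1, hτs]
        refine sub_mem (sub_mem (sub_mem (hanti (by linarith) m3) ?_) ?_) ?_
        · exact mul_mem_weightModule m1 h2 (by omega)
        · rw [add_comm (τ k)]
          exact mul_mem_weightModule h1 m2 (by omega)
        · exact hanti (by linarith [hτε k]) (mul_mem_weightModule m1 m2 (by omega))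
  have hDmem := fun k => hD (τ k) (w k) (hinv k).2.2
  obtain ⟨φ, hφ⟩ := exists_sum_mem_weightModule hτ hub (fun k => (hDmem k).1)
  obtain ⟨ψ, hψ⟩ := exists_sum_mem_weightModule hτ hub (fun k => (hDmem k).2.1)
  have hzsum : ∀ k, z k = (∑ l ∈ Finset.range k, (D (τ l) (w l)).1,
      ∑ l ∈ Finset.range k, (D (τ l) (w l)).2) := by
    intro k
    induction k with
    | zero => simp [hz0]
    | succ k ih => rw [hzs, ih, Finset.sum_range_succ, Finset.sum_range_succ]; rfl
  have hφε : φ ∈ weightModule x c eG d ε := by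
    have := hφ 0
    rwa [hτ0, Finset.sum_range_zero, sub_zero] at this
  have hψε : ψ ∈ weightModule x c eH (M + 1 - d) ε := by
    have := hψ 0
    rwa [hτ0, Finset.sum_range_zero, sub_zero] at this
  refine ⟨φ, hφε, ψ, hψε, ?_⟩
  rw [← sub_eq_zero]
  refine eq_zero_of_forall_mem_weightModule (x := x) (c := c) (e := eG + eH) (N := M + 1) hub
    fun k => ?_
  have h1 : φ - (z k).1 ∈ weightModule x c eG d (τ k) := by
    rw [hzsum]
    exact hφ k
  have h2 : ψ - (z k).2 ∈ weightModule x c eH (M + 1 - d) (τ k) := by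
    rw [hzsum]
    exact hψ k
  -- Compare the limit with the `k`-th approximation: each term has excess at least `τ k`, so the
  -- difference vanishes.
  have e1 : f - (g + φ) * (h + ψ) = w k - (φ - (z k).1) * h - g * (ψ - (z k).2)
      - (φ - (z k).1) * ψ - (z k).1 * (ψ - (z k).2) := by
    simp only [w]
    ring
  rw [e1]
  refine sub_mem (sub_mem (sub_mem (sub_mem (hinv k).2.2 ?_) ?_) ?_) ?_
  · have := mul_mem_weightModule (M := M + 1) h1 hhW (by omega)
    rwa [add_zero] at this
  · have := mul_mem_weightModule (M := M + 1) hgW h2 (by omega)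
    rwa [zero_add] at this
  · exact hanti (by linarith) (mul_mem_weightModule (M := M + 1) h1 hψε (by omega))
  · exact hanti (by linarith) (mul_mem_weightModule (M := M + 1) (hinv k).1 h2 (by omega))

end Hensel

/-! ### Newton polyhedra of perturbed lifts. -/

section Expansion

open Polynomial

variable {S K : Type*} [CommRing S] [Field K] {n : ℕ} {x : Fin n → S} {π : S →+* K} {σ : K → S}
  {c e : Fin n → ℝ}

/-- The points of the exponents of `F`. -/
def supportPoints {k : Type*} [CommRing k] (F : (MvPolynomial (Fin n) k)[X]) :
    Set ((Fin n → ℝ) × ℝ) :=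
  {p | ∃ (j : ℕ) (α : Fin n →₀ ℕ), (F.coeff j).coeff α ≠ 0 ∧ p = point α j}

lemma finite_supportPoints {k : Type*} [CommRing k] (F : (MvPolynomial (Fin n) k)[X]) :
    (supportPoints F).Finite := by
  refine ((finite_support F).image fun p => point p.1 p.2).subset ?_
  rintro _ ⟨j, α, h, rfl⟩
  exact ⟨(α, j), h, rfl⟩

/-- The segment spanned by the exponents of a homogeneous polynomial. -/
lemma convexHull_supportPoints {F : (MvPolynomial (Fin n) K)[X]} (hF : IsHomogeneousAlong c e F)
    (hF0 : F ≠ 0) : convexHull ℝ (supportPoints F)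
      = line e c '' Set.Icc (F.natTrailingDegree : ℝ) F.natDegree := by
  have : supportPoints F = (fun t : ℕ => line e c t) '' {t | F.coeff t ≠ 0} := by
    ext p
    constructor
    · rintro ⟨j, α, h, rfl⟩
      exact ⟨j, fun h0 => h (by rw [h0, MvPolynomial.coeff_zero]),
        (point_eq_line_iff.2 fun i => congrFun (hF j α h) i).symm⟩
    · rintro ⟨j, hj, rfl⟩
      obtain ⟨α, hα⟩ := MvPolynomial.ne_zero_iff.1 hj
      exact ⟨j, α, hα, (point_eq_line_iff.2 fun i => congrFun (hF j α hα) i).symm⟩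
  rw [this]
  refine convexHull_line_image e c ?_ ?_ fun t ht =>
    ⟨natTrailingDegree_le_of_ne_zero ht, le_natDegree_of_ne_zero ht⟩
  · exact (mem_support_iff (p := F)).1 (natTrailingDegree_mem_support_of_nonzero hF0)
  · change F.coeff F.natDegree ≠ 0
    rw [coeff_natDegree]
    exact leadingCoeff_ne_zero.2 hF0

/-- Each hull is a segment bounded by the lowest and the highest degree in `y`, and both degrees are
additive on products. -/
lemma convexHull_supportPoints_mul {e' : Fin n → ℝ} {G H : (MvPolynomial (Fin n) K)[X]}
    (hG : IsHomogeneousAlong c e G) (hH : IsHomogeneousAlong c e' H)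
    (hGH : IsHomogeneousAlong c (e + e') (G * H)) (hG0 : G ≠ 0) (hH0 : H ≠ 0) :
    convexHull ℝ (supportPoints (G * H))
      = convexHull ℝ (supportPoints G) + convexHull ℝ (supportPoints H) := by
  rw [convexHull_supportPoints hG hG0, convexHull_supportPoints hH hH0,
    convexHull_supportPoints hGH (mul_ne_zero hG0 hH0), line_image_Icc_add,
    natDegree_mul hG0 hH0, natTrailingDegree_mul hG0 hH0]
  · push_cast
    rfl
  · exact_mod_cast natTrailingDegree_le_natDegree G
  · exact_mod_cast natTrailingDegree_le_natDegree H

lemma scalar_point (c : Fin n → ℝ) (α : Fin n →₀ ℕ) (j : ℕ) :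
    scalar (1, ∑ i, c i) (point α j) = ∑ i, weight c α j i := by
  simp only [scalar, point, weight, Pi.one_apply, one_mul, Finset.sum_add_distrib,
    ← Finset.mul_sum]
  ring

/-- The face of the Newton polyhedron at which the weight `|α + j c|` is minimal, in terms of the
symbolic restriction. -/
lemma exists_face_of_coeff {k : Type*} [CommRing k] {ρ : k →+* K} (hcpos : 0 < ∑ i, c i)
    {P : (MvPolynomial (Fin n) k)[X]} {F : (MvPolynomial (Fin n) K)[X]} (hF0 : F ≠ 0)
    (hF : IsHomogeneousAlong c e F) {ε : ℝ} (hε : 0 < ε)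
    (h1 : ∀ j α, weight c α j = e →
      ρ ((P.coeff j).coeff α) = (F.coeff j).coeff α ∧
        ((P.coeff j).coeff α ≠ 0 → (F.coeff j).coeff α ≠ 0))
    (h2 : ∀ j α, weight c α j ≠ e → (P.coeff j).coeff α ≠ 0 →
      ∑ i, e i + ε ≤ ∑ i, weight c α j i) :
    IsCompactFace (newtonPolyhedron P) (convexHull ℝ (supportPoints F)) ∧
      symbolicRestriction ρ P (convexHull ℝ (supportPoints F)) = F := by
  classical
  have hwt : ∀ {j α}, (F.coeff j).coeff α ≠ 0 → (P.coeff j).coeff α ≠ 0 := fun {j α} hne h0 =>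
    hne (by rw [← (h1 j α (hF j α hne)).1, h0, map_zero])
  have hset : {p | p ∈ supportPoints P ∧ scalar (1, ∑ i, c i) p = ∑ i, e i} = supportPoints F := by
    ext p
    constructor
    · rintro ⟨⟨j, α, hne, rfl⟩, hs⟩
      rw [scalar_point] at hs
      by_cases hw : weight c α j = e
      · exact ⟨j, α, (h1 j α hw).2 hne, rfl⟩
      · have := h2 j α hw hne
        linarith
    · rintro ⟨j, α, hne, rfl⟩
      refine ⟨⟨j, α, hwt hne, rfl⟩, ?_⟩
      rw [scalar_point, hF j α hne]
  have hne : ∃ p ∈ supportPoints P, scalar (1, ∑ i, c i) p = ∑ i, e i := by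
    obtain ⟨j, hj⟩ : ∃ j, F.coeff j ≠ 0 := by
      by_contra! h
      exact hF0 (Polynomial.ext fun j => by rw [h j, coeff_zero])
    obtain ⟨α, hα⟩ := MvPolynomial.ne_zero_iff.1 hj
    have : point α j ∈ supportPoints F := ⟨j, α, hα, rfl⟩
    rw [← hset] at this
    exact ⟨_, this.1, this.2⟩
  have hface : face (newtonPolyhedron P) (1, ∑ i, c i) = convexHull ℝ (supportPoints F) := by
    rw [← hset]
    refine face_convexHull_add (supportPoints P) (fun i => one_pos) hcpos ?_ hne
    rintro _ ⟨j, α, hne, rfl⟩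
    rw [scalar_point]
    by_cases hw : weight c α j = e
    · rw [hw]
    · have := h2 j α hw hne
      linarith
  refine ⟨⟨⟨(1, ∑ i, c i), ⟨fun _ => zero_le_one, hcpos.le⟩, hface.symm⟩,
    (finite_supportPoints F).isCompact_convexHull ℝ⟩, ?_⟩
  ext j α
  rw [coeff_symbolicRestriction]
  have hmem : point α j ∈ convexHull ℝ (supportPoints F) → ∑ i, weight c α j i = ∑ i, e i := by
    intro h
    rw [← hset] at h
    have : point α j ∈ {w | scalar (1, ∑ i, c i) w = ∑ i, e i} :=
      convexHull_min (fun p hp => hp.2) (convex_hyperplane (isLinearMap_scalar _) _) h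
    rw [← scalar_point]
    exact this
  by_cases hw : weight c α j = e
  · by_cases h0 : (F.coeff j).coeff α = 0
    · rw [(h1 j α hw).1, h0, ite_self]
    · have hp : point α j ∈ supportPoints F := ⟨j, α, h0, rfl⟩
      rw [if_pos (subset_convexHull ℝ _ hp), (h1 j α hw).1]
  · have h0 : (F.coeff j).coeff α = 0 := by
      by_contra hne
      exact hw (hF j α hne)
    rw [h0]
    split_ifs with h
    · by_cases h3 : (P.coeff j).coeff α = 0
      · rw [h3, map_zero]
      · have := h2 j α hw h3
        have := hmem h
        linarith
    · rfl

/-- A small perturbation of the lift of a homogeneous polynomial `F` has an expansion whose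
Newton polyhedron has a compact face with symbolic restriction `F`. -/
lemma exists_expansion_of_lift (hπ : Function.Surjective π)
    (hker : RingHom.ker π = Ideal.span (Set.range x)) [IsAdicComplete (Ideal.span (Set.range x)) S]
    (hσ : ∀ a, π (σ a) = a) (hσ0 : σ 0 = 0) (hcpos : 0 < ∑ i, c i)
    {F : (MvPolynomial (Fin n) K)[X]} (hF0 : F ≠ 0) (hF : IsHomogeneousAlong c e F) {ε : ℝ}
    (hε : 0 < ε) {N : ℕ} {φ : S[X]} (hφ : φ ∈ weightModule x c e N ε) :
    ∃ P : (MvPolynomial (Fin n) S)[X],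
      IsExpansion x (lift x σ c e (dehomogenize F) + φ) P ∧
      IsCompactFace (newtonPolyhedron P) (convexHull ℝ (supportPoints F)) ∧
      symbolicRestriction π P (convexHull ℝ (supportPoints F)) = F := by
  classical
  choose p hpu hpd hpe using fun j : ℕ =>
    exists_unit_expansion_of_mem_pow hπ hker (monomialIdeal_le_pow_ceil (hφ.1 j))
  -- The expansion of `φ` is controlled only in total weight, not coordinatewise. This suffices,
  -- because the face is cut out by `(1, ∑ i, c i)`, which measures total weight.
  have hpw : ∀ (j : ℕ) α, (p j).coeff α ≠ 0 → ∑ i, e i + ε ≤ ∑ i, weight c α j i := by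
    intro j α hne
    have h1 := Nat.ceil_le.1 (hpd j α hne)
    rw [Finset.sum_sub_distrib] at h1
    push_cast at h1
    simp only [weight, Finset.sum_add_distrib]
    linarith
  set N' := max N (F.natDegree + 1) with hN'
  let q : ℕ → MvPolynomial (Fin n) S := fun j =>
    MvPolynomial.monomial (ceil fun i => e i - j * c i) (σ ((dehomogenize F).coeff j)) + p j
  let P : (MvPolynomial (Fin n) S)[X] := ∑ j ∈ Finset.range N', monomial j (q j)
  have hP : ∀ j, P.coeff j = if j < N' then q j else 0 := fun j => by
    simp only [P, finsetSum_coeff, coeff_monomial, Finset.sum_ite_eq', Finset.mem_range]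
  have hFN : ∀ j, ¬ j < N' → F.coeff j = 0 := fun j hj =>
    coeff_eq_zero_of_natDegree_lt (by have := le_max_right N (F.natDegree + 1); omega)
  have hon : ∀ j α, weight c α j = e → (P.coeff j).coeff α = σ ((F.coeff j).coeff α) := by
    intro j α hw
    rw [hP]
    split_ifs with hj
    · have hp0 : (p j).coeff α = 0 := by
        by_contra hne
        have := hpw j α hne
        rw [hw] at this
        linarith
      simp only [q]
      rw [MvPolynomial.coeff_add, MvPolynomial.coeff_monomial, if_pos (ceil_eq_of_weight_eq hw),
        hp0, add_zero, hF.coeff_dehomogenize hw]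
    · rw [hFN j hj, MvPolynomial.coeff_zero, MvPolynomial.coeff_zero, hσ0]
  have hoff : ∀ j α, weight c α j ≠ e → (P.coeff j).coeff α ≠ 0 →
      (P.coeff j).coeff α = (p j).coeff α := by
    intro j α hw hne
    rw [hP] at hne ⊢
    split_ifs at hne ⊢ with hj
    · simp only [q]
      rw [MvPolynomial.coeff_add, MvPolynomial.coeff_monomial]
      split_ifs with hα
      -- Were this coefficient nonzero, the rounded exponent would have weight exactly `e`.
      · have h0 : (dehomogenize F).coeff j = 0 := by
          by_contra hne
          obtain ⟨β, hβ⟩ := hF.isLatticeAlong j hne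
          rw [ceil_eq_of_weight_eq hβ] at hα
          exact hw (hα ▸ hβ)
        rw [h0, hσ0, zero_add]
      · rw [zero_add]
    · exact absurd (MvPolynomial.coeff_zero α) hne
  refine ⟨P, ⟨fun j α => ?_, ?_⟩, exists_face_of_coeff hcpos hF0 hF hε (fun j α hw => ?_)
    fun j α hw hne => ?_⟩
  · by_cases h0 : (P.coeff j).coeff α = 0
    · exact Or.inl h0
    · right
      by_cases hw : weight c α j = e
      · rw [hon j α hw] at h0 ⊢
        refine isUnit_of_map_ne_zero hπ hker fun h1 => h0 ?_
        rw [hσ] at h1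
        rw [h1, hσ0]
      · have h1 := hoff j α hw h0
        rw [h1] at h0 ⊢
        exact (hpu j α).resolve_left h0
  · ext j
    rw [coeff_map, hP, coeff_add, coeff_lift hσ0]
    split_ifs with hj
    · simp only [q]
      rw [map_add, eval_monomial_eq, hpe]
    · rw [map_zero, LooseEdge.coeff_dehomogenize, hFN j hj, map_zero, hσ0, zero_mul, zero_add,
        hφ.2 j ((le_max_left _ _).trans (not_lt.1 hj))]
  · rw [hon j α hw, hσ]
    exact ⟨rfl, fun hne h0 => hne (by rw [h0, hσ0])⟩
  · rw [hoff j α hw hne] at hne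
    exact hpw j α hne

end Expansion

/-! ### Existence of the factorization for given slope data. -/

section Existence

open Polynomial

variable {S K : Type*} [CommRing S] [Field K] {n : ℕ} {x : Fin n → S} {π : S →+* K}
  {c e : Fin n → ℝ}

/-- The support is finite, and coordinatewise `≥` with equal sums forces equality of weights. The
cap `ε ≤ 1` lets the excess-one defects of lifting be absorbed. -/
lemma exists_gap {P : (MvPolynomial (Fin n) S)[X]}
    (hge : ∀ j α, (P.coeff j).coeff α ≠ 0 → ∀ i, e i ≤ weight c α j i) :
    ∃ ε : ℝ, 0 < ε ∧ ε ≤ 1 ∧ ∀ j α, (P.coeff j).coeff α ≠ 0 → weight c α j ≠ e →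
      ∑ i, e i + ε ≤ ∑ i, weight c α j i := by
  let A : Set ((Fin n →₀ ℕ) × ℕ) := {p | (P.coeff p.2).coeff p.1 ≠ 0 ∧ weight c p.1 p.2 ≠ e}
  have hA : A.Finite := (finite_support P).subset fun p hp => hp.1
  have hpos : ∀ p ∈ A, 0 < ∑ i, weight c p.1 p.2 i - ∑ i, e i := by
    rintro ⟨α, j⟩ ⟨h1, h2⟩
    refine sub_pos.2 (lt_of_le_of_ne (Finset.sum_le_sum fun i _ => hge j α h1 i) fun h => h2 ?_)
    have := (Finset.sum_eq_sum_iff_of_le fun i _ => hge j α h1 i).1 h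
    exact funext fun i => (this i (Finset.mem_univ i)).symm
  rcases A.eq_empty_or_nonempty with hem | hne
  · refine ⟨1, one_pos, le_rfl, fun j α h1 h2 => ?_⟩
    have : (α, j) ∈ A := ⟨h1, h2⟩
    rw [hem] at this
    exact absurd this (Set.notMem_empty _)
  · obtain ⟨p, hp, hmin⟩ := Set.exists_min_image A
      (fun p => ∑ i, weight c p.1 p.2 i - ∑ i, e i) hA hne
    refine ⟨min 1 (∑ i, weight c p.1 p.2 i - ∑ i, e i), lt_min one_pos (hpos p hp),
      min_le_left _ _, fun j α h1 h2 => ?_⟩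
    have h3 := hmin (α, j) ⟨h1, h2⟩
    have h4 := min_le_right 1 (∑ i, weight c p.1 p.2 i - ∑ i, e i)
    simp only at h3
    linarith

/-- A polynomial differs from the lift of its symbolic restriction to the line of weight `e` by
terms of larger weight. -/
lemma sub_lift_mem (hker : RingHom.ker π = Ideal.span (Set.range x)) {σ : K → S}
    (hσ : ∀ a, π (σ a) = a) (hσ0 : σ 0 = 0) {f : S[X]} {P : (MvPolynomial (Fin n) S)[X]}
    (hf : P.map (MvPolynomial.eval x) = f)
    (hge : ∀ j α, (P.coeff j).coeff α ≠ 0 → ∀ i, e i ≤ weight c α j i)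
    {F : (MvPolynomial (Fin n) K)[X]} (hF : IsHomogeneousAlong c e F)
    (hPF : ∀ j α, weight c α j = e → π ((P.coeff j).coeff α) = (F.coeff j).coeff α)
    {ε : ℝ} (hε1 : ε ≤ 1) (hgap : ∀ j α, (P.coeff j).coeff α ≠ 0 → weight c α j ≠ e →
      ∑ i, e i + ε ≤ ∑ i, weight c α j i)
    {N : ℕ} (hPN : P.natDegree < N) (hFN : F.natDegree < N) :
    f - lift x σ c e (dehomogenize F) ∈ weightModule x c e N ε := by
  classical
  have hfj : ∀ j, f.coeff j = ∑ α ∈ (P.coeff j).support, (P.coeff j).coeff α * xpow x α := by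
    intro j
    rw [← hf, coeff_map]
    conv_lhs => rw [(P.coeff j).as_sum, map_sum]
    exact Finset.sum_congr rfl fun α _ => eval_monomial_eq x α _
  refine ⟨fun j => ?_, fun j hj => ?_⟩
  · rw [coeff_sub, hfj,
      ← Finset.sum_filter_add_sum_filter_not _ fun α : Fin n →₀ ℕ => weight c α j = e,
      add_sub_right_comm]
    refine add_mem ?_ (Ideal.sum_mem _ fun α hα => Ideal.mul_mem_left _ _ ?_)
    · by_cases hex : ∃ α : Fin n →₀ ℕ, weight c α j = e
      · obtain ⟨α, hα⟩ := hex
        have hsum : ∑ β ∈ (P.coeff j).support with weight c β j = e,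
            (P.coeff j).coeff β * xpow x β = (P.coeff j).coeff α * xpow x α := by
          refine Finset.sum_eq_single α (fun β hβ hne => ?_) fun hn => ?_
          · exact absurd (weight_left_injective ((Finset.mem_filter.1 hβ).2.trans hα.symm)) hne
          · have : (P.coeff j).coeff α = 0 := by
              by_contra hne
              exact hn (Finset.mem_filter.2 ⟨MvPolynomial.mem_support_iff.2 hne, hα⟩)
            rw [this, zero_mul]
        rw [hsum, coeff_lift_of_weight_eq hσ0 _ hα, ← sub_mul, hF.coeff_dehomogenize hα,
          ← hPF j α hα]
        refine monomialIdeal_mono (t := ε) (u := 0 + 1) (fun _ => le_rfl) (by linarith)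
          (mul_mem_monomialIdeal_add_one (sub_section_mem hker hσ _) (xpow_mem_of_weight_eq hα))
      · have h0 : (dehomogenize F).coeff j = 0 := by
          by_contra hne
          exact hex (hF.isLatticeAlong j hne)
        rw [Finset.sum_eq_zero fun α hα => absurd ⟨α, (Finset.mem_filter.1 hα).2⟩ hex,
          coeff_lift hσ0, h0, hσ0, zero_mul, sub_zero]
        exact zero_mem _
    · obtain ⟨h1, h2⟩ := Finset.mem_filter.1 hα
      rw [MvPolynomial.mem_support_iff] at h1
      refine xpow_mem_monomialIdeal (fun i => ?_) ?_
      · have := hge j α h1 i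
        simp only [weight] at this
        linarith
      · have := hgap j α h1 h2
        simp only [weight, Finset.sum_add_distrib] at this
        rw [Finset.sum_sub_distrib]
        linarith
  · rw [coeff_sub, ← hf, coeff_map, coeff_eq_zero_of_natDegree_lt (hPN.trans_le hj), map_zero,
      coeff_lift hσ0, LooseEdge.coeff_dehomogenize, coeff_eq_zero_of_natDegree_lt (hFN.trans_le hj),
      map_zero, hσ0, zero_mul, sub_zero]

/-- Existence of factorizations along an edge of slope `c` over which the Newton polyhedron lies. -/
theorem exists_isFactorizationAlong (hπ : Function.Surjective π)
    (hker : RingHom.ker π = Ideal.span (Set.range x)) [IsAdicComplete (Ideal.span (Set.range x)) S]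
    (hc : ∀ i, 0 ≤ c i) (hcpos : 0 < ∑ i, c i) {f : S[X]} {P : (MvPolynomial (Fin n) S)[X]}
    (hf : P.map (MvPolynomial.eval x) = f)
    (hge : ∀ j α, (P.coeff j).coeff α ≠ 0 → ∀ i, e i ≤ weight c α j i)
    {G H : (MvPolynomial (Fin n) K)[X]} (hGH : IsHomogeneousAlong c e (G * H))
    (hPGH : ∀ j α, weight c α j = e → π ((P.coeff j).coeff α) = ((G * H).coeff j).coeff α)
    (hrel : IsRelPrime G H) (hGm : G.Monic) (hH0 : H ≠ 0) :
    ∃ g h, IsFactorizationAlong x π (convexHull ℝ (supportPoints (G * H))) G H f g h := by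
  classical
  obtain ⟨σ', hσ'⟩ := hπ.hasRightInverse
  -- `σ 0 = 0` keeps lifts supported where the polynomial is; `σ 1 = 1` makes the lift of `G` monic
  -- and the lift of `y^k` a pure monomial.
  obtain ⟨σ, hσ, hσ0, hσ1⟩ : ∃ σ : K → S, (∀ a, π (σ a) = a) ∧ σ 0 = 0 ∧ σ 1 = 1 := by
    refine ⟨fun a => if a = 0 then 0 else if a = 1 then 1 else σ' a, fun a => ?_, if_pos rfl, ?_⟩
    · by_cases h0 : a = 0
      · simp [h0]
      by_cases h1 : a = 1
      · simp [h1]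
      simp [h0, h1, hσ' a]
    · simp
  obtain ⟨ε, hε0, hε1, hgap⟩ := exists_gap hge
  obtain ⟨hG, hH⟩ := hGH.of_mul hGm hH0
  set eG := weight c 0 G.natDegree with heG
  have hdG := hG.natDegree_dehomogenize
  have hdH := hH.natDegree_dehomogenize
  have hGm1 : (dehomogenize G).Monic := hGm.map _
  have hlG := hG.isLatticeAlong
  rw [heG, ← hdG] at hlG
  have hH10 : dehomogenize H ≠ 0 := by
    intro h0
    have h1 : H.coeff H.natDegree ≠ 0 := by
      rw [coeff_natDegree]
      exact leadingCoeff_ne_zero.2 hH0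
    exact hH.coeff_dehomogenize_ne_zero.2 h1 (by rw [h0, coeff_zero])
  have hadd : eG + (e - eG) = e := add_sub_cancel eG e
  set M := P.natDegree + G.natDegree + H.natDegree with hM
  have hstart : f - lift x σ c (weight c 0 (dehomogenize G).natDegree) (dehomogenize G)
      * lift x σ c (e - eG) (dehomogenize H)
      ∈ weightModule x c (weight c 0 (dehomogenize G).natDegree + (e - eG)) (M + 1) ε := by
    have h1 := sub_lift_mem hker hσ hσ0 hf hge hGH hPGH hε1 hgap (N := M + 1) (by omega)
      (by
        have := natDegree_mul_le (p := G) (q := H)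
        omega)
    have h2 := lift_mul_sub_mem hker hσ hσ0 hlG hH.isLatticeAlong
      (coeff_eq_zero_of_natDegree_add_one_le _) (coeff_eq_zero_of_natDegree_add_one_le _)
      (N := M + 1) (by omega)
    rw [hdG, ← heG, hadd] at h2 ⊢
    have h3 := sub_mem h1 (weightModule_mono (t' := ε) (fun _ => le_rfl) (by linarith) le_rfl h2)
    rwa [map_mul, sub_sub_sub_cancel_right] at h3
  obtain ⟨φ, hφ, ψ, hψ, hfac⟩ := exists_factorization hker hσ hσ0 hσ1 hc hGm1
    (isCoprime_dehomogenize hG hH hGm hrel) hlG hH.isLatticeAlong hH10 (by omega) hε0 hε1 hstart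
  rw [hdG, ← heG] at hφ hfac
  obtain ⟨P₁, hP₁, hE₁, hr₁⟩ :=
    exists_expansion_of_lift hπ hker hσ hσ0 hcpos hGm.ne_zero hG hε0 hφ
  obtain ⟨P₂, hP₂, hE₂, hr₂⟩ := exists_expansion_of_lift hπ hker hσ hσ0 hcpos hH0 hH hε0 hψ
  -- The correction `φ` has degree below `deg G`, so it does not affect the leading coefficient.
  have hcoeff : (lift x σ c eG (dehomogenize G) + φ).coeff G.natDegree = 1 := by
    rw [coeff_add, hφ.2 _ le_rfl, add_zero, coeff_lift_of_weight_eq hσ0 _ heG.symm, xpow_zero,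
      mul_one, ← hdG, hGm1.coeff_natDegree, hσ1]
  have hdeg : (lift x σ c eG (dehomogenize G) + φ).natDegree ≤ G.natDegree := by
    rw [natDegree_le_iff_coeff_eq_zero]
    intro j hj
    rw [coeff_add, hφ.2 _ hj.le, add_zero, coeff_lift hσ0,
      coeff_eq_zero_of_natDegree_lt (by omega), hσ0, zero_mul]
  have : Nontrivial S := π.domain_nontrivial
  refine ⟨_, _, hfac, monic_of_natDegree_le_of_coeff_eq_one _ hdeg hcoeff,
    natDegree_eq_of_le_of_coeff_ne_zero hdeg (by rw [hcoeff]; exact one_ne_zero),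
    P₁, P₂, _, _, hP₁, hP₂, hE₁, hE₂, hr₁, hr₂, ?_⟩
  exact convexHull_supportPoints_mul hG hH (by rwa [hadd]) hGm.ne_zero hH0

end Existence

/-! ### Slope data of a loose edge, read on an expansion. -/

section Slope

open Polynomial

variable {S K : Type*} [CommRing S] [Field K] {n : ℕ} {π : S →+* K}

/-- The direction of a loose descendant edge, and its position relative to the support. -/
lemma exists_slope_of_isLooseEdge {P : (MvPolynomial (Fin n) S)[X]} {E : Set ((Fin n → ℝ) × ℝ)}
    (hE : IsLooseEdge (newtonPolyhedron P) E) (hd : IsDescendant E)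
    (hP : ∀ j α, (P.coeff j).coeff α = 0 ∨ IsUnit ((P.coeff j).coeff α))
    {F : (MvPolynomial (Fin n) K)[X]} (hF : symbolicRestriction π P E = F) :
    ∃ c e : Fin n → ℝ, (∀ i, 0 ≤ c i) ∧ 0 < ∑ i, c i ∧
      (∀ j α, (P.coeff j).coeff α ≠ 0 → ∀ i, e i ≤ weight c α j i) ∧
      IsHomogeneousAlong c e F ∧
      (∀ j α, weight c α j = e → π ((P.coeff j).coeff α) = (F.coeff j).coeff α) ∧
      E = convexHull ℝ (supportPoints F) ∧ F ≠ 0 := by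
  classical
  obtain ⟨c, e, hc, hcpos, hge, hmem, hEq⟩ := hE.exists_slope (finite_supportPoints P) hd
  have hwt : ∀ j α, (P.coeff j).coeff α ≠ 0 → (point α j ∈ E ↔ weight c α j = e) :=
    fun j α hne => (hmem _ ⟨j, α, hne, rfl⟩).trans funext_iff.symm
  have hcoeff : ∀ j α, (F.coeff j).coeff α
      = if point α j ∈ E then π ((P.coeff j).coeff α) else 0 := fun j α => by
    rw [← hF, coeff_symbolicRestriction]
  have hiff : ∀ j α, (F.coeff j).coeff α ≠ 0 ↔ (P.coeff j).coeff α ≠ 0 ∧ point α j ∈ E := by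
    intro j α
    rw [hcoeff]
    split_ifs with h
    · rcases hP j α with h0 | h0
      · simp [h0]
      · have h1 := (h0.map π).ne_zero
        have : (P.coeff j).coeff α ≠ 0 := fun h2 => h1 (by rw [h2, map_zero])
        exact ⟨fun _ => ⟨this, h⟩, fun _ => h1⟩
    · simp [h]
  have hset : {p | p ∈ supportPoints P ∧ p ∈ E} = supportPoints F := by
    ext p
    constructor
    · rintro ⟨⟨j, α, hne, rfl⟩, hp⟩
      exact ⟨j, α, (hiff j α).2 ⟨hne, hp⟩, rfl⟩
    · rintro ⟨j, α, hne, rfl⟩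
      have := (hiff j α).1 hne
      exact ⟨⟨j, α, this.1, rfl⟩, this.2⟩
  rw [hset] at hEq
  refine ⟨c, e, hc, hcpos, fun j α hne => hge _ ⟨j, α, hne, rfl⟩, fun j α hne => ?_,
    fun j α hw => ?_, hEq, fun h0 => ?_⟩
  · have := (hiff j α).1 hne
    exact (hwt j α this.1).1 this.2
  · rw [hcoeff]
    split_ifs with h
    · rfl
    · have : (P.coeff j).coeff α = 0 := by
        by_contra hne
        exact h ((hwt j α hne).2 hw)
      rw [this, map_zero]
  · have hem : supportPoints F = ∅ := by
      rw [Set.eq_empty_iff_forall_notMem]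
      rintro p ⟨j, α, hne, rfl⟩
      simp [h0] at hne
    have h1 := hE.2.1
    rw [hEq, hem, convexHull_empty, dim, vectorSpan_empty, finrank_bot] at h1
    exact zero_ne_one h1

end Slope

/-! ### Passage to the completion of a Noetherian local ring. -/

section Completion

open Polynomial IsLocalRing

/-- The edge is used over `R` only, through `c` and `e`. The expansion of `f` is then pushed to the
completion, where nonzero coefficients still come from nonzero ones; no polyhedron of the image of
`f` is needed. -/
theorem exists_isFactorizationAlong_completion {R : Type*} [CommRing R] [IsLocalRing R]
    [IsNoetherianRing R] {n : ℕ} {x : Fin n → R}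
    (hx : Ideal.span (Set.range x) = maximalIdeal R) {f : R[X]}
    {P : (MvPolynomial (Fin n) R)[X]} (hP : IsExpansion x f P) {E : Set ((Fin n → ℝ) × ℝ)}
    (hE : IsLooseEdge (newtonPolyhedron P) E) (hd : IsDescendant E)
    {G H : (MvPolynomial (Fin n) (ResidueField R))[X]}
    (hGH : symbolicRestriction (residue R) P E = G * H) (hrel : IsRelPrime G H) (hG : G.Monic) :
    ∃ g h, IsFactorizationAlong
      (fun i => algebraMap R (AdicCompletion (maximalIdeal R) R) (x i)) (completionResidue R)
      E G H (f.map (algebraMap R (AdicCompletion (maximalIdeal R) R))) g h := by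
  obtain ⟨c, e, hc, hcpos, hge, hom, hcoeff, hEq, h0⟩ :=
    exists_slope_of_isLooseEdge hE hd hP.zero_or_isUnit hGH
  have hspan : Ideal.span (Set.range fun i => algebraMap R (AdicCompletion (maximalIdeal R) R) (x i))
      = (maximalIdeal R).map (algebraMap R (AdicCompletion (maximalIdeal R) R)) := by
    rw [← hx, Ideal.map_span, ← Set.range_comp]
    rfl
  have hfg : (maximalIdeal R).FG := IsNoetherian.noetherian _
  have hadic : IsAdicComplete
      (Ideal.span (Set.range fun i => algebraMap R (AdicCompletion (maximalIdeal R) R) (x i)))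
      (AdicCompletion (maximalIdeal R) R) := by
    rw [hspan]
    exact AdicCompletion.isAdicComplete_self _ hfg
  have hres : ∀ a, completionResidue R (algebraMap R _ a) = residue R a := fun a =>
    RingHom.congr_fun (AdicCompletion.evalOneₐ_comp_algebraMap_eq_mk (maximalIdeal R)) a
  have hP' : ∀ j α, ((P.map (MvPolynomial.map
      (algebraMap R (AdicCompletion (maximalIdeal R) R)))).coeff j).coeff α
        = algebraMap R _ ((P.coeff j).coeff α) := fun j α => by
    rw [coeff_map, MvPolynomial.coeff_map]
  rw [hEq]
  refine exists_isFactorizationAlong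
    (P := P.map (MvPolynomial.map (algebraMap R (AdicCompletion (maximalIdeal R) R))))
    (AdicCompletion.evalOneₐ_surjective (maximalIdeal R))
    ((AdicCompletion.ker_evalOneₐ_eq_map _ hfg).trans hspan.symm) hc hcpos ?_
    (fun j α hne => hge j α fun h1 => hne ?_) hom (fun j α hw => ?_) hrel hG
    (right_ne_zero_of_mul h0)
  · rw [← hP.map_eval, Polynomial.map_map, Polynomial.map_map]
    congr 1
    refine MvPolynomial.ringHom_ext (fun a => ?_) fun i => ?_ <;> simp
  · rw [hP', h1, map_zero]
  · rw [hP', hres, hcoeff j α hw]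

end Completion

/-! ### Power series over a field. -/

section PowerSeries

open Polynomial

variable {K : Type*} [Field K] {n : ℕ}

lemma ker_constantCoeff : RingHom.ker (MvPowerSeries.constantCoeff (σ := Fin n) (R := K))
    = Ideal.span (Set.range fun i => MvPowerSeries.X i) := by
  classical
  apply le_antisymm
  · intro φ hφ
    rw [RingHom.mem_ker] at hφ
    -- Each nonconstant monomial is charged to the first variable that divides it, so exactly one `q
    -- i * X i` contributes it.
    let q : Fin n → MvPowerSeries (Fin n) K := fun i α =>
      if ∀ k < i, α k = 0 then MvPowerSeries.coeff (α + Finsupp.single i 1) φ else 0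
    have hq : φ = ∑ i, q i * MvPowerSeries.X i := by
      ext β
      rw [map_sum]
      simp only [MvPowerSeries.X, MvPowerSeries.coeff_mul_monomial, mul_one]
      rcases eq_or_ne β 0 with rfl | hβ
      · rw [MvPowerSeries.coeff_zero_eq_constantCoeff_apply, hφ]
        symm
        refine Finset.sum_eq_zero fun i _ => if_neg fun h => ?_
        have := h i
        simp at this
      · have hex : ∃ i : Fin n, β i ≠ 0 := by
          by_contra! h
          exact hβ (Finsupp.ext h)
        obtain ⟨i, hi, hmin⟩ : ∃ i : Fin n, β i ≠ 0 ∧ ∀ k < i, β k = 0 := by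
          obtain ⟨i, hi⟩ := hex
          induction i using WellFoundedLT.induction with
          | ind i ih =>
            by_cases h : ∀ k < i, β k = 0
            · exact ⟨i, hi, h⟩
            · push Not at h
              obtain ⟨k, hk, hne⟩ := h
              exact ih k hk hne
        have hle : Finsupp.single i 1 ≤ β := Finsupp.single_le_iff.2 (Nat.one_le_iff_ne_zero.2 hi)
        rw [Finset.sum_eq_single i]
        · rw [if_pos hle]
          change _ = if ∀ k < i, (β - Finsupp.single i 1 : Fin n →₀ ℕ) k = 0 then _ else 0
          rw [if_pos, tsub_add_cancel_of_le hle]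
          intro k hk
          simp [hmin k hk]
        · intro k _ hki
          split_ifs with hk
          · have hk1 : β k ≠ 0 := Nat.one_le_iff_ne_zero.1 (Finsupp.single_le_iff.1 hk)
            have hik : i < k := lt_of_le_of_ne (not_lt.1 fun h => hk1 (hmin k h)) hki.symm
            refine if_neg fun h => hi ?_
            have := h i hik
            simpa [Finsupp.single_apply, hki] using this
          · rfl
        · simp
    rw [hq]
    exact Ideal.sum_mem _ fun i _ => Ideal.mul_mem_left _ _ (Ideal.subset_span ⟨i, rfl⟩)
  · rw [Ideal.span_le]
    rintro _ ⟨i, rfl⟩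
    exact MvPowerSeries.constantCoeff_X i

lemma xpow_X (α : Fin n →₀ ℕ) : xpow (fun i => MvPowerSeries.X i) α
    = (MvPowerSeries.monomial α (1 : K)) := by
  rw [xpow, MvPowerSeries.monomial_one_eq, Finsupp.prod_fintype]
  simp

/-- The coefficient of a power series with a given expansion. -/
lemma coeff_eval_X (p : MvPolynomial (Fin n) (MvPowerSeries (Fin n) K)) (γ : Fin n →₀ ℕ) :
    MvPowerSeries.coeff γ (MvPolynomial.eval (fun i => MvPowerSeries.X i) p)
      = ∑ α ∈ p.support, if α ≤ γ then MvPowerSeries.coeff (γ - α) (p.coeff α) else 0 := by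
  classical
  conv_lhs => rw [p.as_sum, map_sum, map_sum]
  refine Finset.sum_congr rfl fun α _ => ?_
  rw [eval_monomial_eq, xpow_X, MvPowerSeries.coeff_mul_monomial, mul_one]

end PowerSeries

/-! ### Initial forms for the total weight, and uniqueness. -/

section Uniqueness

open Polynomial

variable {K : Type*} [Field K] {n : ℕ} {c e : Fin n → ℝ}

/-- The total weight `|α + j c|` of the exponent `(α, j)`. -/
def totalWeight (c : Fin n → ℝ) (α : Fin n →₀ ℕ) (j : ℕ) : ℝ := ∑ i, weight c α j i

lemma totalWeight_add (c : Fin n → ℝ) (α β : Fin n →₀ ℕ) (i j : ℕ) :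
    totalWeight c (α + β) (i + j) = totalWeight c α i + totalWeight c β j := by
  simp only [totalWeight, weight_add, Pi.add_apply, Finset.sum_add_distrib]

lemma totalWeight_lt {α β : Fin n →₀ ℕ} (h : α < β) (j : ℕ) :
    totalWeight c α j < totalWeight c β j := by
  obtain ⟨i, hi⟩ : ∃ i, α i < β i := by
    by_contra! hcon
    exact h.not_ge fun i => hcon i
  refine Finset.sum_lt_sum (fun k _ => ?_) ⟨i, Finset.mem_univ i, ?_⟩
  · have : (α k : ℝ) ≤ β k := by exact_mod_cast h.le k
    simp only [weight]
    linarith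
  · have : (α i : ℝ) < β i := by exact_mod_cast hi
    simp only [weight]
    linarith

/-- As `c ≥ 0`, the total weight bounds the degree of `α`, and `j` is bounded by the degree of `g`.
-/
lemma finite_totalWeight_le (hc : ∀ i, 0 ≤ c i) (g : (MvPowerSeries (Fin n) K)[X]) (v : ℝ) :
    {p : (Fin n →₀ ℕ) × ℕ | MvPowerSeries.coeff p.1 (g.coeff p.2) ≠ 0 ∧
      totalWeight c p.1 p.2 ≤ v}.Finite := by
  classical
  refine (((Finset.range (⌊v⌋₊ + 1)).biUnion (exponents n)) ×ˢ
    Finset.range (g.natDegree + 1)).finite_toSet.subset ?_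
  rintro ⟨α, j⟩ ⟨h1, h2⟩
  simp only [Finset.coe_product, Set.mem_prod, Finset.mem_coe, Finset.mem_biUnion,
    Finset.mem_range, mem_exponents, Nat.lt_succ_iff]
  refine ⟨⟨_, Nat.le_floor ?_, rfl⟩, ?_⟩
  · push_cast
    refine le_trans (Finset.sum_le_sum fun i _ => ?_) h2
    have := mul_nonneg (Nat.cast_nonneg (α := ℝ) j) (hc i)
    simp only [weight]
    linarith
  · by_contra hlt
    exact h1 (by rw [coeff_eq_zero_of_natDegree_lt (not_le.1 hlt), map_zero])

variable {g : (MvPowerSeries (Fin n) K)[X]}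
  {P : (MvPolynomial (Fin n) (MvPowerSeries (Fin n) K))[X]}

lemma IsExpansion.le_totalWeight (hP : IsExpansion (fun i => MvPowerSeries.X i) g P) {s : ℝ}
    (hs : ∀ j α, (P.coeff j).coeff α ≠ 0 → s ≤ totalWeight c α j) (j : ℕ) (γ : Fin n →₀ ℕ)
    (hne : MvPowerSeries.coeff γ (g.coeff j) ≠ 0) : s ≤ totalWeight c γ j := by
  rw [← hP.map_eval, coeff_map, coeff_eval_X] at hne
  obtain ⟨α, hα, hne⟩ := Finset.exists_ne_zero_of_sum_ne_zero hne
  have hle : α ≤ γ := by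
    by_contra h
    exact hne (if_neg h)
  have := hs j α (MvPolynomial.mem_support_iff.1 hα)
  rcases hle.eq_or_lt with rfl | hlt
  · exact this
  · exact this.trans (totalWeight_lt hlt j).le

/-- A term with exponent `α < γ` would have total weight below the minimum `s`, so only `α = γ`
contributes, through its constant coefficient. -/
lemma IsExpansion.coeff_eq (hP : IsExpansion (fun i => MvPowerSeries.X i) g P) {s : ℝ}
    (hs : ∀ j α, (P.coeff j).coeff α ≠ 0 → s ≤ totalWeight c α j) {j : ℕ} {γ : Fin n →₀ ℕ}
    (hw : totalWeight c γ j = s) : MvPowerSeries.coeff γ (g.coeff j)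
      = MvPowerSeries.constantCoeff ((P.coeff j).coeff γ) := by
  rw [← hP.map_eval, coeff_map, coeff_eval_X, Finset.sum_eq_single γ]
  · rw [if_pos le_rfl, tsub_self, MvPowerSeries.coeff_zero_eq_constantCoeff_apply]
  · intro α hα hne
    refine if_neg fun hle => ?_
    have h1 := hs j α (MvPolynomial.mem_support_iff.1 hα)
    have h2 := totalWeight_lt (c := c) (lt_of_le_of_ne hle hne) j
    linarith
  · intro hγ
    rw [MvPolynomial.notMem_support_iff.1 hγ, if_pos le_rfl, map_zero]

open Classical in
/-- The initial form is read off from an expansion. -/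
lemma IsExpansion.component_totalWeight (hP : IsExpansion (fun i => MvPowerSeries.X i) g P) {s : ℝ}
    (hs : ∀ j α, (P.coeff j).coeff α ≠ 0 → s ≤ totalWeight c α j) :
    component (totalWeight c) s g = toSeries
      (symbolicRestriction MvPowerSeries.constantCoeff P {p | scalar (1, ∑ i, c i) p = s}) := by
  ext j α
  rw [coeff_component, coeff_toSeries, coeff_symbolicRestriction]
  have hmem : point α j ∈ {p | scalar (1, ∑ i, c i) p = s} ↔ totalWeight c α j = s := by
    rw [Set.mem_ofPred_eq, scalar_point, totalWeight]
  by_cases h : totalWeight c α j = s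
  · rw [if_pos h, if_pos (hmem.2 h), hP.coeff_eq hs h]
  · rw [if_neg h, if_neg (hmem.not.2 h)]

lemma IsExpansion.exists_hasInitialForm (hP : IsExpansion (fun i => MvPowerSeries.X i) g P)
    (hg : g ≠ 0) : ∃ s, (∀ j α, (P.coeff j).coeff α ≠ 0 → s ≤ totalWeight c α j) ∧
      HasInitialForm (totalWeight c) g s (toSeries
        (symbolicRestriction MvPowerSeries.constantCoeff P {p | scalar (1, ∑ i, c i) p = s})) := by
  classical
  have hne : {p : (Fin n →₀ ℕ) × ℕ | (P.coeff p.2).coeff p.1 ≠ 0}.Nonempty := by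
    by_contra! h
    refine hg ?_
    have : P = 0 := by
      ext j : 1
      ext1 α
      by_contra hne
      have : (α, j) ∈ {p : (Fin n →₀ ℕ) × ℕ | (P.coeff p.2).coeff p.1 ≠ 0} := by simpa using hne
      rw [h] at this
      exact this
    rw [← hP.map_eval, this, Polynomial.map_zero]
  obtain ⟨⟨β, l⟩, hβ, hmin⟩ := Set.exists_min_image _ (fun p => totalWeight c p.1 p.2)
    (finite_support P) hne
  have hs : ∀ j α, (P.coeff j).coeff α ≠ 0 → totalWeight c β l ≤ totalWeight c α j :=
    fun j α h => hmin (α, j) h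
  refine ⟨_, hs, hP.le_totalWeight hs, hP.component_totalWeight hs, fun h0 => ?_⟩
  have h1 := hP.coeff_eq hs (rfl : totalWeight c β l = totalWeight c β l)
  have h2 := hP.component_totalWeight hs
  rw [h0] at h2
  have h3 := coeff_component (totalWeight c) (totalWeight c β l) g l β
  rw [h2, if_pos rfl, h1, coeff_zero, map_zero] at h3
  exact (((hP.zero_or_isUnit l β).resolve_left hβ).map _).ne_zero h3.symm

lemma IsExpansion.hasInitialForm_toSeries (hP : IsExpansion (fun i => MvPowerSeries.X i) g P)
    (hge : ∀ j α, (P.coeff j).coeff α ≠ 0 → ∀ i, e i ≤ weight c α j i)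
    {F : (MvPolynomial (Fin n) K)[X]} (hF : IsHomogeneousAlong c e F)
    (hPF : ∀ j α, weight c α j = e →
      MvPowerSeries.constantCoeff ((P.coeff j).coeff α) = (F.coeff j).coeff α) (hF0 : F ≠ 0) :
    HasInitialForm (totalWeight c) g (∑ i, e i) (toSeries F) := by
  classical
  have hs : ∀ j α, (P.coeff j).coeff α ≠ 0 → ∑ i, e i ≤ totalWeight c α j :=
    fun j α hne => Finset.sum_le_sum fun i _ => hge j α hne i
  refine ⟨hP.le_totalWeight hs, ?_, fun h1 => hF0 (toSeries_injective (by rw [h1, map_zero]))⟩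
  ext j α
  rw [coeff_component, coeff_toSeries]
  by_cases hw : weight c α j = e
  · have h1 : totalWeight c α j = ∑ i, e i := by rw [totalWeight, hw]
    rw [if_pos h1, hP.coeff_eq hs h1, hPF j α hw]
  · have h2 : (F.coeff j).coeff α = 0 := by
      by_contra hne
      exact hw (hF j α hne)
    rw [h2]
    split_ifs with h1
    · rw [hP.coeff_eq hs h1]
      by_contra hne
      have hne' : (P.coeff j).coeff α ≠ 0 := fun h3 => hne (by rw [h3, map_zero])
      have h4 := (Finset.sum_eq_sum_iff_of_le fun i _ => hge j α hne' i).1 h1.symm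
      exact hw (funext fun i => (h4 i (Finset.mem_univ i)).symm)
    · rfl

/-- A convex piece of a homogeneous polynomial with the same extreme degrees is everything. -/
lemma eq_of_restriction {A : Set ((Fin n → ℝ) × ℝ)} (hA : Convex ℝ A)
    {F F' : (MvPolynomial (Fin n) K)[X]} (hF' : IsHomogeneousAlong c e F')
    (h1 : ∀ j α, (F.coeff j).coeff α ≠ 0 → point α j ∈ A)
    (h2 : ∀ j α, point α j ∈ A → (F.coeff j).coeff α = (F'.coeff j).coeff α) (hF : F ≠ 0)
    (hd : F.natDegree = F'.natDegree) (ht : F.natTrailingDegree = F'.natTrailingDegree) :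
    F = F' := by
  have hline : ∀ j, F.coeff j ≠ 0 → line e c j ∈ A := by
    intro j hj
    obtain ⟨β, hβ⟩ := MvPolynomial.ne_zero_iff.1 hj
    have h3 := h1 j β hβ
    have h4 := hF' j β (by rwa [← h2 j β h3])
    rwa [point_eq_line_iff.2 fun i => congrFun h4 i] at h3
  have htop := hline F.natDegree (by rw [coeff_natDegree]; exact leadingCoeff_ne_zero.2 hF)
  have hbot := hline F.natTrailingDegree (trailingCoeff_nonzero_iff_nonzero.2 hF)
  ext j α
  by_cases h0 : (F'.coeff j).coeff α = 0
  · rw [h0]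
    by_contra hne
    exact hne ((h2 j α (h1 j α hne)).trans h0)
  · have hj : F'.coeff j ≠ 0 := fun h => h0 (by rw [h, MvPolynomial.coeff_zero])
    refine h2 j α ?_
    rw [point_eq_line_iff.2 fun i => congrFun (hF' j α h0) i]
    refine line_mem_of_mem hA hbot htop ?_ ?_
    · rw [ht]
      exact_mod_cast natTrailingDegree_le_of_ne_zero hj
    · rw [hd]
      exact_mod_cast le_natDegree_of_ne_zero hj

lemma le_scalar_of_mem_newtonPolyhedron {s : ℝ} (hcpos : 0 < ∑ i, c i)
    (hs : ∀ j α, (P.coeff j).coeff α ≠ 0 → s ≤ totalWeight c α j) {p : (Fin n → ℝ) × ℝ}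
    (hp : p ∈ newtonPolyhedron P) : s ≤ scalar (1, ∑ i, c i) p := by
  refine convexHull_min (?_ : _ ⊆ {q | s ≤ scalar (1, ∑ i, c i) q})
    (convex_halfSpace_ge (isLinearMap_scalar _) s) hp
  rintro _ ⟨_, ⟨j, α, hne, rfl⟩, v, hv, rfl⟩
  have h1 := hs j α hne
  have h2 : 0 ≤ scalar (1, ∑ i, c i) v := by
    refine add_nonneg (Finset.sum_nonneg fun i _ => mul_nonneg zero_le_one (hv.1 i))
      (mul_nonneg hcpos.le hv.2)
  change s ≤ scalar _ (_ + _)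
  rw [scalar_add_right, scalar_point]
  simp only [totalWeight] at h1
  linarith

/-- The factors have the prescribed symbolic restrictions as their initial forms. -/
lemma IsFactorizationAlong.hasInitialForm (hcpos : 0 < ∑ i, c i)
    {G H : (MvPolynomial (Fin n) K)[X]} (hom : IsHomogeneousAlong c e (G * H)) (hG : G.Monic)
    (hH : H ≠ 0) {f g h : (MvPowerSeries (Fin n) K)[X]}
    (hf : HasInitialForm (totalWeight c) f (∑ i, e i) (toSeries (G * H)))
    (hgh : IsFactorizationAlong (fun i => MvPowerSeries.X i) MvPowerSeries.constantCoeff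
      (convexHull ℝ (supportPoints (G * H))) G H f g h) :
    ∃ s t, HasInitialForm (totalWeight c) g s (toSeries G) ∧
      HasInitialForm (totalWeight c) h t (toSeries H) := by
  classical
  obtain ⟨hfac, hgm, hgd, P, Q, E₁, E₂, hP, hQ, hE₁, hE₂, hPG, hQH, hE⟩ := hgh
  have hf0 : f ≠ 0 := by
    rintro rfl
    obtain ⟨j, α, hne, -⟩ := hf.exists_coeff
    simp at hne
  have hh0 : h ≠ 0 := fun h0 => hf0 (by rw [hfac, h0, mul_zero])
  obtain ⟨s, hs, hg'⟩ := hP.exists_hasInitialForm (c := c) hgm.ne_zero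
  obtain ⟨t, ht, hh'⟩ := hQ.exists_hasInitialForm (c := c) hh0
  set G' := symbolicRestriction MvPowerSeries.constantCoeff P {p | scalar (1, ∑ i, c i) p = s}
    with hG'
  set H' := symbolicRestriction MvPowerSeries.constantCoeff Q {p | scalar (1, ∑ i, c i) p = t}
    with hH'
  have hmul := hg'.mul (totalWeight_add c) hh'
  rw [← hfac, ← map_mul] at hmul
  obtain ⟨hst, hGH⟩ := hmul.unique hf
  replace hGH := toSeries_injective hGH
  have hGH0 : G * H ≠ 0 := mul_ne_zero hG.ne_zero hH
  have hG'0 : G' ≠ 0 := fun h0 => hGH0 (by rw [← hGH, h0, zero_mul])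
  have hH'0 : H' ≠ 0 := fun h0 => hGH0 (by rw [← hGH, h0, mul_zero])
  -- On `E` the functional equals `s + t`, while it is at least `s` on `Δ(g)` and at least `t` on
  -- `Δ(h)`; so it is minimal on `E₁` and on `E₂`. Hence `G` and `H` are pieces of the initial forms
  -- `G'` and `H'`.
  have hEv : ∀ p ∈ E₁, ∀ q ∈ E₂, scalar (1, ∑ i, c i) p = s ∧ scalar (1, ∑ i, c i) q = t := by
    intro p hp q hq
    have h1 : p + q ∈ convexHull ℝ (supportPoints (G * H)) := by
      rw [hE]
      exact Set.add_mem_add hp hq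
    have h2 : scalar (1, ∑ i, c i) (p + q) = ∑ i, e i := by
      refine convexHull_min (?_ : _ ⊆ {q | scalar (1, ∑ i, c i) q = ∑ i, e i})
        (convex_hyperplane (isLinearMap_scalar _) _) h1
      rintro _ ⟨j, α, hne, rfl⟩
      rw [Set.mem_ofPred_eq, scalar_point, hom j α hne]
    rw [scalar_add_right] at h2
    have hp' : p ∈ newtonPolyhedron P := by
      obtain ⟨⟨ξ, -, rfl⟩, -⟩ := hE₁
      exact hp.1
    have hq' : q ∈ newtonPolyhedron Q := by
      obtain ⟨⟨ξ, -, rfl⟩, -⟩ := hE₂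
      exact hq.1
    have h3 := le_scalar_of_mem_newtonPolyhedron hcpos hs hp'
    have h4 := le_scalar_of_mem_newtonPolyhedron hcpos ht hq'
    constructor <;> linarith
  have hEne : (convexHull ℝ (supportPoints (G * H))).Nonempty := by
    obtain ⟨j, hj⟩ : ∃ j, (G * H).coeff j ≠ 0 := by
      by_contra! h
      exact hGH0 (Polynomial.ext fun j => by rw [h j, coeff_zero])
    obtain ⟨α, hα⟩ := MvPolynomial.ne_zero_iff.1 hj
    exact ⟨_, subset_convexHull ℝ _ ⟨j, α, hα, rfl⟩⟩
  rw [hE] at hEne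
  obtain ⟨_, p₀, hp₀, q₀, hq₀, -⟩ := hEne
  have hGm1 : ∀ j α, (G.coeff j).coeff α ≠ 0 → point α j ∈ E₁ := by
    intro j α hne
    rw [← hPG, coeff_symbolicRestriction] at hne
    by_contra hn
    exact hne (if_neg hn)
  have hGm2 : ∀ j α, point α j ∈ E₁ → (G.coeff j).coeff α = (G'.coeff j).coeff α := by
    intro j α hp
    rw [hG', ← hPG, coeff_symbolicRestriction, coeff_symbolicRestriction, if_pos hp]
    exact (if_pos (hEv _ hp _ hq₀).1).symm
  have hHm1 : ∀ j α, (H.coeff j).coeff α ≠ 0 → point α j ∈ E₂ := by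
    intro j α hne
    rw [← hQH, coeff_symbolicRestriction] at hne
    by_contra hn
    exact hne (if_neg hn)
  have hHm2 : ∀ j α, point α j ∈ E₂ → (H.coeff j).coeff α = (H'.coeff j).coeff α := by
    intro j α hp
    rw [hH', ← hQH, coeff_symbolicRestriction, coeff_symbolicRestriction, if_pos hp]
    exact (if_pos (hEv _ hp₀ _ hp).2).symm
  have hsub : ∀ {F F' : (MvPolynomial (Fin n) K)[X]} {A : Set ((Fin n → ℝ) × ℝ)},
      (∀ j α, (F.coeff j).coeff α ≠ 0 → point α j ∈ A) →
      (∀ j α, point α j ∈ A → (F.coeff j).coeff α = (F'.coeff j).coeff α) →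
      ∀ j, F.coeff j ≠ 0 → F'.coeff j ≠ 0 := by
    intro F F' A h1 h2 j hj
    obtain ⟨β, hβ⟩ := MvPolynomial.ne_zero_iff.1 hj
    exact MvPolynomial.ne_zero_iff.2 ⟨β, by rwa [← h2 j β (h1 j β hβ)]⟩
  have hGs := hsub hGm1 hGm2
  have hHs := hsub hHm1 hHm2
  have hlead : ∀ {F : (MvPolynomial (Fin n) K)[X]}, F ≠ 0 → F.coeff F.natDegree ≠ 0 :=
    fun hF => by rw [coeff_natDegree]; exact leadingCoeff_ne_zero.2 hF
  have htrail : ∀ {F : (MvPolynomial (Fin n) K)[X]}, F ≠ 0 → F.coeff F.natTrailingDegree ≠ 0 :=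
    fun hF => trailingCoeff_nonzero_iff_nonzero.2 hF
  -- A piece has no higher top degree and no lower bottom degree than the whole. Since `G' * H' = G
  -- * H`, both degrees agree for each factor.
  have d1 := le_natDegree_of_ne_zero (hGs _ (hlead hG.ne_zero))
  have d2 := le_natDegree_of_ne_zero (hHs _ (hlead hH))
  have d3 := natTrailingDegree_le_of_ne_zero (hGs _ (htrail hG.ne_zero))
  have d4 := natTrailingDegree_le_of_ne_zero (hHs _ (htrail hH))
  have d5 := congrArg natDegree hGH
  have d6 := congrArg natTrailingDegree hGH
  rw [natDegree_mul hG'0 hH'0, natDegree_mul hG.ne_zero hH] at d5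
  rw [natTrailingDegree_mul hG'0 hH'0, natTrailingDegree_mul hG.ne_zero hH] at d6
  have hdeg : G.natDegree = G'.natDegree := by omega
  -- In the top degree `G'` is a component of the leading coefficient `1` of `g`, and its constant
  -- term agrees with that of `G`.
  have hG'm : G'.Monic := by
    have h0 : point 0 G.natDegree ∈ E₁ := hGm1 _ _ (by rw [hG.coeff_natDegree]; simp)
    have h00 := hGm2 _ _ h0
    rw [hG.coeff_natDegree] at h00
    rw [Monic, ← coeff_natDegree, ← hdeg]
    ext α
    rcases eq_or_ne α 0 with rfl | hα
    · exact h00.symm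
    · have h5 := coeff_toSeries G' G.natDegree α
      rw [← hg'.component_eq, coeff_component, ← hgd, hgm.coeff_natDegree,
        MvPowerSeries.coeff_one, if_neg hα, ite_self] at h5
      rw [← hgd, ← h5, MvPolynomial.coeff_one, if_neg hα.symm]
  obtain ⟨homG, homH⟩ := IsHomogeneousAlong.of_mul (by rwa [hGH]) hG'm hH'0
  have hconv : ∀ {Δ A : Set ((Fin n → ℝ) × ℝ)}, Convex ℝ Δ → IsCompactFace Δ A → Convex ℝ A := by
    rintro Δ _ hΔ ⟨⟨ξ, -, rfl⟩, -⟩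
    exact convex_face hΔ ξ
  have e1 : G = G' := eq_of_restriction (hconv (convex_convexHull ℝ _) hE₁) homG hGm1 hGm2
    hG.ne_zero hdeg (by omega)
  have e2 : H = H' := eq_of_restriction (hconv (convex_convexHull ℝ _) hE₂) homH hHm1 hHm2
    hH (by omega) (by omega)
  exact ⟨s, t, e1 ▸ hg', e2 ▸ hh'⟩

/-- Factors with relatively prime initial forms are unique. -/
lemma eq_of_hasInitialForm (hc : ∀ i, 0 ≤ c i) {G H : (MvPolynomial (Fin n) K)[X]}
    (hG : G.Monic) (hrel : IsRelPrime G H) {g h g' h' : (MvPowerSeries (Fin n) K)[X]}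
    (heq : g * h = g' * h') (hg : g.Monic) (hg' : g'.Monic) (hd : g.natDegree = G.natDegree)
    (hd' : g'.natDegree = G.natDegree) {s t : ℝ}
    (hiG : HasInitialForm (totalWeight c) g' s (toSeries G))
    (hiH : HasInitialForm (totalWeight c) h t (toSeries H)) : g = g' := by
  classical
  by_contra hne
  have hφ : g - g' ≠ 0 := sub_ne_zero.2 hne
  -- Only one factor from each factorization needs a known initial form: `h` from one and `g'` from
  -- the other.
  have hrelation : (g - g') * h = g' * (h' - h) := by linear_combination heq
  have hh0 : h ≠ 0 := by
    rintro rfl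
    obtain ⟨j, α, hne, -⟩ := hiH.exists_coeff
    simp at hne
  have hψ : h' - h ≠ 0 := fun h0 => mul_ne_zero hφ hh0 (by rw [hrelation, h0, mul_zero])
  obtain ⟨s₁, φ, hφi⟩ := exists_hasInitialForm hφ (finite_totalWeight_le hc _)
  obtain ⟨t₁, ψ, hψi⟩ := exists_hasInitialForm hψ (finite_totalWeight_le hc _)
  have h1 := hφi.mul (totalWeight_add c) hiH
  rw [hrelation] at h1
  have h2 := (h1.unique (hiG.mul (totalWeight_add c) hψi)).2
  obtain ⟨A, B, r, hr, hAB⟩ := exists_mul_add_mul_eq_C hG hrel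
  have h3 := congrArg toSeries hAB
  rw [map_add, map_mul, map_mul] at h3
  have hdvd : toSeries G ∣ toSeries (C r) * φ :=
    ⟨toSeries A * φ + toSeries B * ψ, by
      linear_combination (-φ) * h3 + toSeries B * h2⟩
  have hmon : (toSeries G).Monic := hG.map _
  have hCr : toSeries (C r) = C (MvPolynomial.coeToMvPowerSeries.ringHom r) := map_C _
  have hr' : MvPolynomial.coeToMvPowerSeries.ringHom r ≠ (0 : MvPowerSeries (Fin n) K) := by
    intro h0
    refine hr (C_injective (toSeries_injective ?_))
    rw [hCr, h0, C_0, C_0, map_zero]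
  -- Both `g` and `g'` are monic of degree `deg G`, so their difference, and hence its initial form,
  -- has smaller degree.
  have hdeg : (toSeries (C r) * φ).degree < (toSeries G).degree := by
    have hGd : (toSeries G).natDegree = G.natDegree := hG.natDegree_map _
    rw [degree_eq_natDegree hmon.ne_zero, hGd, degree_lt_iff_coeff_zero]
    intro j hj
    have : φ.coeff j = 0 := by
      ext α
      rw [← hφi.component_eq, coeff_component, coeff_sub]
      have : g.coeff j = g'.coeff j := by
        rcases hj.eq_or_lt with rfl | hlt
        · conv_lhs => rw [← hd, hg.coeff_natDegree]
          rw [← hd', hg'.coeff_natDegree]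
        · rw [coeff_eq_zero_of_natDegree_lt (by omega), coeff_eq_zero_of_natDegree_lt (by omega)]
      rw [this, sub_self, map_zero, ite_self]
    rw [hCr, coeff_C_mul, this, mul_zero]
  have h4 := eq_zero_of_dvd_of_degree_lt hdvd hdeg
  rw [hCr] at h4
  exact mul_ne_zero (C_ne_zero.2 hr') hφi.ne_zero h4

end Uniqueness

/-! ### Existence and uniqueness over formal power series, and the theorem. -/

section Conclusion

open Polynomial

instance {K : Type*} [Field K] {n : ℕ} : IsAdicComplete
    (Ideal.span (Set.range fun i : Fin n => (MvPowerSeries.X i : MvPowerSeries (Fin n) K)))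
    (MvPowerSeries (Fin n) K) :=
  inferInstanceAs (IsAdicComplete (Ideal.span (Set.range MvPowerSeries.X))
    (MvPowerSeries (Fin n) K))

theorem existsUnique_isFactorizationAlong {K : Type*} [Field K] {n : ℕ}
    {f : (MvPowerSeries (Fin n) K)[X]} {P : (MvPolynomial (Fin n) (MvPowerSeries (Fin n) K))[X]}
    (hP : IsExpansion (fun i => MvPowerSeries.X i) f P) {E : Set ((Fin n → ℝ) × ℝ)}
    (hE : IsLooseEdge (newtonPolyhedron P) E) (hd : IsDescendant E)
    {G H : (MvPolynomial (Fin n) K)[X]}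
    (hGH : symbolicRestriction MvPowerSeries.constantCoeff P E = G * H) (hrel : IsRelPrime G H)
    (hG : G.Monic) :
    ∃! gh : (MvPowerSeries (Fin n) K)[X] × (MvPowerSeries (Fin n) K)[X],
      IsFactorizationAlong (fun i => MvPowerSeries.X i) MvPowerSeries.constantCoeff E G H f
        gh.1 gh.2 := by
  classical
  obtain ⟨c, e, hc, hcpos, hge, hom, hcoeff, hEq, h0⟩ :=
    exists_slope_of_isLooseEdge hE hd hP.zero_or_isUnit hGH
  have hH : H ≠ 0 := right_ne_zero_of_mul h0
  have hsurj : Function.Surjective (MvPowerSeries.constantCoeff (σ := Fin n) (R := K)) :=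
    fun a => ⟨MvPowerSeries.C a, MvPowerSeries.constantCoeff_C a⟩
  obtain ⟨g, h, hgh⟩ := exists_isFactorizationAlong hsurj ker_constantCoeff hc hcpos hP.map_eval hge
    hom hcoeff hrel hG hH
  subst hEq
  have hf : HasInitialForm (totalWeight c) f (∑ i, e i) (toSeries (G * H)) :=
    hP.hasInitialForm_toSeries hge hom hcoeff h0
  refine ⟨(g, h), hgh, ?_⟩
  rintro ⟨g', h'⟩ hgh'
  obtain ⟨s, t, hg1, -⟩ := hgh.hasInitialForm hcpos hom hG hH hf
  obtain ⟨s', t', -, hh1⟩ := hgh'.hasInitialForm hcpos hom hG hH hf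
  have hgg : g' = g := eq_of_hasInitialForm hc hG hrel (hgh'.eq_mul.symm.trans hgh.eq_mul)
    hgh'.monic hgh.monic hgh'.natDegree_eq hgh.natDegree_eq hg1 hh1
  subst hgg
  have := mul_left_cancel₀ hgh.monic.ne_zero (hgh'.eq_mul.symm.trans hgh.eq_mul)
  exact Prod.ext rfl this

end Conclusion

end LooseEdge

theorem theorem1p5 :
    -- regular local rings: existence over the completion
    (∀ (R : Type*) [CommRing R] [IsRegularLocalRing R] (n : ℕ) (x : Fin n → R),
      LooseEdge.IsRegularSystemOfParameters x →
      ∀ (f : Polynomial R) (P : Polynomial (MvPolynomial (Fin n) R)),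
      LooseEdge.IsExpansion x f P →
      ∀ (E : Set ((Fin n → ℝ) × ℝ)),
      LooseEdge.IsLooseEdge (LooseEdge.newtonPolyhedron P) E →
      LooseEdge.IsDescendant E →
      ∀ (G H : Polynomial (MvPolynomial (Fin n) (IsLocalRing.ResidueField R))),
      LooseEdge.symbolicRestriction (IsLocalRing.residue R) P E = G * H →
      IsRelPrime G H →
      G.Monic →
      ∃ g h : Polynomial (AdicCompletion (IsLocalRing.maximalIdeal R) R),
        LooseEdge.IsFactorizationAlong
          (fun i => algebraMap R (AdicCompletion (IsLocalRing.maximalIdeal R) R) (x i))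
          (LooseEdge.completionResidue R) E G H
          (f.map (algebraMap R (AdicCompletion (IsLocalRing.maximalIdeal R) R))) g h) ∧
    -- formal power series over a field: existence and uniqueness
    (∀ (K : Type*) [Field K] (n : ℕ) (f : Polynomial (MvPowerSeries (Fin n) K))
      (P : Polynomial (MvPolynomial (Fin n) (MvPowerSeries (Fin n) K))),
      LooseEdge.IsExpansion (fun i => MvPowerSeries.X i) f P →
      ∀ (E : Set ((Fin n → ℝ) × ℝ)),
      LooseEdge.IsLooseEdge (LooseEdge.newtonPolyhedron P) E →
      LooseEdge.IsDescendant E →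
      ∀ (G H : Polynomial (MvPolynomial (Fin n) K)),
      LooseEdge.symbolicRestriction MvPowerSeries.constantCoeff P E = G * H →
      IsRelPrime G H →
      G.Monic →
      ∃! gh : Polynomial (MvPowerSeries (Fin n) K) × Polynomial (MvPowerSeries (Fin n) K),
        LooseEdge.IsFactorizationAlong (fun i => MvPowerSeries.X i)
          MvPowerSeries.constantCoeff E G H f gh.1 gh.2) := by
  refine ⟨fun R _ _ n x hx f P hP E hE hd G H hGH hrel hG => ?_,
    fun K _ n f P hP E hE hd G H hGH hrel hG => ?_⟩
  · exact LooseEdge.exists_isFactorizationAlong_completion hx.span_range hP hE hd hGH hrel hG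
  · exact LooseEdge.existsUnique_isFactorizationAlong hP hE hd hGH hrel hG
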